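/- Let $(N,J,h)$ be a compact Kähler manifold of complex dimension $n$, with Levi-Civita connection $\nabla$ and curvature tensor $R(X,Y)Z=\nabla_X\nabla_YZ-\nabla_Y\nabla_XZ-\nabla_{[X,Y]}Z$. Let $0<T\le\infty$, let $a\neq0$, $b$, $c$, $\lambda$ be real constants, and let $u^\infty\in N$. Let $u:(-T,T)\times\mathbb R\to N$ be a smooth map such that $\lim_{x\to-\infty}u(t,x)=u^\infty$ for every $t$ and such that $u_x(t,\cdot)$ is in the Schwartz class locally uniformly in $t$, that is, for all $k,l\ge0$ and every compact $K\subset(-T,T)$, $\sup_{t\in K,\,x\in\mathbb R}|x|^k\,|\nabla_x^l u_x(t,x)|_h<\infty$. Suppose that $u$ solves $$u_t=a\,J_u\nabla_x^3u_x+\lambda\,J_u\nabla_xu_x+b\,R(\nabla_xu_x,u_x)J_uu_x+c\,R(J_uu_x,u_x)\nabla_xu_x .$$ Let $e_1^\infty,\dots,e_n^\infty\in T_{u^\infty}N$ be such that $\{e^\infty_j,Je^\infty_j\}_{j=1}^n$ is an orthonormal basis of $T_{u^\infty}N$. Then there is a smooth orthonormal frame $\{e_j,J_ue_j\}_{j=1}^n$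 of $u^{-1}TN$ on $(-T,T)\times\mathbb R$ with $\nabla_xe_j=0$ and $\lim_{x\to-\infty}e_j(t,x)=e_j^\infty$ for all $t$ and $j$. For every such frame, set $Q_j=h(u_x,e_j)+\sqrt{-1}\,h(u_x,J_ue_j)$ and $$S^j_{p,q,r}=\tfrac12\left\{h(R(e_p,e_q)e_r,e_j)+\sqrt{-1}\,h(R(e_p,e_q)e_r,J_ue_j)\right\}+\tfrac{\sqrt{-1}}2\left\{h(R(e_p,J_ue_q)e_r,e_j)+\sqrt{-1}\,h(R(e_p,J_ue_q)e_r,J_ue_j)\right\}.$$ Then all $Q_j$ and $S^j_{p,q,r}$ are smooth complex-valued functions on $(-T,T)\times\mathbb R$ and, for each $j\in\{1,\dots,n\}$, at every $(t,x)\in(-T,T)\times\mathbb R$, $$\begin{aligned} &\sqrt{-1}\,\partial_tQ_j+(a\partial_x^4+\lambda\partial_x^2)Q_j\\ &=d_1\sum_{p,q,r}S^j_{p,q,r}\,\partial_x^2Q_p\overline{Q_q}Q_r+d_2\sum_{p,q,r}S^j_{p,q,r}\,Q_p\overline{\partial_x^2Q_q}Q_r+d_3\sum_{p,q,r}S^j_{p,q,r}\,\partial_xQ_p\overline{\partial_xQ_q}Q_r\\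 &\quad+d_4\sum_{p,q,r}S^j_{p,q,r}\,\partial_xQ_p\overline{Q_q}\,\partial_xQ_r+d_5\sum_{p,q,r}\partial_x(S^j_{p,q,r})\,\partial_xQ_p\overline{Q_q}Q_r+d_6\sum_{p,q,r}\partial_x(S^j_{p,q,r})\,Q_p\overline{\partial_xQ_q}Q_r\\ &\quad-\lambda\sum_{p,q,r}S^j_{p,q,r}\,Q_p\overline{Q_q}Q_r+\sum_{r}\Big(\int_{-\infty}^xf^1_{j,r}(t,y)\,dy\Big)Q_r+\sum_{r}\Big(\int_{-\infty}^xf^2_{j,r}(t,y)\,dy\Big)Q_r , \end{aligned}$$ where all indices run over $\{1,\dots,n\}$, $d_1=-a-b-2c$, $d_2=-a+b$, $d_3=a+b-2c$, $d_4=-b-2c$, $d_5=a-b-2c$, $d_6=a+b$, $$\begin{aligned} f^1_{j,r}&=-(b+2c)\sum_{p,q,\alpha,\beta,\gamma}S^j_{p,q,r}\overline{S^q_{\alpha,\beta,\gamma}}\;\overline{\partial_xQ_\alpha}Q_\beta\overline{Q_\gamma}Q_p-(b+2c)\sum_{p,q,\alpha,\beta,\gamma}S^j_{p,q,r}S^p_{\alpha,\beta,\gamma}\,\partial_xQ_\alpha\overline{Q_\beta}Q_\gamma\overline{Q_q}\\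 &\quad+b\sum_{p,q,\alpha,\beta,\gamma}S^j_{p,q,r}\overline{S^q_{\alpha,\beta,\gamma}}\;\overline{Q_\alpha}\,\partial_xQ_\beta\overline{Q_\gamma}Q_p+b\sum_{p,q,\alpha,\beta,\gamma}S^j_{p,q,r}S^p_{\alpha,\beta,\gamma}\,Q_\alpha\overline{\partial_xQ_\beta}Q_\gamma\overline{Q_q},\\ f^2_{j,r}&=-a\sum_{p,q}\partial_x^2(S^j_{p,q,r})\left(\partial_xQ_p\overline{Q_q}+Q_p\overline{\partial_xQ_q}\right)-3a\sum_{p,q}\partial_x(S^j_{p,q,r})\,\partial_xQ_p\overline{\partial_xQ_q}+\lambda\sum_{p,q}\partial_x(S^j_{p,q,r})\,Q_p\overline{Q_q}, \end{aligned}$$ and the functions $f^1_{j,r}(t,\cdot)$ and $f^2_{j,r}(t,\cdot)$ are integrable on $(-\infty,x]$. -/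

import Mathlib

open scoped Manifold ContDiff Topology

noncomputable section

namespace KahlerFlow

/-! ### Complex manifolds as real manifolds

A complex manifold of dimension `n` is a manifold modelled on a complex vector space `E` of
dimension `n` with holomorphic transition maps.  Its real tangent spaces are
`TangentSpace 𝓘(ℝ, E) p`; Mathlib realises `TangentSpace 𝓘(ℝ, E) p` as `E` by means of the
preferred chart at `p`. -/

/-- A complex manifold is a smooth real manifold. -/
instance isManifoldReal {E : Type*} [NormedAddCommGroup E] [NormedSpace ℂ E]
    {N : Type*} [TopologicalSpace N] [ChartedSpace E N] [IsManifold 𝓘(ℂ, E) ω N] :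
    IsManifold 𝓘(ℝ, E) ∞ N := by
  refine isManifold_of_contDiffOn 𝓘(ℝ, E) ∞ N fun e e' he he' => ?_
  have h := (contDiffGroupoid ω 𝓘(ℂ, E)).compatible he he'
  rw [contDiffGroupoid, mem_groupoid_of_pregroupoid] at h
  exact (h.1.restrict_scalars ℝ).of_le le_top

section Geometry

variable {E : Type*} [NormedAddCommGroup E] [NormedSpace ℂ E]
  {N : Type*} [TopologicalSpace N] [ChartedSpace E N] [IsManifold 𝓘(ℂ, E) ω N]

/-- The complex structure `J`: multiplication by `i` on the tangent space.  (The coordinate changes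
of the tangent bundle are complex linear, so this does not depend on the chart.) -/
def J {p : N} (v : TangentSpace 𝓘(ℝ, E) p) : TangentSpace 𝓘(ℝ, E) p :=
  let w : E := v
  Complex.I • w

/-- Smooth Riemannian metrics on (the real tangent bundle of) `N`. -/
abbrev RMetric (E : Type*) [NormedAddCommGroup E] [NormedSpace ℂ E]
    (N : Type*) [TopologicalSpace N] [ChartedSpace E N] [IsManifold 𝓘(ℂ, E) ω N] :=
  Bundle.ContMDiffRiemannianMetric 𝓘(ℝ, E) ∞ E (fun p : N => TangentSpace 𝓘(ℝ, E) p)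

/-- The metric in the coordinates of the preferred chart at `p`, at the coordinate point `y`. -/
def metricInChart (h : RMetric E N) (p : N) (y : E) : E →L[ℝ] E →L[ℝ] ℝ :=
  let q : N := (extChartAt 𝓘(ℝ, E) p).symm y
  let L : E →L[ℝ] E := tangentCoordChange 𝓘(ℝ, E) p q q
  ContinuousLinearMap.bilinearComp (h.inner q) L L

/-- The Christoffel symbols `Γ(v, w) = v^k w^l Γ_{kl}` of the Levi-Civita connection, in the
coordinates of the preferred chart at `p`, at the coordinate point `y`: with `G` the metric in these
coordinates, `G(Γ(v, w), z) = ½ (D_v G (w, z) + D_w G (v, z) - D_z G (v, w))` for all `z`. -/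
def christoffel (h : RMetric E N) (p : N) (y : E) (v w : E) : E :=
  let G : E → E →L[ℝ] E →L[ℝ] ℝ := metricInChart h p
  let ℓ : E →L[ℝ] ℝ := (1 / 2 : ℝ) •
    (fderiv ℝ G y v w + fderiv ℝ G y w v - ((fderiv ℝ G y).flip v).flip w)
  ContinuousLinearMap.inverse (G y) ℓ

/-- The Riemann curvature tensor `R(X, Y) Z = ∇_X ∇_Y Z - ∇_Y ∇_X Z - ∇_{[X, Y]} Z` in the
coordinates of the preferred chart at `p`, at the coordinate point `y`, computed with the constant
extensions of `X`, `Y`, `Z`. -/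
def curvatureInChart (h : RMetric E N) (p : N) (y : E) (X Y Z : E) : E :=
  fderiv ℝ (fun y' => christoffel h p y' Y Z) y X - fderiv ℝ (fun y' => christoffel h p y' X Z) y Y
    + christoffel h p y X (christoffel h p y Y Z) - christoffel h p y Y (christoffel h p y X Z)

/-- The Riemann curvature tensor `R(X, Y) Z` at `p`. -/
def curvature (h : RMetric E N) {p : N} (X Y Z : TangentSpace 𝓘(ℝ, E) p) :
    TangentSpace 𝓘(ℝ, E) p :=
  (curvatureInChart h p (extChartAt 𝓘(ℝ, E) p p) X Y Z : E)

/-- `(N, J, h)` is Kähler: `h` is Hermitian and `∇J = 0`.  In a holomorphic chart `J` is the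
constant endomorphism `i`, so that `(∇_v J) w = Γ(v, i w) - i Γ(v, w)`. -/
structure IsKahler (h : RMetric E N) : Prop where
  hermitian : ∀ (p : N) (v w : TangentSpace 𝓘(ℝ, E) p), h.inner p (J v) (J w) = h.inner p v w
  parallel_J : ∀ (p : N), ∀ y ∈ (extChartAt 𝓘(ℝ, E) p).target, ∀ v w : E,
    christoffel h p y v (Complex.I • w) = Complex.I • christoffel h p y v w

/-- The covariant derivative at the parameter `s` of the vector field `V` along the curve `γ`, in
the coordinates of the preferred chart at `γ s`: `∇V = dV/ds + Γ(γ', V)`. -/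
def covDerivAlong (h : RMetric E N) (γ : ℝ → N) (V : ∀ s, TangentSpace 𝓘(ℝ, E) (γ s)) (s : ℝ) :
    TangentSpace 𝓘(ℝ, E) (γ s) :=
  (deriv (fun σ => tangentCoordChange 𝓘(ℝ, E) (γ σ) (γ s) (γ σ) (V σ : E)) s
    + christoffel h (γ s) (extChartAt 𝓘(ℝ, E) (γ s) (γ s))
        (mfderiv 𝓘(ℝ, ℝ) 𝓘(ℝ, E) γ s (1 : ℝ)) (V s) : E)

/-! ### Maps `u = u(t, x)` into `N` and vector fields along them -/

/-- Vector fields along `u`, that is, (not necessarily smooth) sections of `u⁻¹TN`. -/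
abbrev VF (E : Type*) [NormedAddCommGroup E] [NormedSpace ℂ E]
    {N : Type*} [TopologicalSpace N] [ChartedSpace E N] (u : ℝ → ℝ → N) :=
  ∀ t x : ℝ, TangentSpace 𝓘(ℝ, E) (u t x)

/-- `u_x`. -/
def velX (E : Type*) [NormedAddCommGroup E] [NormedSpace ℂ E]
    {N : Type*} [TopologicalSpace N] [ChartedSpace E N] (u : ℝ → ℝ → N) : VF E u :=
  fun t x => mfderiv 𝓘(ℝ, ℝ) 𝓘(ℝ, E) (fun y => u t y) x (1 : ℝ)

/-- `u_t`. -/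
def velT (E : Type*) [NormedAddCommGroup E] [NormedSpace ℂ E]
    {N : Type*} [TopologicalSpace N] [ChartedSpace E N] (u : ℝ → ℝ → N) : VF E u :=
  fun t x => mfderiv 𝓘(ℝ, ℝ) 𝓘(ℝ, E) (fun s => u s x) t (1 : ℝ)

/-- `∇_x V`. -/
def nablaX (h : RMetric E N) (u : ℝ → ℝ → N) (V : VF E u) : VF E u :=
  fun t x => covDerivAlong h (fun y => u t y) (fun y => V t y) x

/-- The time interval `(-T, T)`, where `0 < T ≤ ∞`. -/
def timeInterval (T : EReal) : Set ℝ := {t | ((|t| : ℝ) : EReal) < T}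

/-- The domain `(-T, T) × ℝ`. -/
def spaceTime (T : EReal) : Set (ℝ × ℝ) := timeInterval T ×ˢ Set.univ

/-- The class of smooth maps `u : (-T, T) × ℝ → N` with `u(t, x) → u^∞` as `x → -∞` and with `u_x`
in the Schwartz class, locally uniformly in `t`. -/
structure IsAdmissible (h : RMetric E N) (T : EReal) (uinf : N) (u : ℝ → ℝ → N) : Prop where
  smooth : ContMDiffOn 𝓘(ℝ, ℝ × ℝ) 𝓘(ℝ, E) ∞ (fun z : ℝ × ℝ => u z.1 z.2) (spaceTime T)
  tendsto : ∀ t ∈ timeInterval T, Filter.Tendsto (u t) Filter.atBot (𝓝 uinf)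
  schwartz : ∀ k l : ℕ, ∀ K ⊆ timeInterval T, IsCompact K → ∃ C : ℝ, ∀ t ∈ K, ∀ x : ℝ,
    |x| ^ k * √(h.inner (u t x) ((nablaX h u)^[l] (velX E u) t x)
      ((nablaX h u)^[l] (velX E u) t x)) ≤ C

/-- `u_t = a J ∇_x³ u_x + λ J ∇_x u_x + b R(∇_x u_x, u_x) J u_x + c R(J u_x, u_x) ∇_x u_x`
on `(-T, T) × ℝ`. -/
def IsSolution (h : RMetric E N) (a lam b c : ℝ) (T : EReal) (u : ℝ → ℝ → N) : Prop :=
  let ux : VF E u := velX E u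
  let dux : VF E u := nablaX h u ux
  ∀ t ∈ timeInterval T, ∀ x : ℝ,
    velT E u t x = a • J ((nablaX h u)^[3] ux t x) + lam • J (dux t x)
      + b • curvature h (dux t x) (ux t x) (J (ux t x))
      + c • curvature h (J (ux t x)) (ux t x) (dux t x)

/-- `e_1, …, e_n, J e_1, …, J e_n` is an orthonormal family at `p`. -/
def IsUnitaryFrame (h : RMetric E N) {n : ℕ} {p : N} (e : Fin n → TangentSpace 𝓘(ℝ, E) p) : Prop :=
  ∀ i j, h.inner p (e i) (e j) = (if i = j then 1 else 0) ∧ h.inner p (e i) (J (e j)) = 0 ∧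
    h.inner p (J (e i)) (J (e j)) = (if i = j then 1 else 0)

/-- `{e_j, J e_j}` is a smooth orthonormal frame for `u⁻¹TN` on `(-T, T) × ℝ` with `∇_x e_j = 0`
and `e_j(t, x) → e_j^∞` as `x → -∞`. -/
structure IsParallelFrame (h : RMetric E N) (T : EReal) (u : ℝ → ℝ → N) {n : ℕ} {uinf : N}
    (einf : Fin n → TangentSpace 𝓘(ℝ, E) uinf) (e : Fin n → VF E u) : Prop where
  smooth : ∀ j, ContMDiffOn 𝓘(ℝ, ℝ × ℝ) 𝓘(ℝ, E).tangent ∞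
    (fun z : ℝ × ℝ => (⟨u z.1 z.2, e j z.1 z.2⟩ : TangentBundle 𝓘(ℝ, E) N)) (spaceTime T)
  orthonormal : ∀ t ∈ timeInterval T, ∀ x, IsUnitaryFrame h (fun j => e j t x)
  parallel : ∀ j, ∀ t ∈ timeInterval T, ∀ x, nablaX h u (e j) t x = 0
  tendsto : ∀ j, ∀ t ∈ timeInterval T,
    Filter.Tendsto (fun x => (⟨u t x, e j t x⟩ : TangentBundle 𝓘(ℝ, E) N)) Filter.atBot
      (𝓝 ⟨uinf, einf j⟩)

/-- `⟨Ξ⟩_e = h(Ξ, e) + i h(Ξ, J e)`. -/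
def comp (h : RMetric E N) {p : N} (Ξ e : TangentSpace 𝓘(ℝ, E) p) : ℂ :=
  (h.inner p Ξ e : ℂ) + Complex.I * (h.inner p Ξ (J e) : ℂ)

/-- `Q_j = h(u_x, e_j) + i h(u_x, J e_j)`. -/
def Qfun (h : RMetric E N) {u : ℝ → ℝ → N} {n : ℕ} (e : Fin n → VF E u)
    (j : Fin n) (t x : ℝ) : ℂ :=
  comp h (velX E u t x) (e j t x)

/-- `S^j_{p,q,r} = ½ (R^{A,j}_{p,q,r} + i R^{B,j}_{p,q,r})`, where `R^{A,j}_{p,q,r}` and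
`R^{B,j}_{p,q,r}` are the `j`-th complex components of `R(e_p, e_q) e_r` and
`R(e_p, J e_q) e_r`. The arguments are in the order `j p q r`. -/
def Sfun (h : RMetric E N) {u : ℝ → ℝ → N} {n : ℕ} (e : Fin n → VF E u)
    (j p q r : Fin n) (t x : ℝ) : ℂ :=
  (1 / 2) * (comp h (curvature h (e p t x) (e q t x) (e r t x)) (e j t x)
    + Complex.I * comp h (curvature h (e p t x) (J (e q t x)) (e r t x)) (e j t x))

end Geometry

/-! ### The system for `Q_1, …, Q_n` -/

/-- `∂_x F`. -/
def dx (F : ℝ → ℝ → ℂ) : ℝ → ℝ → ℂ := fun t x => deriv (fun y => F t y) x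

/-- `∂_t F`. -/
def dt (F : ℝ → ℝ → ℂ) : ℝ → ℝ → ℂ := fun t x => deriv (fun s => F s x) t

section System

open scoped ComplexConjugate

variable {n : ℕ}

/-- The nonlocal density `f¹_{j,r}(Q, ∂_x Q)`. -/
def f1 (b c : ℝ) (S : Fin n → Fin n → Fin n → Fin n → ℝ → ℝ → ℂ) (Q : Fin n → ℝ → ℝ → ℂ)
    (j r : Fin n) (t x : ℝ) : ℂ :=
  -(b + 2 * c) * (∑ p, ∑ q, ∑ α, ∑ β, ∑ γ, S j p q r t x * conj (S q α β γ t x)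
      * conj (dx (Q α) t x) * Q β t x * conj (Q γ t x) * Q p t x)
  - (b + 2 * c) * (∑ p, ∑ q, ∑ α, ∑ β, ∑ γ, S j p q r t x * S p α β γ t x
      * dx (Q α) t x * conj (Q β t x) * Q γ t x * conj (Q q t x))
  + b * (∑ p, ∑ q, ∑ α, ∑ β, ∑ γ, S j p q r t x * conj (S q α β γ t x)
      * conj (Q α t x) * dx (Q β) t x * conj (Q γ t x) * Q p t x)
  + b * (∑ p, ∑ q, ∑ α, ∑ β, ∑ γ, S j p q r t x * S p α β γ t x
      * Q α t x * conj (dx (Q β) t x) * Q γ t x * conj (Q q t x))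

/-- The nonlocal density `f²_{j,r}(Q, ∂_x Q)`. -/
def f2 (a lam : ℝ) (S : Fin n → Fin n → Fin n → Fin n → ℝ → ℝ → ℂ) (Q : Fin n → ℝ → ℝ → ℂ)
    (j r : Fin n) (t x : ℝ) : ℂ :=
  -a * (∑ p, ∑ q, dx (dx (S j p q r)) t x
      * (dx (Q p) t x * conj (Q q t x) + Q p t x * conj (dx (Q q) t x)))
  - 3 * a * (∑ p, ∑ q, dx (S j p q r) t x * dx (Q p) t x * conj (dx (Q q) t x))
  + lam * (∑ p, ∑ q, dx (S j p q r) t x * Q p t x * conj (Q q t x))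

/-- The `j`-th equation of the system at `(t, x)`. -/
def SystemEq (a lam b c : ℝ) (S : Fin n → Fin n → Fin n → Fin n → ℝ → ℝ → ℂ)
    (Q : Fin n → ℝ → ℝ → ℂ) (j : Fin n) (t x : ℝ) : Prop :=
  let d₁ : ℝ := -a - b - 2 * c
  let d₂ : ℝ := -a + b
  let d₃ : ℝ := a + b - 2 * c
  let d₄ : ℝ := -b - 2 * c
  let d₅ : ℝ := a - b - 2 * c
  let d₆ : ℝ := a + b
  Complex.I * dt (Q j) t x + (a * dx^[4] (Q j) t x + lam * dx^[2] (Q j) t x) =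
    d₁ * (∑ p, ∑ q, ∑ r, S j p q r t x * dx^[2] (Q p) t x * conj (Q q t x) * Q r t x)
    + d₂ * (∑ p, ∑ q, ∑ r, S j p q r t x * Q p t x * conj (dx^[2] (Q q) t x) * Q r t x)
    + d₃ * (∑ p, ∑ q, ∑ r, S j p q r t x * dx (Q p) t x * conj (dx (Q q) t x) * Q r t x)
    + d₄ * (∑ p, ∑ q, ∑ r, S j p q r t x * dx (Q p) t x * conj (Q q t x) * dx (Q r) t x)
    + d₅ * (∑ p, ∑ q, ∑ r, dx (S j p q r) t x * dx (Q p) t x * conj (Q q t x) * Q r t x)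
    + d₆ * (∑ p, ∑ q, ∑ r, dx (S j p q r) t x * Q p t x * conj (dx (Q q) t x) * Q r t x)
    - lam * (∑ p, ∑ q, ∑ r, S j p q r t x * Q p t x * conj (Q q t x) * Q r t x)
    + (∑ r, (∫ y in Set.Iic x, f1 b c S Q j r t y) * Q r t x)
    + (∑ r, (∫ y in Set.Iic x, f2 a lam S Q j r t y) * Q r t x)

end System

end KahlerFlow

end

/-! In a frame that is parallel in x, the operator ∂_x acts on components as ∇_x acts on fields, and
taking complex components turns J into multiplication by i. The Kähler condition gives R(X,Y)Z =
P(X,Y)Z − P(Y,X)Z with P = `curvPart` complex linear in X and Z, conjugate linear in Y, and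
symmetric in X and Z; S is the component array of P. Hence the flow says that u_t has components
iF_j, where F = `fluxFn` is built from Q, its x derivatives and S (`compField_flowField`).

Absence of torsion, ∇_t u_x = ∇_x u_t, then gives ∂_t Q_j + Σ_r ω_jr Q_r = i ∂_x F_j with ω_jr =
⟨∇_t e_r, e_j⟩ (`evolution`). Since ∇_x e_r = 0, the derivative ∂_x ω_jr is a component of R(u_x,
u_t)e_r, hence explicit in S, Q and F (`hasDerivAt_connection`). If ω → 0 as x → −∞, it is recovered
by integration. The terms of highest order in −i ∂_x ω are integrated by parts: subtracting the
derivative of `boundaryFn` leaves exactly f¹ + f² (`hasDerivAt_density`), and collecting terms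
produces the coefficients d_k (`systemEq_of`).

The analytic content is the existence of the frame, the limit ω → 0 and the integrability of f¹ and
f². The hypotheses give convergence to u^∞ only for each t separately, and decay only for x
derivatives of u. Three facts close the gap. Integrating the speed |u_x| shows that u stays, locally
uniformly in t, in a compact part of one chart as x → −∞ (`exists_region`). In that chart,
polynomials in the jets ∇_x^l u_x with smooth coefficients form a class closed under ∂_x and, by the
equation, under ∂_t (`JetPoly`, `jetVec_time_jet`); those with a jet factor in each monomial are
O((1+x²)⁻¹). Writing V = Σ c_i X_i(u) with finitely many global fields X_i spanning TN turns ∇_x V =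
0 into a linear equation c_x = Bc on the whole line, where B and all ∂_t^k B decay at −∞. Its Picard
series started at −∞ is smooth in (t,x), and its t derivative tends to 0 (`exists_smooth_solution`),
so ∇_t V → 0 (`exists_parallel`).

Inner products of parallel fields are constant. So orthonormal data at −∞ yield an orthonormal
frame, and a parallel field is determined by its limit (`eq_of_parallel`). Every frame as in the
statement therefore coincides with the constructed one and has ω → 0
(`IsParallelFrame.unitaryFrame`).

Curvature and ∇_x at a point are defined in the preferred chart of that very point. Before anything
can be differentiated they are transported to a fixed chart, by proving that transition maps are
local isometries and that Γ, R and ∇ transform accordingly. -/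

noncomputable section
namespace KahlerFlow

/-! ### Linear ordinary differential equations with data at `-∞`, depending on a parameter -/

section LinearODE

open MeasureTheory Set Filter

/-! ### Integrals over half lines depending on a parameter -/

section Integral

variable {F : Type*} [NormedAddCommGroup F]

/-- `‖g(t, x)‖ ≤ C (1 + x²)⁻¹` on every half line `x ≤ X`, locally uniformly in `t ∈ I`. -/
def DecaysAtBot (I : Set ℝ) (g : ℝ → ℝ → F) : Prop :=
  ∀ t₀ ∈ I, ∀ X : ℝ, ∃ C : ℝ, 0 ≤ C ∧ ∀ᶠ t in 𝓝 t₀, ∀ x ≤ X, ‖g t x‖ ≤ C * (1 + x ^ 2)⁻¹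

lemma integrableOn_Iic_of_decay {g : ℝ → F} (hc : Continuous g) {C X : ℝ}
    (hb : ∀ x ≤ X, ‖g x‖ ≤ C * (1 + x ^ 2)⁻¹) : IntegrableOn g (Iic X) := by
  refine Integrable.mono' (g := fun x => C * (1 + x ^ 2)⁻¹) ?_ hc.aestronglyMeasurable ?_
  · exact (integrable_inv_one_add_sq.const_mul C).integrableOn
  · exact (ae_restrict_iff' measurableSet_Iic).2 (Eventually.of_forall hb)

lemma continuous_slice {I : Set ℝ} {G : Type*} [TopologicalSpace G] {g : ℝ → ℝ → G}
    (hc : ContinuousOn (fun z : ℝ × ℝ => g z.1 z.2) (I ×ˢ univ)) {t : ℝ} (ht : t ∈ I) :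
    Continuous (g t) := by
  rw [← continuousOn_univ]
  exact hc.comp (f := fun x => (t, x)) (by fun_prop) (fun x _ => ⟨ht, mem_univ _⟩)

lemma DecaysAtBot.integrableOn {I : Set ℝ} {g : ℝ → ℝ → F}
    (hd : DecaysAtBot I g) (hc : ContinuousOn (fun z : ℝ × ℝ => g z.1 z.2) (I ×ˢ univ))
    {t : ℝ} (ht : t ∈ I) (x : ℝ) : IntegrableOn (g t) (Iic x) := by
  obtain ⟨C, -, hC⟩ := hd t ht x
  exact integrableOn_Iic_of_decay (continuous_slice hc ht) hC.self_of_nhds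

variable [NormedSpace ℝ F]

lemma DecaysAtBot.hasDerivAt_integral [CompleteSpace F] {I : Set ℝ} {g : ℝ → ℝ → F}
    (hd : DecaysAtBot I g) (hc : ContinuousOn (fun z : ℝ × ℝ => g z.1 z.2) (I ×ˢ univ))
    {t : ℝ} (ht : t ∈ I) (x : ℝ) :
    HasDerivAt (fun x => ∫ y in Iic x, g t y) (g t x) x := by
  have hcs := continuous_slice hc ht
  have h : (fun x => ∫ y in Iic x, g t y) = fun x => (∫ y in Iic 0, g t y) + ∫ y in (0:ℝ)..x, g t y := by
    funext x
    rw [← intervalIntegral.integral_Iic_sub_Iic (hd.integrableOn hc ht _) (hd.integrableOn hc ht _)]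
    abel
  rw [h]
  exact (intervalIntegral.integral_hasDerivAt_right (hcs.intervalIntegrable _ _)
    hcs.stronglyMeasurable.stronglyMeasurableAtFilter hcs.continuousAt).const_add _

/-- Dominated convergence, with the moving endpoint absorbed into an indicator function. The cut-off
integrands converge at every y except the endpoint itself, a null set. -/
lemma DecaysAtBot.continuousOn_integral {I : Set ℝ} (hI : IsOpen I) {g : ℝ → ℝ → F}
    (hd : DecaysAtBot I g) (hc : ContinuousOn (fun z : ℝ × ℝ => g z.1 z.2) (I ×ˢ univ)) :
    ContinuousOn (fun z : ℝ × ℝ => ∫ y in Iic z.2, g z.1 y) (I ×ˢ univ) := by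
  rintro ⟨t₀, x₀⟩ ⟨ht₀, -⟩
  refine ContinuousAt.continuousWithinAt ?_
  -- The bound is taken up to x₀ + 1 so that it covers all endpoints close to x₀.
  obtain ⟨C, hC0, hC⟩ := hd t₀ ht₀ (x₀ + 1)
  simp_rw [← integral_indicator measurableSet_Iic]
  have hev : ∀ᶠ z : ℝ × ℝ in 𝓝 (t₀, x₀), z.1 ∈ I ∧ z.2 < x₀ + 1 ∧
      ∀ x ≤ x₀ + 1, ‖g z.1 x‖ ≤ C * (1 + x ^ 2)⁻¹ :=
    ((continuous_fst.tendsto (t₀, x₀)).eventually (hI.mem_nhds ht₀)).and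
      (((continuous_snd.tendsto (t₀, x₀)).eventually (gt_mem_nhds (by simp))).and
        ((continuous_fst.tendsto (t₀, x₀)).eventually hC))
  refine continuousAt_of_dominated (bound := fun x => C * (1 + x ^ 2)⁻¹) ?_ ?_
    (integrable_inv_one_add_sq.const_mul C) ?_
  · filter_upwards [hev] with z hz
    exact (continuous_slice hc hz.1).aestronglyMeasurable.indicator measurableSet_Iic
  · filter_upwards [hev] with z hz
    refine Eventually.of_forall fun y => ?_
    by_cases hy : y ∈ Iic z.2
    · rw [indicator_of_mem hy]
      exact hz.2.2 _ (hy.out.trans hz.2.1.le)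
    · rw [indicator_of_notMem hy, norm_zero]
      positivity
  · have : ∀ᵐ y : ℝ, y ≠ x₀ := by simp [ae_iff, measure_singleton]
    filter_upwards [this] with y hy
    rcases lt_or_gt_of_ne hy with h | h
    · have hev2 : ∀ᶠ z : ℝ × ℝ in 𝓝 (t₀, x₀), g z.1 y = (Iic z.2).indicator (fun y => g z.1 y) y := by
        filter_upwards [(continuous_snd.tendsto (t₀, x₀)).eventually (lt_mem_nhds h)] with z hz
        exact (indicator_of_mem (s := Iic z.2) (le_of_lt hz) _).symm
      refine ContinuousAt.congr ?_ hev2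
      have h1 : ContinuousAt (fun z : ℝ × ℝ => g z.1 z.2) (t₀, y) :=
        hc.continuousAt ((hI.prod isOpen_univ).mem_nhds ⟨ht₀, mem_univ _⟩)
      exact h1.comp_of_eq (f := fun z : ℝ × ℝ => (z.1, y)) (by fun_prop) rfl
    · have hev2 : ∀ᶠ z : ℝ × ℝ in 𝓝 (t₀, x₀), (0 : F) = (Iic z.2).indicator (fun y => g z.1 y) y := by
        filter_upwards [(continuous_snd.tendsto (t₀, x₀)).eventually (gt_mem_nhds h)] with z hz
        exact (indicator_of_notMem (s := Iic z.2) (by simpa using hz) _).symm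
      exact continuousAt_const.congr hev2

lemma DecaysAtBot.hasDerivAt_integral_param {I : Set ℝ} (hI : IsOpen I) {g g' : ℝ → ℝ → F}
    (hd : DecaysAtBot I g) (hc : ContinuousOn (fun z : ℝ × ℝ => g z.1 z.2) (I ×ˢ univ))
    (hd' : DecaysAtBot I g') (hc' : ContinuousOn (fun z : ℝ × ℝ => g' z.1 z.2) (I ×ˢ univ))
    (hg : ∀ t ∈ I, ∀ x, HasDerivAt (fun s => g s x) (g' t x) t) {t : ℝ} (ht : t ∈ I) (x : ℝ) :
    HasDerivAt (fun s => ∫ y in Iic x, g s y) (∫ y in Iic x, g' t y) t := by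
  obtain ⟨C, hC0, hC⟩ := hd' t ht x
  refine (hasDerivAt_integral_of_dominated_loc_of_deriv_le (bound := fun x => C * (1 + x ^ 2)⁻¹)
    (s := {s | s ∈ I ∧ ∀ y ≤ x, ‖g' s y‖ ≤ C * (1 + y ^ 2)⁻¹}) (inter_mem (hI.mem_nhds ht) hC)
    ?_ (hd.integrableOn hc ht x) (continuous_slice hc' ht).aestronglyMeasurable ?_ ?_ ?_).2
  · filter_upwards [hI.mem_nhds ht] with s hs
    exact (continuous_slice hc hs).aestronglyMeasurable
  · exact (ae_restrict_iff' measurableSet_Iic).2 (Eventually.of_forall fun y hy s hs => hs.2 y hy)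
  · exact (integrable_inv_one_add_sq.const_mul C).integrableOn
  · exact Eventually.of_forall fun y s hs => hg s hs.1 y

end Integral

/-! ### The Picard series with data at −∞ -/

variable {F : Type*} [NormedAddCommGroup F] [NormedSpace ℝ F]

/-- The terms of the Picard (Dyson) series of `W_x = B W`, `W(-∞) = w`. -/
def picardTerm (B : ℝ → ℝ → F →L[ℝ] F) (w : F) : ℕ → ℝ → ℝ → F
  | 0 => fun _ _ => w
  | n + 1 => fun t x => ∫ y in Iic x, B t y (picardTerm B w n t y)

/-- The solution of `W_x = B W`, `W(-∞) = w`. -/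
def picardSum (B : ℝ → ℝ → F →L[ℝ] F) (w : F) (t x : ℝ) : F := ∑' n, picardTerm B w n t x

/-- The function arctan x + π/2 is the primitive of (1+x²)⁻¹ vanishing at −∞, so these are the
iterated integrals of C(1+x²)⁻¹ that dominate the Picard terms. -/
lemma hasDerivAt_arctan_pow (C : ℝ) (n : ℕ) (x : ℝ) :
    HasDerivAt (fun x => (C * (Real.arctan x + Real.pi / 2)) ^ (n + 1) / (n + 1).factorial)
      (C * (1 + x ^ 2)⁻¹ * ((C * (Real.arctan x + Real.pi / 2)) ^ n / n.factorial)) x := by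
  have h := ((((Real.hasDerivAt_arctan x).add_const (Real.pi / 2)).const_mul C).pow (n + 1)).div_const
    ((n + 1).factorial : ℝ)
  refine h.congr_deriv ?_
  rw [Nat.factorial_succ]
  have : (n.factorial : ℝ) ≠ 0 := by positivity
  have : (1 + x ^ 2) ≠ 0 := by positivity
  have : (n + 1 : ℝ) ≠ 0 := by positivity
  push_cast
  simp
  field_simp

lemma arctan_add_nonneg (x : ℝ) : 0 ≤ Real.arctan x + Real.pi / 2 := by
  linarith [Real.neg_pi_div_two_lt_arctan x]

lemma arctan_add_le (x : ℝ) : Real.arctan x + Real.pi / 2 ≤ Real.pi := by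
  linarith [Real.arctan_lt_pi_div_two x]

lemma tendsto_arctan_add : Tendsto (fun x : ℝ => Real.arctan x + Real.pi / 2) atBot (𝓝 0) := by
  have := (Real.tendsto_arctan_atBot.mono_right nhdsWithin_le_nhds).add_const (Real.pi / 2)
  simpa using this

/-- Integrating the bound for one term against C(1+x²)⁻¹ gives exactly the bound for the next. The
factorials make the series converge on the whole half line without any smallness of B. -/
lemma norm_picardTerm_le {B : ℝ → ℝ → F →L[ℝ] F} {w : F} {t C X : ℝ} (hC : 0 ≤ C)
    (hB : ∀ x ≤ X, ‖B t x‖ ≤ C * (1 + x ^ 2)⁻¹) (n : ℕ) : ∀ x ≤ X,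
    ‖picardTerm B w n t x‖ ≤ ‖w‖ * ((C * (Real.arctan x + Real.pi / 2)) ^ n / n.factorial) := by
  induction n with
  | zero => intro x _; simp [picardTerm]
  | succ n ih =>
    intro x hx
    have hint : IntegrableOn (fun y : ℝ => C * (1 + y ^ 2)⁻¹ *
        ((C * (Real.arctan y + Real.pi / 2)) ^ n / n.factorial)) (Iic x) := by
      refine integrableOn_Iic_of_decay (C := C * ((C * Real.pi) ^ n / n.factorial)) ?_ ?_
      · have : Continuous Real.arctan := Real.continuous_arctan
        refine ((continuous_const.mul (Continuous.inv₀ (by fun_prop) fun y => by positivity))).mul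
          (by fun_prop)
      · intro y _
        have h0 := mul_nonneg hC (arctan_add_nonneg y)
        rw [Real.norm_of_nonneg (by positivity), mul_right_comm]
        gcongr
        exact arctan_add_le y
    have key : ∫ y in Iic x, C * (1 + y ^ 2)⁻¹ *
        ((C * (Real.arctan y + Real.pi / 2)) ^ n / n.factorial)
        = (C * (Real.arctan x + Real.pi / 2)) ^ (n + 1) / (n + 1).factorial := by
      have hlim : Tendsto (fun x : ℝ => (C * (Real.arctan x + Real.pi / 2)) ^ (n + 1) /
          (n + 1).factorial) atBot (𝓝 0) := by
        have := (((tendsto_arctan_add.const_mul C).pow (n + 1)).div_const ((n + 1).factorial : ℝ))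
        simpa using this
      simpa using integral_Iic_of_hasDerivAt_of_tendsto' (fun y _ => hasDerivAt_arctan_pow C n y)
        hint hlim
    simp only [picardTerm]
    rw [← key, ← integral_const_mul]
    refine norm_integral_le_of_norm_le (hint.const_mul _) ?_
    refine (ae_restrict_iff' measurableSet_Iic).2 (Eventually.of_forall fun y hy => ?_)
    have hy' : y ≤ X := hy.out.trans hx
    calc ‖B t y (picardTerm B w n t y)‖ ≤ ‖B t y‖ * ‖picardTerm B w n t y‖ := (B t y).le_opNorm _
      _ ≤ (C * (1 + y ^ 2)⁻¹) * (‖w‖ * ((C * (Real.arctan y + Real.pi / 2)) ^ n / n.factorial)) :=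
        mul_le_mul (hB y hy') (ih y hy') (norm_nonneg _) (by positivity)
      _ = _ := by ring

lemma norm_picardTerm_le_const {B : ℝ → ℝ → F →L[ℝ] F} {w : F} {t C X : ℝ} (hC : 0 ≤ C)
    (hB : ∀ x ≤ X, ‖B t x‖ ≤ C * (1 + x ^ 2)⁻¹) (n : ℕ) {x : ℝ} (hx : x ≤ X) :
    ‖picardTerm B w n t x‖ ≤ ‖w‖ * ((C * Real.pi) ^ n / n.factorial) := by
  refine (norm_picardTerm_le hC hB n x hx).trans ?_
  have h0 := mul_nonneg hC (arctan_add_nonneg x)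
  gcongr
  exact arctan_add_le x

lemma summable_picard_bound (a b : ℝ) : Summable fun n : ℕ => a * (b ^ n / n.factorial) :=
  (Real.summable_pow_div_factorial b).mul_left a

section

variable {I : Set ℝ} {B : ℝ → ℝ → F →L[ℝ] F} {w : F}

lemma DecaysAtBot.clm_apply_picardTerm {B' : ℝ → ℝ → F →L[ℝ] F} (hd : DecaysAtBot I B)
    (hd' : DecaysAtBot I B') (n : ℕ) :
    DecaysAtBot I (fun t x => B' t x (picardTerm B w n t x)) := by
  intro t₀ ht₀ X
  obtain ⟨C, hC0, hC⟩ := hd t₀ ht₀ X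
  obtain ⟨C', hC0', hC'⟩ := hd' t₀ ht₀ X
  refine ⟨C' * (‖w‖ * ((C * Real.pi) ^ n / n.factorial)), by positivity, ?_⟩
  filter_upwards [hC, hC'] with t ht ht' x hx
  calc _ ≤ ‖B' t x‖ * ‖picardTerm B w n t x‖ := (B' t x).le_opNorm _
    _ ≤ (C' * (1 + x ^ 2)⁻¹) * (‖w‖ * ((C * Real.pi) ^ n / n.factorial)) :=
        mul_le_mul (ht' x hx) (norm_picardTerm_le_const hC0 ht n hx) (norm_nonneg _) (by positivity)
    _ = _ := by ring

lemma continuousOn_picardTerm (hI : IsOpen I) (hd : DecaysAtBot I B)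
    (hc : ContinuousOn (fun z : ℝ × ℝ => B z.1 z.2) (I ×ˢ univ)) (n : ℕ) :
    ContinuousOn (fun z : ℝ × ℝ => picardTerm B w n z.1 z.2) (I ×ˢ univ) := by
  induction n with
  | zero => exact continuousOn_const
  | succ n ih => exact (hd.clm_apply_picardTerm hd n).continuousOn_integral hI (hc.clm_apply ih)

variable [CompleteSpace F]

/-- Weierstrass test on a product of a neighbourhood of t₀ with a half line, where one constant C
bounds B. -/
lemma continuousOn_picardSum (hI : IsOpen I) (hd : DecaysAtBot I B)
    (hc : ContinuousOn (fun z : ℝ × ℝ => B z.1 z.2) (I ×ˢ univ)) :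
    ContinuousOn (fun z : ℝ × ℝ => picardSum B w z.1 z.2) (I ×ˢ univ) := by
  rintro ⟨t₀, x₀⟩ ⟨ht₀, -⟩
  obtain ⟨C, hC0, hC⟩ := hd t₀ ht₀ (x₀ + 1)
  obtain ⟨U, hU, hUo, htU⟩ := eventually_nhds_iff.1 (hC.and (hI.mem_nhds ht₀))
  have h : ContinuousOn (fun z : ℝ × ℝ => ∑' n, picardTerm B w n z.1 z.2)
      (U ×ˢ Iio (x₀ + 1)) := by
    refine continuousOn_tsum (fun n => ?_) (summable_picard_bound ‖w‖ (C * Real.pi)) ?_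
    · exact (continuousOn_picardTerm hI hd hc n).mono fun z hz => ⟨(hU _ hz.1).2, mem_univ _⟩
    · intro n z hz
      exact norm_picardTerm_le_const hC0 (hU _ hz.1).1 n hz.2.le
  exact (h.continuousAt ((hUo.prod isOpen_Iio).mem_nhds ⟨htU, by simp⟩)).continuousWithinAt

lemma summable_picardTerm (hd : DecaysAtBot I B) {t : ℝ} (ht : t ∈ I) (x : ℝ) :
    Summable fun n => picardTerm B w n t x := by
  obtain ⟨C, hC0, hC⟩ := hd t ht x
  exact Summable.of_norm_bounded (summable_picard_bound _ _) fun n =>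
    norm_picardTerm_le_const hC0 hC.self_of_nhds n le_rfl

lemma hasDerivAt_picardSum (hd : DecaysAtBot I B)
    (hI : IsOpen I) (hc : ContinuousOn (fun z : ℝ × ℝ => B z.1 z.2) (I ×ˢ univ))
    {t : ℝ} (ht : t ∈ I) (x : ℝ) :
    HasDerivAt (picardSum B w t) (B t x (picardSum B w t x)) x := by
  obtain ⟨C, hC0, hC⟩ := hd t ht (x + 1)
  have hC := hC.self_of_nhds
  -- The zeroth term is constant and the derivative of term n + 1 is B applied to term n. This index
  -- shift makes the differentiated series equal to B applied to the sum.
  set g' : ℕ → ℝ → F := fun n y => Nat.casesOn n 0 fun n => B t y (picardTerm B w n t y)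
  have hg' : ∀ n y, HasDerivAt (picardTerm B w n t) (g' n y) y := by
    rintro (_ | n) y
    · exact hasDerivAt_const _ _
    · exact (hd.clm_apply_picardTerm hd n).hasDerivAt_integral
        (hc.clm_apply (continuousOn_picardTerm hI hd hc n)) ht y
  set b : ℕ → ℝ := fun n => Nat.casesOn n 0 fun n => C * (‖w‖ * ((C * Real.pi) ^ n / n.factorial))
  have hb : Summable b := by
    rw [← summable_nat_add_iff 1]
    exact (summable_picard_bound _ _).mul_left C
  have hle : ∀ n, ∀ y ∈ Iio (x + 1), ‖g' n y‖ ≤ b n := by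
    rintro (_ | n) y hy
    · simp [g', b]
    · refine ((B t y).le_opNorm _).trans (mul_le_mul ((hC y (le_of_lt hy)).trans ?_)
        (norm_picardTerm_le_const hC0 hC n (le_of_lt hy)) (norm_nonneg _) hC0)
      exact mul_le_of_le_one_right hC0 (inv_le_one_of_one_le₀ (by nlinarith [sq_nonneg y]))
  have hx : x ∈ Iio (x + 1) := by simp
  have key := hasDerivAt_tsum_of_isPreconnected hb isOpen_Iio isPreconnected_Iio
    (fun n y _ => hg' n y) hle hx (summable_picardTerm hd ht x) hx
  have hs : Summable fun n => g' n x := Summable.of_norm_bounded hb fun n => hle n x hx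
  have : ∑' n, g' n x = B t x (picardSum B w t x) := by
    rw [hs.tsum_eq_zero_add, picardSum, (B t x).map_tsum (summable_picardTerm hd ht x)]
    simp [g']
  rwa [this] at key

/-- Every term of index at least 1 carries a power of arctan x + π/2 and tends to 0; the summable
bound allows passing to the limit termwise, and only w survives. -/
lemma tendsto_picardSum (hd : DecaysAtBot I B) {t : ℝ} (ht : t ∈ I) :
    Tendsto (picardSum B w t) atBot (𝓝 w) := by
  obtain ⟨C, hC0, hC⟩ := hd t ht 0
  have hC := hC.self_of_nhds
  have h := tendsto_tsum_of_dominated_convergence (𝓕 := (atBot : Filter ℝ))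
    (f := fun x n => picardTerm B w n t x)
    (g := fun n => if n = 0 then w else 0) (summable_picard_bound ‖w‖ (C * Real.pi)) ?_ ?_
  · simp only [tsum_ite_eq] at h
    exact h
  · rintro (_ | n)
    · simp [picardTerm]
    · simp only [Nat.add_eq_zero_iff, one_ne_zero, and_false, if_false]
      have hlim : Tendsto (fun x : ℝ => ‖w‖ * ((C * (Real.arctan x + Real.pi / 2)) ^ (n + 1) /
          (n + 1).factorial)) atBot (𝓝 0) := by
        have := (((tendsto_arctan_add.const_mul C).pow (n + 1)).div_const
          ((n + 1).factorial : ℝ)).const_mul ‖w‖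
        simpa using this
      refine squeeze_zero_norm' ?_ hlim
      filter_upwards [eventually_le_atBot 0] with x hx
      exact norm_picardTerm_le hC0 hC (n + 1) x hx
  · filter_upwards [eventually_le_atBot 0] with x hx n
    exact norm_picardTerm_le_const hC0 hC n hx

end

/-- The system satisfied by `(W, W_t)`. -/
def extendSystem (L L' : F →L[ℝ] F) : F × F →L[ℝ] F × F :=
  (L.comp (ContinuousLinearMap.fst ℝ F F)).prod
    (L'.comp (ContinuousLinearMap.fst ℝ F F) + L.comp (ContinuousLinearMap.snd ℝ F F))

@[simp] lemma extendSystem_apply (L L' : F →L[ℝ] F) (v : F × F) :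
    extendSystem L L' v = (L v.1, L' v.1 + L v.2) := rfl

lemma norm_extendSystem_le (L L' : F →L[ℝ] F) : ‖extendSystem L L'‖ ≤ ‖L‖ + ‖L'‖ := by
  refine ContinuousLinearMap.opNorm_le_bound _ (by positivity) fun v => ?_
  have h1 := norm_fst_le v
  have h2 := norm_snd_le v
  rw [extendSystem_apply, Prod.norm_mk]
  refine max_le ?_ ?_
  · refine (L.le_opNorm _).trans ?_
    nlinarith [norm_nonneg L, norm_nonneg L', norm_nonneg v]
  · refine (norm_add_le _ _).trans ?_
    have h3 := L.le_opNorm v.2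
    have h4 := L'.le_opNorm v.1
    nlinarith [norm_nonneg L, norm_nonneg L', norm_nonneg v]

/-- The map `extendSystem` as a linear map. -/
def extendSystemL : (F →L[ℝ] F) × (F →L[ℝ] F) →L[ℝ] (F × F →L[ℝ] F × F) :=
  LinearMap.mkContinuous
    { toFun := fun p => extendSystem p.1 p.2
      map_add' := by intros; ext <;> simp
      map_smul' := by intros; ext <;> simp } 2 (by
    intro p
    refine (norm_extendSystem_le _ _).trans ?_
    linarith [norm_fst_le p, norm_snd_le p])

/-- A smooth coefficient on `I × ℝ`, together with all its derivatives in `t`, which decay. -/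
structure IsSmoothCoeff (I : Set ℝ) (B : ℕ → ℝ → ℝ → F →L[ℝ] F) : Prop where
  smooth : ∀ k, ContDiffOn ℝ ∞ (fun z : ℝ × ℝ => B k z.1 z.2) (I ×ˢ univ)
  deriv : ∀ k, ∀ t ∈ I, ∀ x, HasDerivAt (fun s => B k s x) (B (k + 1) t x) t
  decays : ∀ k, DecaysAtBot I (B k)

/-- The system for (W, W_t) has ∂_t B among its coefficients. This is why the class carries a whole
sequence of t derivatives: it is then stable under doubling, and regularity can be proved by
induction. -/
lemma IsSmoothCoeff.extend {I : Set ℝ} {B : ℕ → ℝ → ℝ → F →L[ℝ] F} (h : IsSmoothCoeff I B) :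
    IsSmoothCoeff I (fun k t x => extendSystem (B k t x) (B (k + 1) t x)) where
  smooth k := extendSystemL.contDiff.comp_contDiffOn ((h.smooth k).prodMk (h.smooth (k + 1)))
  deriv k t ht x := by
    exact extendSystemL.hasFDerivAt.comp_hasDerivAt t
      ((h.deriv k t ht x).prodMk (h.deriv (k + 1) t ht x))
  decays k := by
    intro t₀ ht₀ X
    obtain ⟨C, hC0, hC⟩ := h.decays k t₀ ht₀ X
    obtain ⟨C', hC0', hC'⟩ := h.decays (k + 1) t₀ ht₀ X
    refine ⟨C + C', by positivity, ?_⟩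
    filter_upwards [hC, hC'] with t ht ht' x hx
    rw [add_mul]
    exact (norm_extendSystem_le _ _).trans (add_le_add (ht x hx) (ht' x hx))

/-! ### Smooth dependence of the Picard series on the parameter -/

section

variable [CompleteSpace F] {I : Set ℝ} {B : ℕ → ℝ → ℝ → F →L[ℝ] F} {w : F}

/-- The doubled system with data (w, 0) has as Picard terms the pairs (term, t derivative of the
term); the second data vector is 0 because w does not depend on t. The induction step is
differentiation under the integral sign. -/
lemma hasDerivAt_picardTerm_param (hI : IsOpen I) (h : IsSmoothCoeff I B) (n : ℕ) :
    (∀ t ∈ I, ∀ x, (picardTerm (fun t x => extendSystem (B 0 t x) (B 1 t x)) (w, 0) n t x).1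
      = picardTerm (B 0) w n t x) ∧
    ∀ t ∈ I, ∀ x, HasDerivAt (fun s => picardTerm (B 0) w n s x)
      (picardTerm (fun t x => extendSystem (B 0 t x) (B 1 t x)) (w, 0) n t x).2 t := by
  induction n with
  | zero => exact ⟨fun _ _ _ => rfl, fun t _ x => by simpa [picardTerm] using hasDerivAt_const t w⟩
  | succ n ih =>
    have he := h.extend
    set B' : ℝ → ℝ → F × F →L[ℝ] F × F := fun t x => extendSystem (B 0 t x) (B 1 t x) with hB'
    have hcW := continuousOn_picardTerm (w := w) hI (h.decays 0) (h.smooth 0).continuousOn n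
    have hcZ := continuousOn_picardTerm (w := (w, (0 : F))) hI (he.decays 0)
      (he.smooth 0).continuousOn n
    have hdZ := (he.decays 0).clm_apply_picardTerm (w := (w, (0 : F))) (he.decays 0) n
    have hcZ' := (he.smooth 0).continuousOn.clm_apply hcZ
    have hint := fun t (ht : t ∈ I) x => hdZ.integrableOn hcZ' ht x
    have hfst : ∀ t ∈ I, ∀ x, (picardTerm B' (w, 0) (n + 1) t x).1
        = ∫ y in Iic x, B 0 t y (picardTerm (B 0) w n t y) := by
      intro t ht x
      have := ((ContinuousLinearMap.fst ℝ F F).integral_comp_comm (hint t ht x)).symm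
      refine this.trans (integral_congr_ae (Eventually.of_forall fun y => ?_))
      show B 0 t y (picardTerm B' (w, 0) n t y).1 = _
      rw [ih.1 t ht y]
    have hsnd : ∀ t ∈ I, ∀ x, (picardTerm B' (w, 0) (n + 1) t x).2
        = ∫ y in Iic x, (B 1 t y (picardTerm (B 0) w n t y) +
          B 0 t y (picardTerm B' (w, 0) n t y).2) := by
      intro t ht x
      have := ((ContinuousLinearMap.snd ℝ F F).integral_comp_comm (hint t ht x)).symm
      refine this.trans (integral_congr_ae (Eventually.of_forall fun y => ?_))
      show B 1 t y (picardTerm B' (w, 0) n t y).1 + _ = _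
      rw [ih.1 t ht y]
      rfl
    refine ⟨hfst, fun t ht x => ?_⟩
    rw [hsnd t ht x]
    refine ((h.decays 0).clm_apply_picardTerm (h.decays 0) n).hasDerivAt_integral_param hI
      ((h.smooth 0).continuousOn.clm_apply hcW)
      (g' := fun t y => B 1 t y (picardTerm (B 0) w n t y) +
          B 0 t y (picardTerm B' (w, 0) n t y).2) ?_ ?_ ?_ ht x
    · intro t₀ ht₀ X
      -- The t derivative of the integrand is the second component of the integrand of the doubled
      -- system, so it inherits the decay of the latter.
      obtain ⟨C, hC0, hC⟩ := hdZ t₀ ht₀ X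
      refine ⟨C, hC0, ?_⟩
      filter_upwards [hC, hI.mem_nhds ht₀] with t hCt ht x hx
      refine le_trans ?_ (hCt x hx)
      rw [← ih.1 t ht x]
      exact norm_snd_le (B' t x (picardTerm B' (w, 0) n t x))
    · exact ((h.smooth 1).continuousOn.clm_apply hcW).add
        ((h.smooth 0).continuousOn.clm_apply (continuous_snd.comp_continuousOn hcZ))
    · intro t ht x
      exact (h.deriv 0 t ht x).clm_apply (ih.2 t ht x)

lemma hasDerivAt_picardSum_param (hI : IsOpen I) (h : IsSmoothCoeff I B) {t : ℝ} (ht : t ∈ I)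
    (x : ℝ) : HasDerivAt (fun s => picardSum (B 0) w s x)
      (picardSum (fun t x => extendSystem (B 0 t x) (B 1 t x)) (w, 0) t x).2 t := by
  have he := h.extend
  obtain ⟨C, hC0, hC⟩ := he.decays 0 t ht x
  obtain ⟨ε, hε, hεs⟩ := Metric.eventually_nhds_iff_ball.1 (hC.and (hI.mem_nhds ht))
  have hle : ∀ n, ∀ s ∈ Metric.ball t ε,
      ‖(picardTerm (fun t x => extendSystem (B 0 t x) (B 1 t x)) (w, 0) n s x).2‖ ≤
      ‖(w, (0 : F))‖ * ((C * Real.pi) ^ n / n.factorial) := fun n s hs => (norm_snd_le _).trans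
    (norm_picardTerm_le_const (B := fun t x => extendSystem (B 0 t x) (B 1 t x)) hC0
      (hεs s hs).1 n le_rfl)
  have key := hasDerivAt_tsum_of_isPreconnected (g := fun n s => picardTerm (B 0) w n s x)
    (summable_picard_bound ‖(w, (0 : F))‖ (C * Real.pi)) Metric.isOpen_ball
    (convex_ball t ε).isPreconnected
    (fun n s hs => (hasDerivAt_picardTerm_param hI h n).2 s (hεs s hs).2 x) hle
    (Metric.mem_ball_self hε) (summable_picardTerm (h.decays 0) ht x) (Metric.mem_ball_self hε)
  refine HasDerivAt.congr_deriv (f := fun s => ∑' n, picardTerm (B 0) w n s x) key ?_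
  exact ((ContinuousLinearMap.snd ℝ F F).map_tsum (summable_picardTerm
    (B := fun t x => extendSystem (B 0 t x) (B 1 t x)) (he.decays 0) ht x)).symm

end

/-- The x derivative of the sum is B applied to the sum, and its t derivative is a component of the
sum for the doubled system. Both are C^k by induction, so the sum is C^(k+1). The space F is
quantified inside the induction because the step passes from F to F × F. -/
lemma contDiffOn_picardSum_nat.{v} {I : Set ℝ} (hI : IsOpen I) (k : ℕ) : ∀ (F : Type v)
    [NormedAddCommGroup F] [NormedSpace ℝ F] [CompleteSpace F] (B : ℕ → ℝ → ℝ → F →L[ℝ] F) (w : F),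
    IsSmoothCoeff I B →
    ContDiffOn ℝ k (fun z : ℝ × ℝ => picardSum (B 0) w z.1 z.2) (I ×ˢ univ) := by
  induction k with
  | zero =>
    intro F _ _ _ B w h
    exact contDiffOn_zero.2 (continuousOn_picardSum hI (h.decays 0) (h.smooth 0).continuousOn)
  | succ k ih =>
    intro F _ _ _ B w h
    have hO : IsOpen (I ×ˢ (univ : Set ℝ)) := hI.prod isOpen_univ
    have hZ := (ih (F × F) _ (w, 0) h.extend).snd
    have hX : ContDiffOn ℝ k (fun z : ℝ × ℝ => B 0 z.1 z.2 (picardSum (B 0) w z.1 z.2))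
        (I ×ˢ univ) :=
      ((h.smooth 0).of_le (mod_cast le_top)).clm_apply (ih F B w h)
    set f₁ : ℝ → ℝ → ℝ →L[ℝ] F := fun t x => ContinuousLinearMap.toSpanSingleton ℝ
      (picardSum (fun t x => extendSystem (B 0 t x) (B 1 t x)) (w, 0) t x).2 with hf₁
    set f₂ : ℝ → ℝ → ℝ →L[ℝ] F := fun t x => ContinuousLinearMap.toSpanSingleton ℝ
      (B 0 t x (picardSum (B 0) w t x)) with hf₂
    have hf₁c : ContDiffOn ℝ k (fun z : ℝ × ℝ => f₁ z.1 z.2) (I ×ˢ univ) :=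
      (ContinuousLinearMap.toSpanSingletonCLE (𝕜 := ℝ) (E := F)).contDiff.comp_contDiffOn hZ
    have hf₂c : ContDiffOn ℝ k (fun z : ℝ × ℝ => f₂ z.1 z.2) (I ×ˢ univ) :=
      (ContinuousLinearMap.toSpanSingletonCLE (𝕜 := ℝ) (E := F)).contDiff.comp_contDiffOn hX
    have hder : ∀ z ∈ I ×ˢ (univ : Set ℝ), HasFDerivAt (fun z : ℝ × ℝ => picardSum (B 0) w z.1 z.2)
        ((f₁ z.1 z.2).coprod (f₂ z.1 z.2)) z := by
      intro z hz
      refine (hasStrictFDerivAt_uncurry_coprod (f := picardSum (B 0) w) (f₁ := f₁) (f₂ := f₂)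
        ?_ ?_ (hf₁c.continuousOn.continuousAt (hO.mem_nhds hz))
        (hf₂c.continuousOn.continuousAt (hO.mem_nhds hz))).hasFDerivAt
      · filter_upwards [hO.mem_nhds hz] with v hv
        exact (hasDerivAt_picardSum_param hI h hv.1 v.2).hasFDerivAt
      · filter_upwards [hO.mem_nhds hz] with v hv
        exact (hasDerivAt_picardSum (h.decays 0) hI (h.smooth 0).continuousOn hv.1 v.2).hasFDerivAt
    push_cast
    rw [contDiffOn_succ_iff_fderiv_of_isOpen hO]
    refine ⟨fun z hz => (hder z hz).differentiableAt.differentiableWithinAt, by simp, ?_⟩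
    refine ContDiffOn.congr (f := fun z : ℝ × ℝ => (f₁ z.1 z.2).coprod (f₂ z.1 z.2)) ?_
      fun z hz => (hder z hz).fderiv
    have : (fun z : ℝ × ℝ => (f₁ z.1 z.2).coprod (f₂ z.1 z.2)) = fun z =>
      (f₁ z.1 z.2).comp (ContinuousLinearMap.fst ℝ ℝ ℝ) +
      (f₂ z.1 z.2).comp (ContinuousLinearMap.snd ℝ ℝ ℝ) := by
      funext z; ext <;> simp
    rw [this]
    exact (hf₁c.clm_comp contDiffOn_const).add (hf₂c.clm_comp contDiffOn_const)

/-- The linear equation `W_x = B W` with `W → w` at `-∞` has a solution which is smooth in `(t, x)`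
and whose derivative in `t` tends to `0` at `-∞`. -/
theorem exists_smooth_solution [CompleteSpace F] {I : Set ℝ} (hI : IsOpen I)
    {B : ℕ → ℝ → ℝ → F →L[ℝ] F} (h : IsSmoothCoeff I B) (w : F) :
    ∃ W W' : ℝ → ℝ → F, ContDiffOn ℝ ∞ (fun z : ℝ × ℝ => W z.1 z.2) (I ×ˢ univ) ∧
      (∀ t ∈ I, ∀ x, HasDerivAt (W t) (B 0 t x (W t x)) x) ∧
      (∀ t ∈ I, Tendsto (W t) atBot (𝓝 w)) ∧
      (∀ t ∈ I, ∀ x, HasDerivAt (fun s => W s x) (W' t x) t) ∧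
      ∀ t ∈ I, Tendsto (W' t) atBot (𝓝 0) := by
  refine ⟨picardSum (B 0) w, fun t x =>
    (picardSum (fun t x => extendSystem (B 0 t x) (B 1 t x)) (w, 0) t x).2, ?_, ?_, ?_, ?_, ?_⟩
  · exact contDiffOn_infty.2 fun k => contDiffOn_picardSum_nat hI k F B w h
  · exact fun t ht x => hasDerivAt_picardSum (h.decays 0) hI (h.smooth 0).continuousOn ht x
  · exact fun t ht => tendsto_picardSum (h.decays 0) ht
  · exact fun t ht x => hasDerivAt_picardSum_param hI h ht x
  · exact fun t ht => (continuous_snd.tendsto ((w, 0) : F × F)).comp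
      (tendsto_picardSum (h.extend.decays 0) ht)

end LinearODE

end KahlerFlow
end

noncomputable section
namespace KahlerFlow

/-! ### Riemannian geometry on an open subset of a vector space -/

section LocalGeometry

set_option maxSynthPendingDepth 3
set_option linter.unusedSectionVars false

open ContinuousLinearMap

variable {E : Type*} [NormedAddCommGroup E] [NormedSpace ℝ E]

/-- A Riemannian metric on the open set `O`. -/
structure IsLocalMetric (O : Set E) (G : E → E →L[ℝ] E →L[ℝ] ℝ) : Prop where
  isOpen : IsOpen O
  smooth : ContDiffOn ℝ ∞ G O
  symm : ∀ y ∈ O, ∀ v w, G y v w = G y w v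
  pos : ∀ y ∈ O, ∀ v, v ≠ 0 → 0 < G y v v

/-- The Christoffel symbols of `G`, as a bilinear map. -/
def localChr (G : E → E →L[ℝ] E →L[ℝ] ℝ) (y : E) : E →L[ℝ] E →L[ℝ] E :=
  (compL ℝ E (E →L[ℝ] ℝ) E (inverse (G y))).comp ((1 / 2 : ℝ) •
    (fderiv ℝ G y + (fderiv ℝ G y).flip
      - ((flipₗᵢ ℝ E E ℝ).toContinuousLinearEquiv :
        (E →L[ℝ] E →L[ℝ] ℝ) →L[ℝ] (E →L[ℝ] E →L[ℝ] ℝ)).comp (fderiv ℝ G y).flip))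

lemma localChr_apply (G : E → E →L[ℝ] E →L[ℝ] ℝ) (y v w : E) :
    localChr G y v w = inverse (G y) ((1 / 2 : ℝ) •
      (fderiv ℝ G y v w + fderiv ℝ G y w v - ((fderiv ℝ G y).flip v).flip w)) := rfl

/-- The curvature tensor of the connection with Christoffel symbols `Γ`. -/
def localCurv (Γ : E → E →L[ℝ] E →L[ℝ] E) (y X Y Z : E) : E :=
  fderiv ℝ Γ y X Y Z - fderiv ℝ Γ y Y X Z + Γ y X (Γ y Y Z) - Γ y Y (Γ y X Z)

/-- The covariant derivative in the direction `d` of the field `W` along `v`. -/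
def localCov {P : Type*} [NormedAddCommGroup P] [NormedSpace ℝ P] (Γ : E → E →L[ℝ] E →L[ℝ] E)
    (v : P → E) (d : P) (W : P → E) (z : P) : E :=
  fderiv ℝ W z d + Γ (v z) (fderiv ℝ v z d) (W z)

lemma fderiv_clm_apply₁ {P F F' : Type*} [NormedAddCommGroup P] [NormedSpace ℝ P]
    [NormedAddCommGroup F] [NormedSpace ℝ F] [NormedAddCommGroup F'] [NormedSpace ℝ F']
    {A : P → F →L[ℝ] F'} {z : P} (hA : DifferentiableAt ℝ A z) {V : P → F}
    (hV : DifferentiableAt ℝ V z) (d : P) :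
    fderiv ℝ (fun z => A z (V z)) z d = fderiv ℝ A z d (V z) + A z (fderiv ℝ V z d) := by
  rw [fderiv_clm_apply hA hV]
  simp [add_comm]

lemma fderiv_clm_apply_const {P F F' : Type*} [NormedAddCommGroup P] [NormedSpace ℝ P]
    [NormedAddCommGroup F] [NormedSpace ℝ F] [NormedAddCommGroup F'] [NormedSpace ℝ F']
    {A : P → F →L[ℝ] F'} {z : P} (hA : DifferentiableAt ℝ A z) (V : F) (d : P) :
    fderiv ℝ (fun z => A z V) z d = fderiv ℝ A z d V := by
  rw [fderiv_clm_apply₁ hA (by fun_prop)]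
  simp

lemma fderiv_clm_apply₂ {P F F' F'' : Type*} [NormedAddCommGroup P] [NormedSpace ℝ P]
    [NormedAddCommGroup F] [NormedSpace ℝ F] [NormedAddCommGroup F'] [NormedSpace ℝ F']
    [NormedAddCommGroup F''] [NormedSpace ℝ F'']
    {A : P → F →L[ℝ] F' →L[ℝ] F''} {z : P} (hA : DifferentiableAt ℝ A z) {V : P → F}
    (hV : DifferentiableAt ℝ V z) {W : P → F'} (hW : DifferentiableAt ℝ W z) (d : P) :
    fderiv ℝ (fun z => A z (V z) (W z)) z d
      = fderiv ℝ A z d (V z) (W z) + A z (fderiv ℝ V z d) (W z) + A z (V z) (fderiv ℝ W z d) := by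
  rw [fderiv_clm_apply₁ (hA.clm_apply hV) hW, fderiv_clm_apply₁ hA hV]
  simp

lemma fderiv_comp_apply {P F F' : Type*} [NormedAddCommGroup P] [NormedSpace ℝ P]
    [NormedAddCommGroup F] [NormedSpace ℝ F] [NormedAddCommGroup F'] [NormedSpace ℝ F']
    {A : F → F'} {v : P → F} {z : P} (hA : DifferentiableAt ℝ A (v z))
    (hv : DifferentiableAt ℝ v z) (d : P) :
    fderiv ℝ (fun z => A (v z)) z d = fderiv ℝ A (v z) (fderiv ℝ v z d) := by
  have := fderiv_comp z hA hv
  simp only [Function.comp_def] at this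
  rw [this]; rfl

lemma two_le_infty : (2 : ℕ∞ω) ≤ ∞ := by
  show ((2 : ℕ∞) : ℕ∞ω) ≤ ((⊤ : ℕ∞) : ℕ∞ω)
  exact WithTop.coe_le_coe.2 le_top

lemma fderiv_fderiv_symm {P F : Type*} [NormedAddCommGroup P] [NormedSpace ℝ P]
    [NormedAddCommGroup F] [NormedSpace ℝ F] {f : P → F} {z : P} (hf : ContDiffAt ℝ ∞ f z)
    (v w : P) : fderiv ℝ (fderiv ℝ f) z v w = fderiv ℝ (fderiv ℝ f) z w v :=
  (hf.isSymmSndFDerivAt (by simpa using two_le_infty)).eq v w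

lemma contDiffAt_fderiv {P F : Type*} [NormedAddCommGroup P] [NormedSpace ℝ P]
    [NormedAddCommGroup F] [NormedSpace ℝ F] {f : P → F} {z : P} (hf : ContDiffAt ℝ ∞ f z) :
    ContDiffAt ℝ ∞ (fderiv ℝ f) z :=
  hf.fderiv_right (by simp)

lemma differentiableAt_of_smooth {P F : Type*} [NormedAddCommGroup P] [NormedSpace ℝ P]
    [NormedAddCommGroup F] [NormedSpace ℝ F] {f : P → F} {z : P} (hf : ContDiffAt ℝ ∞ f z) :
    DifferentiableAt ℝ f z := hf.differentiableAt (by simp)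

variable {O : Set E} {G : E → E →L[ℝ] E →L[ℝ] ℝ}

lemma IsLocalMetric.contDiffAt (hG : IsLocalMetric O G) {y : E} (hy : y ∈ O) :
    ContDiffAt ℝ ∞ G y := hG.smooth.contDiffAt (hG.isOpen.mem_nhds hy)

lemma IsLocalMetric.fderiv_symm (hG : IsLocalMetric O G) {y : E} (hy : y ∈ O) (u v w : E) :
    fderiv ℝ G y u v w = fderiv ℝ G y u w v := by
  have hd := differentiableAt_of_smooth (hG.contDiffAt hy)
  have h1 := fderiv_clm_apply₂ (V := fun _ => v) (W := fun _ => w) hd (by fun_prop) (by fun_prop) u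
  have h2 := fderiv_clm_apply₂ (V := fun _ => w) (W := fun _ => v) hd (by fun_prop) (by fun_prop) u
  have h3 : (fun z => G z v w) =ᶠ[𝓝 y] fun z => G z w v := by
    filter_upwards [hG.isOpen.mem_nhds hy] with z hz using hG.symm z hz v w
  rw [h3.fderiv_eq, h2] at h1
  simpa using h1.symm

lemma IsLocalMetric.ext_right (hG : IsLocalMetric O G) {y : E} (hy : y ∈ O) {v w : E}
    (h : ∀ z, G y v z = G y w z) : v = w := by
  by_contra hne
  have h1 := hG.pos y hy (v - w) (sub_ne_zero.2 hne)
  have h2 := h (v - w)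
  rw [map_sub (G y), sub_apply, h2, sub_self] at h1
  exact lt_irrefl _ h1

lemma localCurv_antisymm (Γ : E → E →L[ℝ] E →L[ℝ] E) (y X Y Z : E) :
    localCurv Γ y X Y Z = -localCurv Γ y Y X Z := by
  simp only [localCurv]; abel

lemma localCurv_add_right (Γ : E → E →L[ℝ] E →L[ℝ] E) (y X Y Z Z' : E) :
    localCurv Γ y X Y (Z + Z') = localCurv Γ y X Y Z + localCurv Γ y X Y Z' := by
  simp only [localCurv, map_add]; abel

lemma localCurv_add_left (Γ : E → E →L[ℝ] E →L[ℝ] E) (y X X' Y Z : E) :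
    localCurv Γ y (X + X') Y Z = localCurv Γ y X Y Z + localCurv Γ y X' Y Z := by
  simp only [localCurv, map_add, add_apply]; abel

lemma localCurv_smul_left (Γ : E → E →L[ℝ] E →L[ℝ] E) (y : E) (c : ℝ) (X Y Z : E) :
    localCurv Γ y (c • X) Y Z = c • localCurv Γ y X Y Z := by
  simp only [localCurv, map_smul, smul_apply, smul_sub, smul_add]

lemma localCurv_smul_right (Γ : E → E →L[ℝ] E →L[ℝ] E) (y : E) (c : ℝ) (X Y Z : E) :
    localCurv Γ y X Y (c • Z) = c • localCurv Γ y X Y Z := by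
  simp only [localCurv, map_smul, smul_sub, smul_add]

lemma contDiffAt_localCurv {P : Type*} [NormedAddCommGroup P] [NormedSpace ℝ P]
    {Γ : E → E →L[ℝ] E →L[ℝ] E} {v X Y Z : P → E} {z : P} (hΓ : ContDiffAt ℝ ∞ Γ (v z))
    (hv : ContDiffAt ℝ ∞ v z) (hX : ContDiffAt ℝ ∞ X z) (hY : ContDiffAt ℝ ∞ Y z)
    (hZ : ContDiffAt ℝ ∞ Z z) :
    ContDiffAt ℝ ∞ (fun z => localCurv Γ (v z) (X z) (Y z) (Z z)) z := by
  have h1 := hΓ.comp z hv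
  have h2 := (contDiffAt_fderiv hΓ).comp z hv
  unfold localCurv
  exact ((((h2.clm_apply hX).clm_apply hY).clm_apply hZ).sub
    (((h2.clm_apply hY).clm_apply hX).clm_apply hZ)).add
    ((h1.clm_apply hX).clm_apply ((h1.clm_apply hY).clm_apply hZ)) |>.sub
    ((h1.clm_apply hY).clm_apply ((h1.clm_apply hX).clm_apply hZ))

lemma contDiffAt_localCov {P : Type*} [NormedAddCommGroup P] [NormedSpace ℝ P]
    {v W : P → E} {z : P} {Γ : E → E →L[ℝ] E →L[ℝ] E} (hΓ : ContDiffAt ℝ ∞ Γ (v z))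
    (hv : ContDiffAt ℝ ∞ v z) (hW : ContDiffAt ℝ ∞ W z) (d : P) :
    ContDiffAt ℝ ∞ (localCov Γ v d W) z :=
  ((contDiffAt_fderiv hW).clm_apply contDiffAt_const).add
    (((hΓ.comp z hv).clm_apply ((contDiffAt_fderiv hv).clm_apply contDiffAt_const)).clm_apply hW)

variable [FiniteDimensional ℝ E]

/-- Positivity makes G injective, and E and its dual have the same dimension. Without this the
operator `inverse` in `localChr` would take its default value 0. -/
lemma IsLocalMetric.isInvertible (hG : IsLocalMetric O G) {y : E} (hy : y ∈ O) :
    (G y).IsInvertible := by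
  have hinj : Function.Injective ((G y : E →L[ℝ] E →L[ℝ] ℝ) : E →ₗ[ℝ] E →L[ℝ] ℝ) := by
    intro v w h
    exact hG.ext_right hy fun z => by
      have := congrArg (fun f : E →L[ℝ] ℝ => f z) h
      simpa using this
  have hdim : Module.finrank ℝ E = Module.finrank ℝ (E →L[ℝ] ℝ) := by
    rw [← (LinearMap.toContinuousLinearMap (𝕜 := ℝ) (E := E) (F' := ℝ)).finrank_eq]
    exact (Subspace.dual_finrank_eq (K := ℝ) (V := E)).symm
  refine ⟨(LinearEquiv.ofInjectiveOfFinrankEq _ hinj hdim).toContinuousLinearEquiv, ?_⟩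
  ext v w
  rfl

lemma IsLocalMetric.chr_spec (hG : IsLocalMetric O G) {y : E} (hy : y ∈ O) (v w z : E) :
    G y (localChr G y v w) z
      = (1 / 2) * (fderiv ℝ G y v w z + fderiv ℝ G y w v z - fderiv ℝ G y z v w) := by
  rw [localChr_apply, (hG.isInvertible hy).self_apply_inverse]
  simp

lemma IsLocalMetric.chr_symm (hG : IsLocalMetric O G) {y : E} (hy : y ∈ O) (v w : E) :
    localChr G y v w = localChr G y w v :=
  hG.ext_right hy fun z => by
    rw [hG.chr_spec hy, hG.chr_spec hy, hG.fderiv_symm hy z v w]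
    ring

/-- In the sum of the two Koszul formulas four of the six derivatives cancel. -/
lemma IsLocalMetric.compat (hG : IsLocalMetric O G) {y : E} (hy : y ∈ O) (u v w : E) :
    fderiv ℝ G y u v w = G y (localChr G y u v) w + G y v (localChr G y u w) := by
  rw [hG.symm y hy v, hG.chr_spec hy, hG.chr_spec hy, hG.fderiv_symm hy u w v,
    hG.fderiv_symm hy v u w, hG.fderiv_symm hy w u v]
  ring

lemma IsLocalMetric.contDiffAt_chr (hG : IsLocalMetric O G) {y : E} (hy : y ∈ O) :
    ContDiffAt ℝ ∞ (localChr G) y := by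
  have h1 := hG.contDiffAt hy
  have h2 := contDiffAt_fderiv h1
  have h3 : ContDiffAt ℝ ∞ (fun y => inverse (G y)) y := by
    obtain ⟨e, he⟩ := hG.isInvertible hy
    exact ContDiffAt.comp y (g := inverse) (he ▸ contDiffAt_map_inverse e) h1
  have h4 : ContDiffAt ℝ ∞ (fun y => (fderiv ℝ G y).flip) y :=
    (flipₗᵢ ℝ E E (E →L[ℝ] ℝ)).contDiff.contDiffAt.comp y h2
  unfold localChr
  refine ContDiffAt.clm_comp ((compL ℝ E (E →L[ℝ] ℝ) E).contDiff.contDiffAt.comp y h3) ?_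
  refine ((h2.add h4).sub ?_).const_smul (1 / 2 : ℝ)
  exact contDiffAt_const.clm_comp h4

lemma IsLocalMetric.differentiableAt_chr (hG : IsLocalMetric O G) {y : E} (hy : y ∈ O) :
    DifferentiableAt ℝ (localChr G) y := differentiableAt_of_smooth (hG.contDiffAt_chr hy)

/-! #### Curvature -/

lemma IsLocalMetric.fderiv_chr_symm (hG : IsLocalMetric O G) {y : E} (hy : y ∈ O) (u v w : E) :
    fderiv ℝ (localChr G) y u v w = fderiv ℝ (localChr G) y u w v := by
  have hd := hG.differentiableAt_chr hy
  have h1 := fderiv_clm_apply₂ (V := fun _ => v) (W := fun _ => w) hd (by fun_prop) (by fun_prop) u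
  have h2 := fderiv_clm_apply₂ (V := fun _ => w) (W := fun _ => v) hd (by fun_prop) (by fun_prop) u
  have h3 : (fun z => localChr G z v w) =ᶠ[𝓝 y] fun z => localChr G z w v := by
    filter_upwards [hG.isOpen.mem_nhds hy] with z hz using hG.chr_symm hz v w
  rw [h3.fderiv_eq, h2] at h1
  simpa using h1.symm

lemma IsLocalMetric.bianchi (hG : IsLocalMetric O G) {y : E} (hy : y ∈ O) (X Y Z : E) :
    localCurv (localChr G) y X Y Z + localCurv (localChr G) y Y Z X
      + localCurv (localChr G) y Z X Y = 0 := by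
  simp only [localCurv]
  rw [hG.fderiv_chr_symm hy X Y Z, hG.fderiv_chr_symm hy Y X Z, hG.fderiv_chr_symm hy Z Y X,
    hG.chr_symm hy Y Z, hG.chr_symm hy X Z, hG.chr_symm hy Y X]
  abel

/-- Metric compatibility differentiated once more; its antisymmetrisation in X and Y is the skew
symmetry of the curvature. -/
lemma IsLocalMetric.second_deriv (hG : IsLocalMetric O G) {y : E} (hy : y ∈ O) (X Y Z W : E) :
    fderiv ℝ (fderiv ℝ G) y X Y Z W =
      fderiv ℝ G y X (localChr G y Y Z) W + G y (fderiv ℝ (localChr G) y X Y Z) W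
      + fderiv ℝ G y X Z (localChr G y Y W) + G y Z (fderiv ℝ (localChr G) y X Y W) := by
  have hG1 := hG.contDiffAt hy
  have hd := differentiableAt_of_smooth hG1
  have hd2 := differentiableAt_of_smooth (contDiffAt_fderiv hG1)
  have hΓ := hG.differentiableAt_chr hy
  have h1 : fderiv ℝ (fun y => fderiv ℝ G y Y Z W) y X = fderiv ℝ (fderiv ℝ G) y X Y Z W := by
    rw [fderiv_clm_apply_const (A := fun y => fderiv ℝ G y Y Z)
      ((hd2.clm_apply (by fun_prop)).clm_apply (by fun_prop)),
      fderiv_clm_apply_const (A := fun y => fderiv ℝ G y Y) (hd2.clm_apply (by fun_prop)),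
      fderiv_clm_apply_const hd2]
  have hc : ∀ V, DifferentiableAt ℝ (fun y => localChr G y Y V) y := fun V =>
    (hΓ.clm_apply (by fun_prop)).clm_apply (by fun_prop)
  have hc' : ∀ V, fderiv ℝ (fun y => localChr G y Y V) y X = fderiv ℝ (localChr G) y X Y V := by
    intro V
    rw [fderiv_clm_apply₂ (V := fun _ => Y) (W := fun _ => V) hΓ (by fun_prop) (by fun_prop)]
    simp
  have h2 : (fun y => fderiv ℝ G y Y Z W) =ᶠ[𝓝 y]
      fun y => G y (localChr G y Y Z) W + G y Z (localChr G y Y W) := by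
    filter_upwards [hG.isOpen.mem_nhds hy] with z hz using hG.compat hz Y Z W
  have hA : DifferentiableAt ℝ (fun y => G y (localChr G y Y Z) W) y :=
    (hd.clm_apply (hc Z)).clm_apply (by fun_prop)
  have hB : DifferentiableAt ℝ (fun y => G y Z (localChr G y Y W)) y :=
    (hd.clm_apply (by fun_prop)).clm_apply (hc W)
  rw [← h1, h2.fderiv_eq, fderiv_fun_add hA hB, add_apply,
    fderiv_clm_apply₂ (W := fun _ => W) hd (hc Z) (by fun_prop),
    fderiv_clm_apply₂ (V := fun _ => Z) hd (by fun_prop) (hc W), hc', hc']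
  simp
  ring

/-- The second derivatives of G commute, so the antisymmetrisation of `second_deriv` in X and Y
vanishes; after replacing first derivatives of G through `compat`, what remains is the curvature
identity. -/
lemma IsLocalMetric.curv_skew (hG : IsLocalMetric O G) {y : E} (hy : y ∈ O) (X Y Z W : E) :
    G y (localCurv (localChr G) y X Y Z) W = -G y (localCurv (localChr G) y X Y W) Z := by
  have h1 := hG.second_deriv hy X Y Z W
  have h2 := hG.second_deriv hy Y X Z W
  have h3 := congrArg (fun A : E →L[ℝ] E →L[ℝ] ℝ => A Z W)
    (fderiv_fderiv_symm (hG.contDiffAt hy) X Y)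
  rw [h1, h2] at h3
  rw [hG.compat hy X, hG.compat hy X, hG.compat hy Y, hG.compat hy Y] at h3
  rw [hG.symm y hy _ Z]
  simp only [localCurv, map_add, map_sub, add_apply, sub_apply]
  linarith

/-- The classical octahedron argument: a linear consequence of four instances of the first Bianchi
identity and the two skew symmetries. -/
lemma IsLocalMetric.curv_pair (hG : IsLocalMetric O G) {y : E} (hy : y ∈ O) (X Y Z W : E) :
    G y (localCurv (localChr G) y X Y Z) W = G y (localCurv (localChr G) y Z W X) Y := by
  have b : ∀ X Y Z W, G y (localCurv (localChr G) y X Y Z) W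
      + G y (localCurv (localChr G) y Y Z X) W + G y (localCurv (localChr G) y Z X Y) W = 0 := by
    intro X Y Z W
    rw [← add_apply, ← map_add, ← add_apply, ← map_add, hG.bianchi hy]
    simp
  have a : ∀ X Y Z W, G y (localCurv (localChr G) y X Y Z) W
      = -G y (localCurv (localChr G) y Y X Z) W := by
    intro X Y Z W
    rw [localCurv_antisymm]; simp
  have s := hG.curv_skew hy
  linarith [b X Y Z W, b Y Z W X, b Z W X Y, b W X Y Z, a X Y Z W, a X Y W Z, a Y Z X W, a Y Z W X,
    a Z W X Y, a Z W Y X, a W X Y Z, a W X Z Y, a Z X Y W, a Z X W Y, a W Y Z X, a W Y X Z,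
    s X Y Z W, s Y Z X W, s Z X Y W, s Y Z W X, s Z W Y X, s W Y Z X, s Z W X Y, s W X Z Y,
    s X Z W Y, s W X Y Z, s X Y W Z, s Y W X Z, a X Z W Y, a X Z Y W, a Y W X Z, a Y W Z X]

/-! #### Change of coordinates -/

section Transform

variable {O' : Set E} {G' : E → E →L[ℝ] E →L[ℝ] ℝ} {φ : E → E}

/-- `φ` maps `O` to `O'` and is a local diffeomorphism for which `G` is the pullback of `G'`. -/
structure IsLocalIsometry (O O' : Set E) (G G' : E → E →L[ℝ] E →L[ℝ] ℝ) (φ : E → E) : Prop where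
  source : IsLocalMetric O G
  target : IsLocalMetric O' G'
  smooth : ContDiffOn ℝ ∞ φ O
  mapsTo : Set.MapsTo φ O O'
  surj : ∀ y ∈ O, Function.Surjective (fderiv ℝ φ y)
  pullback : ∀ y ∈ O, ∀ v w, G y v w = G' (φ y) (fderiv ℝ φ y v) (fderiv ℝ φ y w)

variable (hφ : IsLocalIsometry O O' G G' φ) {y : E}

include hφ

lemma IsLocalIsometry.contDiffAt (hy : y ∈ O) : ContDiffAt ℝ ∞ φ y :=
  hφ.smooth.contDiffAt (hφ.source.isOpen.mem_nhds hy)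

lemma IsLocalIsometry.fderiv_metric (hy : y ∈ O) (u v w : E) :
    fderiv ℝ G y u v w =
      fderiv ℝ G' (φ y) (fderiv ℝ φ y u) (fderiv ℝ φ y v) (fderiv ℝ φ y w)
      + G' (φ y) (fderiv ℝ (fderiv ℝ φ) y u v) (fderiv ℝ φ y w)
      + G' (φ y) (fderiv ℝ φ y v) (fderiv ℝ (fderiv ℝ φ) y u w) := by
  have h0 := hφ.contDiffAt hy
  have hd := differentiableAt_of_smooth (hφ.source.contDiffAt hy)
  have hd' := differentiableAt_of_smooth (hφ.target.contDiffAt (hφ.mapsTo hy))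
  have hφ1 := differentiableAt_of_smooth h0
  have hφ2 := differentiableAt_of_smooth (contDiffAt_fderiv h0)
  have h1 : (fun y => G y v w) =ᶠ[𝓝 y]
      fun y => G' (φ y) (fderiv ℝ φ y v) (fderiv ℝ φ y w) := by
    filter_upwards [hφ.source.isOpen.mem_nhds hy] with z hz using hφ.pullback z hz v w
  have h2 := h1.fderiv_eq (𝕜 := ℝ)
  have h3 := congrArg (fun f => f u) h2
  rw [fderiv_clm_apply₂ (V := fun _ => v) (W := fun _ => w) hd (by fun_prop) (by fun_prop),
    fderiv_clm_apply₂ (A := fun y => G' (φ y)) (V := fun y => fderiv ℝ φ y v)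
    (W := fun y => fderiv ℝ φ y w) (hd'.comp y hφ1) (hφ2.clm_apply (by fun_prop))
    (hφ2.clm_apply (by fun_prop)), fderiv_comp_apply hd' hφ1, fderiv_clm_apply_const hφ2,
    fderiv_clm_apply_const hφ2] at h3
  simpa using h3

/-- Both sides are compared through the Koszul formula. By surjectivity every test vector is an
image Dφ z, and the second derivatives of φ combine into the inhomogeneous term. -/
lemma IsLocalIsometry.chr (hy : y ∈ O) (v w : E) :
    fderiv ℝ φ y (localChr G y v w) =
      localChr G' (φ y) (fderiv ℝ φ y v) (fderiv ℝ φ y w) + fderiv ℝ (fderiv ℝ φ) y v w := by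
  refine hφ.target.ext_right (hφ.mapsTo hy) fun z' => ?_
  obtain ⟨z, rfl⟩ := hφ.surj y hy z'
  have s := fderiv_fderiv_symm (hφ.contDiffAt hy)
  rw [← hφ.pullback y hy, hφ.source.chr_spec hy, map_add, add_apply,
    hφ.target.chr_spec (hφ.mapsTo hy), hφ.fderiv_metric hy, hφ.fderiv_metric hy,
    hφ.fderiv_metric hy, s w v, s z v, s z w,
    hφ.target.symm _ (hφ.mapsTo hy) (fderiv ℝ φ y w) (fderiv ℝ (fderiv ℝ φ) y v z)]
  ring

/-- The derivative of the transformation law `chr`. The third derivative of φ is written as a second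
derivative of y ↦ Dφ(y) Z, so that its symmetry in X and Y is an instance of the symmetry of second
derivatives. -/
lemma IsLocalIsometry.fderiv_chr (hy : y ∈ O) (X Y Z : E) :
    fderiv ℝ (localChr G') (φ y) (fderiv ℝ φ y X) (fderiv ℝ φ y Y) (fderiv ℝ φ y Z)
      + localChr G' (φ y) (fderiv ℝ (fderiv ℝ φ) y X Y) (fderiv ℝ φ y Z)
      + localChr G' (φ y) (fderiv ℝ φ y Y) (fderiv ℝ (fderiv ℝ φ) y X Z)
      + fderiv ℝ (fderiv ℝ (fun y => fderiv ℝ φ y Z)) y X Y =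
    fderiv ℝ (fderiv ℝ φ) y X (localChr G y Y Z)
      + fderiv ℝ φ y (fderiv ℝ (localChr G) y X Y Z) := by
  have h0 := hφ.contDiffAt hy
  have h00 := contDiffAt_fderiv h0
  have hΓ := hφ.source.differentiableAt_chr hy
  have hΓ' := hφ.target.differentiableAt_chr (hφ.mapsTo hy)
  have hφ1 := differentiableAt_of_smooth h0
  have hφ2 := differentiableAt_of_smooth h00
  have hφ3 : ContDiffAt ℝ ∞ (fun y => fderiv ℝ φ y Z) y := h00.clm_apply contDiffAt_const
  have hφ4 := differentiableAt_of_smooth (contDiffAt_fderiv hφ3)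
  have h1 : (fun y => fderiv ℝ φ y (localChr G y Y Z)) =ᶠ[𝓝 y]
      fun y => localChr G' (φ y) (fderiv ℝ φ y Y) (fderiv ℝ φ y Z)
        + fderiv ℝ (fun y => fderiv ℝ φ y Z) y Y := by
    filter_upwards [hφ.source.isOpen.mem_nhds hy] with z hz
    rw [fderiv_clm_apply_const
      (differentiableAt_of_smooth (contDiffAt_fderiv (hφ.contDiffAt hz)))]
    exact hφ.chr hz Y Z
  have h2 := congrArg (fun f => f X) (h1.fderiv_eq (𝕜 := ℝ))
  have hc : DifferentiableAt ℝ (fun y => localChr G y Y Z) y :=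
    (hΓ.clm_apply (by fun_prop)).clm_apply (by fun_prop)
  have hY : DifferentiableAt ℝ (fun y => fderiv ℝ φ y Y) y := hφ2.clm_apply (by fun_prop)
  have hZ : DifferentiableAt ℝ (fun y => fderiv ℝ φ y Z) y := hφ2.clm_apply (by fun_prop)
  have hΓφ : DifferentiableAt ℝ (fun y => localChr G' (φ y)) y := hΓ'.comp y hφ1
  rw [fderiv_clm_apply₁ hφ2 hc, fderiv_fun_add ((hΓφ.clm_apply hY).clm_apply hZ)
    (hφ4.clm_apply (by fun_prop)), add_apply, fderiv_clm_apply₂ hΓφ hY hZ,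
    fderiv_comp_apply hΓ' hφ1, fderiv_clm_apply_const hφ2, fderiv_clm_apply_const hφ2,
    fderiv_clm_apply_const hφ4,
    fderiv_clm_apply₂ (V := fun _ => Y) (W := fun _ => Z) hΓ (by fun_prop) (by fun_prop)] at h2
  simpa using h2.symm

/-- Antisymmetrising `fderiv_chr` in X and Y removes the second and third derivatives of φ that have
both X and Y as arguments; the remaining inhomogeneous terms cancel against those from applying
`chr` to the quadratic part of the curvature. -/
lemma IsLocalIsometry.curv (hy : y ∈ O) (X Y Z : E) :
    fderiv ℝ φ y (localCurv (localChr G) y X Y Z) =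
      localCurv (localChr G') (φ y) (fderiv ℝ φ y X) (fderiv ℝ φ y Y) (fderiv ℝ φ y Z) := by
  have h0 := hφ.contDiffAt hy
  have s := fderiv_fderiv_symm h0 X Y
  have s3 := fderiv_fderiv_symm ((contDiffAt_fderiv h0).clm_apply (contDiffAt_const (c := Z))) X Y
  have e1 := hφ.fderiv_chr hy X Y Z
  have e2 := hφ.fderiv_chr hy Y X Z
  have c1 := hφ.chr hy X (localChr G y Y Z)
  have c2 := hφ.chr hy Y (localChr G y X Z)
  rw [hφ.chr hy Y Z, map_add] at c1
  rw [hφ.chr hy X Z, map_add] at c2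
  simp only [localCurv, map_add, map_sub]
  rw [c1, c2, eq_sub_of_add_eq' e1.symm, eq_sub_of_add_eq' e2.symm, s, s3]
  abel

/-- The derivative of Dφ along v is compensated by the inhomogeneous term in the transformation law
of the Christoffel symbols. -/
lemma IsLocalIsometry.cov {P : Type*} [NormedAddCommGroup P] [NormedSpace ℝ P] {v W : P → E}
    {z : P} (hv : DifferentiableAt ℝ v z) (hW : DifferentiableAt ℝ W z) (hz : v z ∈ O) (d : P) :
    localCov (localChr G') (fun z => φ (v z)) d (fun z => fderiv ℝ φ (v z) (W z)) z
      = fderiv ℝ φ (v z) (localCov (localChr G) v d W z) := by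
  have h0 := hφ.contDiffAt hz
  have h1 := differentiableAt_of_smooth h0
  have h2 := differentiableAt_of_smooth (contDiffAt_fderiv h0)
  simp only [localCov]
  rw [fderiv_clm_apply₁ (A := fun z => fderiv ℝ φ (v z)) (h2.comp z hv) hW, fderiv_comp_apply h2 hv,
    fderiv_comp_apply h1 hv, map_add, hφ.chr hz]
  abel

end Transform

/-! #### Covariant derivatives of fields along maps -/

section Along

variable {P : Type*} [NormedAddCommGroup P] [NormedSpace ℝ P] {v V W : P → E} {z : P}

lemma IsLocalMetric.deriv_inner (hG : IsLocalMetric O G) (hz : v z ∈ O)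
    (hv : DifferentiableAt ℝ v z) (hV : DifferentiableAt ℝ V z) (hW : DifferentiableAt ℝ W z)
    (d : P) : fderiv ℝ (fun z => G (v z) (V z) (W z)) z d =
      G (v z) (localCov (localChr G) v d V z) (W z)
      + G (v z) (V z) (localCov (localChr G) v d W z) := by
  have hd := differentiableAt_of_smooth (hG.contDiffAt hz)
  rw [fderiv_clm_apply₂ (A := fun z => G (v z)) (hd.comp z hv) hV hW, fderiv_comp_apply hd hv,
    hG.compat hz]
  simp only [localCov, map_add, add_apply]
  ring

lemma IsLocalMetric.torsion_free (hG : IsLocalMetric O G) (hz : v z ∈ O)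
    (hv : ContDiffAt ℝ ∞ v z) (d d' : P) :
    localCov (localChr G) v d (fun z => fderiv ℝ v z d') z
      = localCov (localChr G) v d' (fun z => fderiv ℝ v z d) z := by
  have h2 := differentiableAt_of_smooth (contDiffAt_fderiv hv)
  simp only [localCov]
  rw [fderiv_clm_apply_const h2, fderiv_clm_apply_const h2, fderiv_fderiv_symm hv,
    hG.chr_symm hz]

/-- No bracket term occurs because d and d' are constant directions in the parameter space. -/
lemma IsLocalMetric.cov_comm (hG : IsLocalMetric O G) (hz : v z ∈ O)
    (hv : ContDiffAt ℝ ∞ v z) (hW : ContDiffAt ℝ ∞ W z) (d d' : P) :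
    localCov (localChr G) v d (localCov (localChr G) v d' W) z
      - localCov (localChr G) v d' (localCov (localChr G) v d W) z
      = localCurv (localChr G) (v z) (fderiv ℝ v z d) (fderiv ℝ v z d') (W z) := by
  have hΓ := hG.differentiableAt_chr hz
  have hv1 := differentiableAt_of_smooth hv
  have hv2 := differentiableAt_of_smooth (contDiffAt_fderiv hv)
  have hW1 := differentiableAt_of_smooth hW
  have hW2 := differentiableAt_of_smooth (contDiffAt_fderiv hW)
  have key : ∀ d d' : P, fderiv ℝ (localCov (localChr G) v d' W) z d =
      fderiv ℝ (fderiv ℝ W) z d d' +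
      (fderiv ℝ (localChr G) (v z) (fderiv ℝ v z d) (fderiv ℝ v z d') (W z)
      + localChr G (v z) (fderiv ℝ (fderiv ℝ v) z d d') (W z)
      + localChr G (v z) (fderiv ℝ v z d') (fderiv ℝ W z d)) := by
    intro d d'
    unfold localCov
    have hA : DifferentiableAt ℝ (fun z => localChr G (v z)) z :=
      DifferentiableAt.comp (g := localChr G) z hΓ hv1
    have hB : DifferentiableAt ℝ (fun z => fderiv ℝ v z d') z := hv2.clm_apply (by fun_prop)
    rw [fderiv_fun_add (hW2.clm_apply (by fun_prop)) ((hA.clm_apply hB).clm_apply hW1), add_apply,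
      fderiv_clm_apply_const hW2, fderiv_clm_apply₂ hA hB hW1, fderiv_comp_apply hΓ hv1,
      fderiv_clm_apply_const hv2]
  change (fderiv ℝ (localCov (localChr G) v d' W) z d + _)
    - (fderiv ℝ (localCov (localChr G) v d W) z d' + _) = _
  rw [key, key, fderiv_fderiv_symm hW d' d, fderiv_fderiv_symm hv d' d]
  simp only [localCov, localCurv, map_add]
  abel

end Along

end LocalGeometry

/-! ### Curvature symmetries of a Kähler metric in a holomorphic chart -/

section LocalKahler

set_option maxSynthPendingDepth 3
set_option linter.unusedSectionVars false

open ContinuousLinearMap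

variable {E : Type*} [NormedAddCommGroup E] [NormedSpace ℂ E] [FiniteDimensional ℂ E]
  {O : Set E} {G : E → E →L[ℝ] E →L[ℝ] ℝ}

/-- Multiplication by i is constant in the chart and commutes with Γ on an open set, hence it also
commutes with the derivatives of Γ. -/
lemma IsLocalMetric.curv_I_right (hG : IsLocalMetric O G)
    (hJ : ∀ y ∈ O, ∀ v w, localChr G y v (Complex.I • w) = Complex.I • localChr G y v w)
    {y : E} (hy : y ∈ O) (X Y Z : E) :
    localCurv (localChr G) y X Y (Complex.I • Z) = Complex.I • localCurv (localChr G) y X Y Z := by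
  have hΓ := hG.differentiableAt_chr hy
  have key : ∀ X Y, fderiv ℝ (localChr G) y X Y (Complex.I • Z) =
      Complex.I • fderiv ℝ (localChr G) y X Y Z := by
    intro X Y
    have h1 : (fun y => localChr G y Y (Complex.I • Z)) =ᶠ[𝓝 y]
        fun y => Complex.I • localChr G y Y Z := by
      filter_upwards [hG.isOpen.mem_nhds hy] with z hz using hJ z hz Y Z
    have h2 := congrArg (fun f => f X) (h1.fderiv_eq (𝕜 := ℝ))
    have h3 : ∀ V, fderiv ℝ (fun y => localChr G y Y V) y X = fderiv ℝ (localChr G) y X Y V := by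
      intro V
      rw [fderiv_clm_apply₂ (V := fun _ => Y) (W := fun _ => V) hΓ (by fun_prop) (by fun_prop)]
      simp
    rw [h3, fderiv_fun_const_smul ((hΓ.clm_apply (by fun_prop)).clm_apply (by fun_prop))] at h2
    rw [h2, smul_apply, h3]
  simp only [localCurv, key, hJ y hy, smul_sub, smul_add]

/-- Pair symmetry moves X and Y to the slots where i commutes with the curvature and is an isometry,
and then moves them back. -/
lemma IsLocalMetric.curv_I_I (hG : IsLocalMetric O G)
    (hH : ∀ y ∈ O, ∀ v w, G y (Complex.I • v) (Complex.I • w) = G y v w)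
    (hJ : ∀ y ∈ O, ∀ v w, localChr G y v (Complex.I • w) = Complex.I • localChr G y v w)
    {y : E} (hy : y ∈ O) (X Y Z : E) :
    localCurv (localChr G) y (Complex.I • X) (Complex.I • Y) Z = localCurv (localChr G) y X Y Z := by
  refine hG.ext_right hy fun W => ?_
  rw [hG.curv_pair hy, hG.curv_I_right hJ hy, hH y hy, hG.curv_pair hy]

end LocalKahler

end KahlerFlow
end

noncomputable section
namespace KahlerFlow

/-! ### Riemannian geometry of a complex manifold in its preferred charts -/

section Charts

set_option maxSynthPendingDepth 3
set_option linter.unusedSectionVars false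

open Set

variable {E : Type*} [NormedAddCommGroup E] [NormedSpace ℂ E]
  {N : Type*} [TopologicalSpace N] [ChartedSpace E N] [IsManifold 𝓘(ℂ, E) ω N]

/-- The coordinates of tangent vectors at `q` in the preferred chart at `p`. -/
def toChart (E : Type*) [NormedAddCommGroup E] [NormedSpace ℂ E]
    {N : Type*} [TopologicalSpace N] [ChartedSpace E N] [IsManifold 𝓘(ℂ, E) ω N] (p q : N) : E →L[ℝ] E :=
  tangentCoordChange 𝓘(ℝ, E) q p q

/-- The transition map from the preferred chart at `p` to the preferred chart at `p'`. -/
def transition (E : Type*) [NormedAddCommGroup E] [NormedSpace ℂ E]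
    {N : Type*} [TopologicalSpace N] [ChartedSpace E N] (p p' : N) (y : E) : E :=
  extChartAt 𝓘(ℝ, E) p' ((extChartAt 𝓘(ℝ, E) p).symm y)

/-- The domain of `transition E p p'`. -/
def transitionSource (E : Type*) [NormedAddCommGroup E] [NormedSpace ℂ E]
    {N : Type*} [TopologicalSpace N] [ChartedSpace E N] (p p' : N) : Set E :=
  (extChartAt 𝓘(ℝ, E) p).target ∩ (extChartAt 𝓘(ℝ, E) p).symm ⁻¹' (chartAt E p').source

lemma isOpen_transitionSource (p p' : N) : IsOpen (transitionSource E p p') := by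
  have := (continuousOn_extChartAt_symm (I := 𝓘(ℝ, E)) p).isOpen_inter_preimage
    (isOpen_extChartAt_target p) (chartAt E p').open_source
  exact this

lemma mem_transitionSource {p p' q : N} (hp : q ∈ (chartAt E p).source)
    (hp' : q ∈ (chartAt E p').source) :
    extChartAt 𝓘(ℝ, E) p q ∈ transitionSource E p p' := by
  have hp2 : q ∈ (extChartAt 𝓘(ℝ, E) p).source := by rwa [extChartAt_source]
  refine ⟨(extChartAt 𝓘(ℝ, E) p).map_source hp2, ?_⟩
  rw [mem_preimage, (extChartAt 𝓘(ℝ, E) p).left_inv hp2]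
  exact hp'

lemma transition_apply {p q : N} (p' : N) (hp : q ∈ (chartAt E p).source) :
    transition E p p' (extChartAt 𝓘(ℝ, E) p q) = extChartAt 𝓘(ℝ, E) p' q := by
  rw [transition, (extChartAt 𝓘(ℝ, E) p).left_inv (by rwa [extChartAt_source])]

lemma contDiffOn_transition_complex (p p' : N) :
    ContDiffOn ℂ ω (transition E p p') (transitionSource E p p') := by
  have h := contDiffOn_ext_coord_change (n := ω) (I := 𝓘(ℂ, E)) (M := N)
    p' p
  refine h.mono fun y hy => ?_
  rw [PartialEquiv.trans_source, PartialEquiv.symm_source]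
  refine ⟨hy.1, ?_⟩
  rw [mem_preimage, extChartAt_source]
  exact hy.2

lemma contDiffOn_transition (p p' : N) :
    ContDiffOn ℝ ∞ (transition E p p') (transitionSource E p p') :=
  ((contDiffOn_transition_complex p p').restrict_scalars ℝ).of_le le_top

lemma tangentCoordChange_eq_fderiv {p q : N} (p' : N) :
    tangentCoordChange 𝓘(ℝ, E) p p' q
      = fderiv ℝ (transition E p p') (extChartAt 𝓘(ℝ, E) p q) := by
  rw [tangentCoordChange_def, ModelWithCorners.range_eq_univ, fderivWithin_univ]
  rfl

/-- Transition maps are holomorphic, so their real derivatives are complex linear. This is what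
makes multiplication by i independent of the chart. -/
lemma fderiv_transition_I {p p' : N} {y : E} (hy : y ∈ transitionSource E p p') (v : E) :
    fderiv ℝ (transition E p p') y (Complex.I • v)
      = Complex.I • fderiv ℝ (transition E p p') y v := by
  have h := ((contDiffOn_transition_complex p p').contDiffAt
    ((isOpen_transitionSource p p').mem_nhds hy)).differentiableAt (by simp)
  rw [h.fderiv_restrictScalars ℝ]
  simp

lemma toChart_I {p q : N} (hq : q ∈ (chartAt E p).source) (v : E) :
    toChart E p q (Complex.I • v) = Complex.I • toChart E p q v := by
  rw [toChart, tangentCoordChange_eq_fderiv]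
  exact fderiv_transition_I (mem_transitionSource (mem_chart_source E q) hq) v

lemma toChart_self (p : N) (v : E) : toChart E p p v = v :=
  tangentCoordChange_self (mem_extChartAt_source p)

lemma toChart_comp {p p' q : N} (hp : q ∈ (chartAt E p).source) (hp' : q ∈ (chartAt E p').source)
    (v : E) : tangentCoordChange 𝓘(ℝ, E) p p' q (toChart E p q v) = toChart E p' q v :=
  tangentCoordChange_comp (by simp [hp, hp'])

lemma toChart_change {p p' q : N} (hp : q ∈ (chartAt E p).source)
    (hp' : q ∈ (chartAt E p').source) (v : E) :
    toChart E p' q v = fderiv ℝ (transition E p p') (extChartAt 𝓘(ℝ, E) p q) (toChart E p q v) := by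
  rw [← tangentCoordChange_eq_fderiv, toChart_comp hp hp']

/-- The tangent vector at `q` with given coordinates in the preferred chart at `p`. -/
def ofChart (E : Type*) [NormedAddCommGroup E] [NormedSpace ℂ E]
    {N : Type*} [TopologicalSpace N] [ChartedSpace E N] [IsManifold 𝓘(ℂ, E) ω N] (p q : N) : E →L[ℝ] E :=
  tangentCoordChange 𝓘(ℝ, E) p q q

lemma toChart_ofChart {p q : N} (hq : q ∈ (chartAt E p).source) (v : E) :
    toChart E p q (ofChart E p q v) = v := by
  rw [toChart, ofChart, tangentCoordChange_comp (by simp [hq]), tangentCoordChange_self (by simp [hq])]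

lemma ofChart_toChart {p q : N} (hq : q ∈ (chartAt E p).source) (v : E) :
    ofChart E p q (toChart E p q v) = v := by
  rw [toChart, ofChart, tangentCoordChange_comp (by simp [hq]), tangentCoordChange_self (by simp)]

lemma toChart_injective {p q : N} (hq : q ∈ (chartAt E p).source) {v w : E}
    (h : toChart E p q v = toChart E p q w) : v = w := by
  rw [← ofChart_toChart hq v, h, ofChart_toChart hq]

lemma trivializationAt_snd (p : N) (z : TangentBundle 𝓘(ℝ, E) N) :
    (trivializationAt E (TangentSpace 𝓘(ℝ, E)) p z).2 = toChart E p z.1 z.2 := by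
  rw [TangentBundle.trivializationAt_apply]
  rfl

lemma contMDiffOn_ofChart (p : N) (v : E) :
    ContMDiffOn 𝓘(ℝ, E) 𝓘(ℝ, E).tangent ∞
      (fun q : N => (⟨q, ofChart E p q v⟩ : TangentBundle 𝓘(ℝ, E) N)) (chartAt E p).source := by
  refine ((trivializationAt E (TangentSpace 𝓘(ℝ, E)) p).contMDiffOn_iff (n := ∞) ?_).2
    ⟨contMDiffOn_id, ?_⟩
  · intro q hq
    rw [TangentBundle.trivializationAt_source]
    exact hq
  · refine (contMDiffOn_const (c := v)).congr fun q hq => ?_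
    rw [trivializationAt_snd]
    exact toChart_ofChart hq v

/-- The metric at `q`, in the preferred chart at `q`. -/
def metricAt (h : RMetric E N) (q : N) : E →L[ℝ] E →L[ℝ] ℝ := h.inner q

/-- The curvature tensor at `q`, in the preferred chart at `q`. -/
def curvAt (h : RMetric E N) (q : N) (X Y Z : E) : E :=
  curvatureInChart h q (extChartAt 𝓘(ℝ, E) q q) X Y Z

variable (h : RMetric E N)

lemma metricAt_symm (q : N) (v w : E) : metricAt h q v w = metricAt h q w v := h.symm q v w

lemma metricAt_pos (q : N) (v : E) (hv : v ≠ 0) : 0 < metricAt h q v v := h.pos q v hv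

lemma metricInChart_apply (p : N) (y v w : E) : metricInChart h p y v w =
    metricAt h ((extChartAt 𝓘(ℝ, E) p).symm y) (ofChart E p ((extChartAt 𝓘(ℝ, E) p).symm y) v)
      (ofChart E p ((extChartAt 𝓘(ℝ, E) p).symm y) w) := rfl

lemma metricAt_eq {p q : N} (hq : q ∈ (chartAt E p).source) (v w : E) :
    metricAt h q v w
      = metricInChart h p (extChartAt 𝓘(ℝ, E) p q) (toChart E p q v) (toChart E p q w) := by
  rw [metricInChart_apply, (extChartAt 𝓘(ℝ, E) p).left_inv (by rwa [extChartAt_source]),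
    ofChart_toChart hq, ofChart_toChart hq]

/-- The Christoffel symbols of the preferred chart at `p`. -/
def chartChr (p : N) : E → E →L[ℝ] E →L[ℝ] E := localChr (metricInChart h p)

lemma symm_mem_source {p : N} {y : E} (hy : y ∈ (extChartAt 𝓘(ℝ, E) p).target) :
    (extChartAt 𝓘(ℝ, E) p).symm y ∈ (chartAt E p).source := by
  have := (extChartAt 𝓘(ℝ, E) p).map_target hy
  rwa [extChartAt_source] at this

lemma contMDiffOn_metricAt (p : N) (v w : E) :
    ContMDiffOn 𝓘(ℝ, E) 𝓘(ℝ, ℝ) ∞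
      (fun q : N => metricAt h q (ofChart E p q v) (ofChart E p q w)) (chartAt E p).source := by
  intro q hq
  have : ContMDiffWithinAt 𝓘(ℝ, E) (𝓘(ℝ, E).prod 𝓘(ℝ)) ∞
      (fun m : N ↦ Bundle.TotalSpace.mk' ℝ (E := Bundle.Trivial N ℝ) m
        (h.inner m (ofChart E p m v) (ofChart E p m w))) (chartAt E p).source q := by
    apply ContMDiffWithinAt.clm_bundle_apply₂ (F₁ := E) (F₂ := E)
    · exact h.contMDiff.contMDiffAt.contMDiffWithinAt
    · exact contMDiffOn_ofChart p v q hq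
    · exact contMDiffOn_ofChart p w q hq
  rw [Bundle.contMDiffWithinAt_totalSpace] at this
  exact this.2

variable [FiniteDimensional ℂ E]

lemma contDiffOn_metricInChart (p : N) :
    ContDiffOn ℝ ∞ (metricInChart h p) (extChartAt 𝓘(ℝ, E) p).target := by
  refine contDiffOn_clm_apply.2 fun v => contDiffOn_clm_apply.2 fun w => ?_
  have h2 := contMDiffOn_extChartAt_symm (I := 𝓘(ℝ, E)) (n := ∞) p
  have h3 := ((contMDiffOn_metricAt h p v w).comp h2 fun y hy => symm_mem_source hy).contDiffOn
  exact h3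

lemma isLocalMetric_metricInChart (p : N) :
    IsLocalMetric (extChartAt 𝓘(ℝ, E) p).target (metricInChart h p) where
  isOpen := isOpen_extChartAt_target p
  smooth := contDiffOn_metricInChart h p
  symm y _ v w := by
    rw [metricInChart_apply, metricInChart_apply, metricAt_symm]
  pos y hy v hv := by
    rw [metricInChart_apply]
    refine metricAt_pos h _ _ fun h0 => hv ?_
    rw [← toChart_ofChart (symm_mem_source hy) v, h0, map_zero]

/-- With this, the change of coordinates lemmas apply to any two preferred charts, although the
geometric definitions use a different chart at every point. -/
lemma isLocalIsometry_transition (p p' : N) :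
    IsLocalIsometry (transitionSource E p p') (extChartAt 𝓘(ℝ, E) p').target
      (metricInChart h p) (metricInChart h p') (transition E p p') := by
  have hc : ∀ y ∈ transitionSource E p p', ∀ v, fderiv ℝ (transition E p p') y v =
      toChart E p' ((extChartAt 𝓘(ℝ, E) p).symm y)
        (ofChart E p ((extChartAt 𝓘(ℝ, E) p).symm y) v) := by
    intro y hy v
    rw [toChart_change (symm_mem_source hy.1) hy.2, toChart_ofChart (symm_mem_source hy.1),
      (extChartAt 𝓘(ℝ, E) p).right_inv hy.1]
  have hG := isLocalMetric_metricInChart h p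
  refine ⟨⟨isOpen_transitionSource p p', hG.smooth.mono inter_subset_left,
    fun y hy => hG.symm y hy.1, fun y hy => hG.pos y hy.1⟩, isLocalMetric_metricInChart h p',
    contDiffOn_transition p p', fun y hy => ?_, fun y hy => ?_, fun y hy v w => ?_⟩
  · exact (extChartAt 𝓘(ℝ, E) p').map_source (by rw [extChartAt_source]; exact hy.2)
  · intro v
    refine ⟨toChart E p ((extChartAt 𝓘(ℝ, E) p).symm y)
      (ofChart E p' ((extChartAt 𝓘(ℝ, E) p).symm y) v), ?_⟩
    rw [hc y hy, ofChart_toChart (symm_mem_source hy.1), toChart_ofChart hy.2]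
  · rw [hc y hy, hc y hy, metricInChart_apply, metricAt_eq h hy.2]
    rfl

/-- The curvature at q is defined in the chart of q, which moves with q. Transporting it to a fixed
chart is needed before it can be regarded as a smooth function of the point. -/
lemma curvAt_eq {p q : N} (hq : q ∈ (chartAt E p).source) (X Y Z : E) :
    toChart E p q (curvAt h q X Y Z) = localCurv (chartChr h p) (extChartAt 𝓘(ℝ, E) p q)
      (toChart E p q X) (toChart E p q Y) (toChart E p q Z) := by
  have hm : extChartAt 𝓘(ℝ, E) q q ∈ (extChartAt 𝓘(ℝ, E) q).target := mem_extChartAt_target q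
  have hd := (isLocalMetric_metricInChart h q).differentiableAt_chr hm
  have hcc : ∀ X Y Z : E, fderiv ℝ (chartChr h q) (extChartAt 𝓘(ℝ, E) q q) X Y Z =
      fderiv ℝ (fun y' => christoffel h q y' Y Z) (extChartAt 𝓘(ℝ, E) q q) X := by
    intro X Y Z
    have h0 : (fun y' => christoffel h q y' Y Z) = fun y' => localChr (metricInChart h q) y' Y Z :=
      rfl
    rw [h0, fderiv_clm_apply₂ (V := fun _ => Y) (W := fun _ => Z) hd (by fun_prop) (by fun_prop)]
    simp [chartChr]
  have h1 : curvAt h q X Y Z = localCurv (chartChr h q) (extChartAt 𝓘(ℝ, E) q q) X Y Z := by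
    unfold localCurv
    rw [hcc, hcc]
    rfl
  have h2 := (isLocalIsometry_transition h q p).curv
    (mem_transitionSource (mem_chart_source E q) hq) X Y Z
  have h3 : ∀ v, fderiv ℝ (transition E q p) (extChartAt 𝓘(ℝ, E) q q) v = toChart E p q v := by
    intro v
    rw [toChart_change (mem_chart_source E q) hq, toChart_self]
  rw [h1, ← h3, chartChr, h2, transition_apply p (mem_chart_source E q), h3, h3, h3]
  rfl

lemma metricAt_I (hK : IsKahler h) (q : N) (v w : E) :
    metricAt h q (Complex.I • v) (Complex.I • w) = metricAt h q v w := hK.hermitian q v w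

lemma metricInChart_I (hK : IsKahler h) (p : N) : ∀ y ∈ (extChartAt 𝓘(ℝ, E) p).target, ∀ v w,
    metricInChart h p y (Complex.I • v) (Complex.I • w) = metricInChart h p y v w := by
  intro y hy v w
  set q := (extChartAt 𝓘(ℝ, E) p).symm y with hq'
  have hq : q ∈ (chartAt E p).source := symm_mem_source hy
  have e : ∀ v, ofChart E p q (Complex.I • v) = Complex.I • ofChart E p q v := by
    intro v
    refine toChart_injective hq ?_
    rw [toChart_I hq, toChart_ofChart hq, toChart_ofChart hq]
  rw [metricInChart_apply, metricInChart_apply, ← hq', e, e, metricAt_I h hK]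

lemma chartChr_I (hK : IsKahler h) (p : N) : ∀ y ∈ (extChartAt 𝓘(ℝ, E) p).target, ∀ v w,
    chartChr h p y v (Complex.I • w) = Complex.I • chartChr h p y v w :=
  hK.parallel_J p

end Charts

end KahlerFlow
end

noncomputable section
namespace KahlerFlow

/-! ### Vector fields along maps of two variables -/

section Fields

set_option maxSynthPendingDepth 3
set_option linter.unusedSectionVars false

open Set Filter

variable {E : Type*} [NormedAddCommGroup E] [NormedSpace ℂ E]
  {N : Type*} [TopologicalSpace N] [ChartedSpace E N] [IsManifold 𝓘(ℂ, E) ω N]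

/-- The coordinates of `u` in the preferred chart at `p`. -/
def coord (E : Type*) [NormedAddCommGroup E] [NormedSpace ℂ E]
    {N : Type*} [TopologicalSpace N] [ChartedSpace E N] (u : ℝ → ℝ → N) (p : N) (z : ℝ × ℝ) : E :=
  extChartAt 𝓘(ℝ, E) p (u z.1 z.2)

/-- The coordinates of the vector field `V` along `u` in the preferred chart at `p`. -/
def rep (u : ℝ → ℝ → N) (p : N) (V : ℝ → ℝ → E) (z : ℝ × ℝ) : E :=
  toChart E p (u z.1 z.2) (V z.1 z.2)

/-- `V` is a smooth vector field along `u`, on `Ω`. -/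
def SmoothField (u : ℝ → ℝ → N) (Ω : Set (ℝ × ℝ)) (V : ℝ → ℝ → E) : Prop :=
  ∀ z ∈ Ω, ∀ p, u z.1 z.2 ∈ (chartAt E p).source → ContDiffAt ℝ ∞ (rep u p V) z

/-- The covariant derivative of `V` in the direction `d`. -/
def nab (h : RMetric E N) (u : ℝ → ℝ → N) (d : ℝ × ℝ) (V : ℝ → ℝ → E) (t x : ℝ) : E :=
  localCov (chartChr h (u t x)) (coord E u (u t x)) d (rep u (u t x) V) (t, x)

/-- The derivative of `u` in the direction `d`. -/
def vel (E : Type*) [NormedAddCommGroup E] [NormedSpace ℂ E]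
    {N : Type*} [TopologicalSpace N] [ChartedSpace E N] (u : ℝ → ℝ → N) (d : ℝ × ℝ)
    (t x : ℝ) : E :=
  fderiv ℝ (coord E u (u t x)) (t, x) d

lemma rep_self (u : ℝ → ℝ → N) (V : ℝ → ℝ → E) (z : ℝ × ℝ) :
    rep u (u z.1 z.2) V z = V z.1 z.2 := toChart_self _ _

lemma deriv_slice {F : Type*} [NormedAddCommGroup F] [NormedSpace ℝ F] {f : ℝ × ℝ → F} {z : ℝ × ℝ}
    (hf : DifferentiableAt ℝ f z) : HasDerivAt (fun y => f (z.1, y)) (fderiv ℝ f z (0, 1)) z.2 := by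
  have h1 : HasDerivAt (fun y : ℝ => (z.1, y)) ((0 : ℝ), (1 : ℝ)) z.2 :=
    (hasDerivAt_const _ _).prodMk (hasDerivAt_id _)
  have h2 : HasFDerivAt f (fderiv ℝ f z) ((fun y : ℝ => (z.1, y)) z.2) := hf.hasFDerivAt
  exact h2.comp_hasDerivAt z.2 h1

lemma deriv_slice_left {F : Type*} [NormedAddCommGroup F] [NormedSpace ℝ F] {f : ℝ × ℝ → F}
    {z : ℝ × ℝ} (hf : DifferentiableAt ℝ f z) :
    HasDerivAt (fun s => f (s, z.2)) (fderiv ℝ f z (1, 0)) z.1 := by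
  have h1 : HasDerivAt (fun s : ℝ => (s, z.2)) ((1 : ℝ), (0 : ℝ)) z.1 :=
    (hasDerivAt_id _).prodMk (hasDerivAt_const _ _)
  have h2 : HasFDerivAt f (fderiv ℝ f z) ((fun s : ℝ => (s, z.2)) z.1) := hf.hasFDerivAt
  exact h2.comp_hasDerivAt z.1 h1

/-- `u` is a smooth map on the open set `Ω`. -/
structure SmoothMap (E : Type*) [NormedAddCommGroup E] [NormedSpace ℂ E]
    {N : Type*} [TopologicalSpace N] [ChartedSpace E N] (u : ℝ → ℝ → N) (Ω : Set (ℝ × ℝ)) :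
    Prop where
  isOpen : IsOpen Ω
  smooth : ContMDiffOn 𝓘(ℝ, ℝ × ℝ) 𝓘(ℝ, E) ∞ (fun z : ℝ × ℝ => u z.1 z.2) Ω

variable {u : ℝ → ℝ → N} {Ω : Set (ℝ × ℝ)} (hu : SmoothMap E u Ω) {z : ℝ × ℝ} {p : N}
  {V W : ℝ → ℝ → E}

include hu

lemma SmoothMap.contMDiffAt (hz : z ∈ Ω) :
    ContMDiffAt 𝓘(ℝ, ℝ × ℝ) 𝓘(ℝ, E) ∞ (fun z : ℝ × ℝ => u z.1 z.2) z :=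
  hu.smooth.contMDiffAt (hu.isOpen.mem_nhds hz)

lemma SmoothMap.eventually_source (hz : z ∈ Ω) (hp : u z.1 z.2 ∈ (chartAt E p).source) :
    ∀ᶠ z' in 𝓝 z, z' ∈ Ω ∧ u z'.1 z'.2 ∈ (chartAt E p).source :=
  (hu.isOpen.eventually_mem hz).and
    ((hu.contMDiffAt hz).continuousAt.eventually ((chartAt E p).open_source.mem_nhds hp))

lemma SmoothMap.contDiffAt_coord (hz : z ∈ Ω) (hp : u z.1 z.2 ∈ (chartAt E p).source) :
    ContDiffAt ℝ ∞ (coord E u p) z :=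
  ((contMDiffAt_extChartAt' (I := 𝓘(ℝ, E)) (n := ∞) hp).comp z (hu.contMDiffAt hz)).contDiffAt

omit hu in
lemma coord_mem (hp : u z.1 z.2 ∈ (chartAt E p).source) :
    coord E u p z ∈ (extChartAt 𝓘(ℝ, E) p).target :=
  (extChartAt 𝓘(ℝ, E) p).map_source (by rwa [extChartAt_source])

lemma SmoothMap.eventually_coord (hz : z ∈ Ω) (hp : u z.1 z.2 ∈ (chartAt E p).source) (p' : N) :
    coord E u p' =ᶠ[𝓝 z] fun z => transition E p p' (coord E u p z) := by
  filter_upwards [hu.eventually_source hz hp] with z' hz'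
  exact (transition_apply p' hz'.2).symm

lemma SmoothMap.eventually_rep {p' : N} (hz : z ∈ Ω) (hp : u z.1 z.2 ∈ (chartAt E p).source)
    (hp' : u z.1 z.2 ∈ (chartAt E p').source) (V : ℝ → ℝ → E) :
    rep u p' V =ᶠ[𝓝 z] fun z => fderiv ℝ (transition E p p') (coord E u p z) (rep u p V z) := by
  filter_upwards [hu.eventually_source hz hp, hu.eventually_source hz hp'] with z' hz' hz''
  exact toChart_change hz'.2 hz''.2 _

lemma SmoothMap.smoothField_iff : SmoothField u Ω V ↔
    ContMDiffOn 𝓘(ℝ, ℝ × ℝ) 𝓘(ℝ, E).tangent ∞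
      (fun z : ℝ × ℝ => (⟨u z.1 z.2, V z.1 z.2⟩ : TangentBundle 𝓘(ℝ, E) N)) Ω := by
  have key : ∀ z ∈ Ω, ∀ p, u z.1 z.2 ∈ (chartAt E p).source → (ContMDiffWithinAt 𝓘(ℝ, ℝ × ℝ)
      𝓘(ℝ, E).tangent ∞ (fun z : ℝ × ℝ => (⟨u z.1 z.2, V z.1 z.2⟩ : TangentBundle 𝓘(ℝ, E) N)) Ω z ↔
      ContDiffAt ℝ ∞ (rep u p V) z) := by
    intro z hz p hp
    rw [(trivializationAt E (TangentSpace 𝓘(ℝ, E)) p).contMDiffWithinAt_iff (n := ∞) (by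
      rw [TangentBundle.trivializationAt_source]; exact hp)]
    simp only [trivializationAt_snd]
    rw [contMDiffWithinAt_iff_contDiffWithinAt]
    exact ⟨fun H => H.2.contDiffAt (hu.isOpen.mem_nhds hz),
      fun H => ⟨hu.smooth z hz, H.contDiffWithinAt⟩⟩
  exact ⟨fun H z hz => (key z hz _ (mem_chart_source E _)).2 (H z hz _ (mem_chart_source E _)),
    fun H z hz p hp => (key z hz p hp).1 (H z hz)⟩

/-- The velocity at each point is computed in the chart of that point; in a fixed chart it becomes
an ordinary derivative, which can be differentiated again. -/
lemma SmoothMap.rep_vel (hz : z ∈ Ω) (hp : u z.1 z.2 ∈ (chartAt E p).source) (d : ℝ × ℝ) :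
    rep u p (vel E u d) z = fderiv ℝ (coord E u p) z d := by
  have hq := mem_chart_source E (u z.1 z.2)
  have h1 : ContDiffAt ℝ ∞ (transition E (u z.1 z.2) p) (coord E u (u z.1 z.2) z) :=
    (contDiffOn_transition _ p).contDiffAt
      ((isOpen_transitionSource _ p).mem_nhds (mem_transitionSource hq hp))
  rw [(hu.eventually_coord hz hq p).fderiv_eq, fderiv_comp_apply (differentiableAt_of_smooth h1)
    (differentiableAt_of_smooth (hu.contDiffAt_coord hz hq)), rep, toChart_change hq hp, toChart_self]
  rfl

lemma SmoothMap.smooth_vel (d : ℝ × ℝ) : SmoothField u Ω (vel E u d) := by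
  intro z hz p hp
  have : rep u p (vel E u d) =ᶠ[𝓝 z] fun z => fderiv ℝ (coord E u p) z d := by
    filter_upwards [hu.eventually_source hz hp] with z' hz' using hu.rep_vel hz'.1 hz'.2 d
  exact ((contDiffAt_fderiv (hu.contDiffAt_coord hz hp)).clm_apply contDiffAt_const).congr_of_eventuallyEq
    this

lemma SmoothMap.rep_congr (hVW : ∀ z ∈ Ω, V z.1 z.2 = W z.1 z.2) (hz : z ∈ Ω) (p : N) :
    rep u p V =ᶠ[𝓝 z] rep u p W := by
  filter_upwards [hu.isOpen.mem_nhds hz] with z' hz'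
  rw [rep, hVW z' hz', rep]

lemma SmoothMap.smooth_congr (hVW : ∀ z ∈ Ω, V z.1 z.2 = W z.1 z.2) (hW : SmoothField u Ω W) :
    SmoothField u Ω V :=
  fun z hz p hp => (hW z hz p hp).congr_of_eventuallyEq (hu.rep_congr hVW hz p)

omit hu in
lemma localCov_congr {P : Type*} [NormedAddCommGroup P] [NormedSpace ℝ P]
    {Γ : E → E →L[ℝ] E →L[ℝ] E} {v v' : P → E} {V V' : P → E} {z : P} (hv : v =ᶠ[𝓝 z] v')
    (hV : V =ᶠ[𝓝 z] V') (d : P) : localCov Γ v d V z = localCov Γ v' d V' z := by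
  rw [localCov, localCov, hv.fderiv_eq, hV.fderiv_eq, hv.self_of_nhds, hV.self_of_nhds]

variable (h : RMetric E N)

lemma SmoothMap.nab_congr (hVW : ∀ z ∈ Ω, V z.1 z.2 = W z.1 z.2) (hz : z ∈ Ω) (d : ℝ × ℝ) :
    nab h u d V z.1 z.2 = nab h u d W z.1 z.2 :=
  localCov_congr (EventuallyEq.refl _ _) (hu.rep_congr hVW hz _) d

variable [FiniteDimensional ℂ E]

/-- The analogue of `rep_vel` for the covariant derivative, and the tool by which iterated covariant
derivatives are handled. -/
lemma SmoothMap.rep_nab (hV : SmoothField u Ω V) (hz : z ∈ Ω)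
    (hp : u z.1 z.2 ∈ (chartAt E p).source) (d : ℝ × ℝ) :
    rep u p (nab h u d V) z = localCov (chartChr h p) (coord E u p) d (rep u p V) z := by
  have hq := mem_chart_source E (u z.1 z.2)
  rw [localCov_congr (hu.eventually_coord hz hq p) (hu.eventually_rep hz hq hp V), chartChr,
    (isLocalIsometry_transition h _ p).cov (differentiableAt_of_smooth (hu.contDiffAt_coord hz hq))
    (differentiableAt_of_smooth (hV z hz _ hq)) (mem_transitionSource hq hp),
    rep, toChart_change hq hp, toChart_self]
  rfl

omit hu in
lemma contDiffAt_chartChr {y : E} (hy : y ∈ (extChartAt 𝓘(ℝ, E) p).target) :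
    ContDiffAt ℝ ∞ (chartChr h p) y := (isLocalMetric_metricInChart h p).contDiffAt_chr hy

lemma SmoothMap.smooth_nab (hV : SmoothField u Ω V) (d : ℝ × ℝ) :
    SmoothField u Ω (nab h u d V) := by
  intro z hz p hp
  have : rep u p (nab h u d V) =ᶠ[𝓝 z] localCov (chartChr h p) (coord E u p) d (rep u p V) := by
    filter_upwards [hu.eventually_source hz hp] with z' hz' using hu.rep_nab h hV hz'.1 hz'.2 d
  exact (contDiffAt_localCov ((isLocalMetric_metricInChart h p).contDiffAt_chr (coord_mem hp))
    (hu.contDiffAt_coord hz hp) (hV z hz p hp) d).congr_of_eventuallyEq this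

/-! #### Comparison with `velX`, `velT` and `nablaX` -/

omit hu [FiniteDimensional ℂ E] in
lemma mfderiv_curve {γ : ℝ → N} {s : ℝ} (hγ : MDifferentiableAt 𝓘(ℝ, ℝ) 𝓘(ℝ, E) γ s) :
    (mfderiv 𝓘(ℝ, ℝ) 𝓘(ℝ, E) γ s (1 : ℝ) : E) = deriv (fun y => extChartAt 𝓘(ℝ, E) (γ s) (γ y)) s := by
  rw [hγ.mfderiv]
  simp only [ModelWithCorners.range_eq_univ, fderivWithin_univ, ← fderiv_apply_one_eq_deriv]
  rfl

omit [FiniteDimensional ℂ E] in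
lemma SmoothMap.mdifferentiableAt_slice (hz : z ∈ Ω) :
    MDifferentiableAt 𝓘(ℝ, ℝ) 𝓘(ℝ, E) (fun y => u z.1 y) z.2 := by
  have h1 : MDifferentiableAt 𝓘(ℝ, ℝ) 𝓘(ℝ, ℝ × ℝ) (fun y : ℝ => (z.1, y)) z.2 :=
    (DifferentiableAt.prodMk (by fun_prop) (by fun_prop)).mdifferentiableAt
  have h2 : MDifferentiableAt 𝓘(ℝ, ℝ × ℝ) 𝓘(ℝ, E) (fun z : ℝ × ℝ => u z.1 z.2) (z.1, z.2) :=
    (hu.contMDiffAt hz).mdifferentiableAt (by simp)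
  exact h2.comp z.2 h1

omit [FiniteDimensional ℂ E] in
lemma SmoothMap.mdifferentiableAt_slice_left (hz : z ∈ Ω) :
    MDifferentiableAt 𝓘(ℝ, ℝ) 𝓘(ℝ, E) (fun s => u s z.2) z.1 := by
  have h1 : MDifferentiableAt 𝓘(ℝ, ℝ) 𝓘(ℝ, ℝ × ℝ) (fun s : ℝ => (s, z.2)) z.1 :=
    (DifferentiableAt.prodMk (by fun_prop) (by fun_prop)).mdifferentiableAt
  have h2 : MDifferentiableAt 𝓘(ℝ, ℝ × ℝ) 𝓘(ℝ, E) (fun z : ℝ × ℝ => u z.1 z.2) (z.1, z.2) :=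
    (hu.contMDiffAt hz).mdifferentiableAt (by simp)
  exact h2.comp (f := fun s : ℝ => (s, z.2)) z.1 h1

omit [FiniteDimensional ℂ E] in
lemma SmoothMap.velX_eq (hz : z ∈ Ω) : (velX E u z.1 z.2 : E) = vel E u (0, 1) z.1 z.2 := by
  have h1 := deriv_slice (differentiableAt_of_smooth (hu.contDiffAt_coord hz (mem_chart_source E _)))
  exact (mfderiv_curve (hu.mdifferentiableAt_slice hz)).trans h1.deriv

omit [FiniteDimensional ℂ E] in
lemma SmoothMap.velT_eq (hz : z ∈ Ω) : (velT E u z.1 z.2 : E) = vel E u (1, 0) z.1 z.2 := by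
  have h1 := deriv_slice_left
    (differentiableAt_of_smooth (hu.contDiffAt_coord hz (mem_chart_source E _)))
  exact (mfderiv_curve (hu.mdifferentiableAt_slice_left hz)).trans h1.deriv

omit [FiniteDimensional ℂ E] in
lemma SmoothMap.nablaX_eq (hV : SmoothField u Ω V) (hz : z ∈ Ω) :
    (nablaX h u V z.1 z.2 : E) = nab h u (0, 1) V z.1 z.2 := by
  have h1 := deriv_slice (differentiableAt_of_smooth (hV z hz _ (mem_chart_source E _)))
  have h2 := mfderiv_curve (hu.mdifferentiableAt_slice hz)
  have h3 := deriv_slice (differentiableAt_of_smooth (hu.contDiffAt_coord hz (mem_chart_source E _)))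
  have h4 : (nablaX h u V z.1 z.2 : E) =
      deriv (fun σ => rep u (u z.1 z.2) V (z.1, σ)) z.2 + chartChr h (u z.1 z.2)
        (coord E u (u z.1 z.2) z) (mfderiv 𝓘(ℝ, ℝ) 𝓘(ℝ, E) (fun y => u z.1 y) z.2 (1 : ℝ) : E)
        (V z.1 z.2) := rfl
  rw [h4, h1.deriv, h2, nab, localCov, rep_self]
  exact congrArg (fun w => _ + chartChr h (u z.1 z.2) (coord E u (u z.1 z.2) z) w _) h3.deriv

/-- Agreement has to be proved on all of Ω at each stage, since the next derivative sees the field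
in a neighbourhood of the point. -/
lemma SmoothMap.nablaX_iterate_eq (hV : SmoothField u Ω V) (l : ℕ) :
    SmoothField u Ω ((nab h u (0, 1))^[l] V) ∧
    ∀ z ∈ Ω, ((nablaX h u)^[l] V z.1 z.2 : E) = (nab h u (0, 1))^[l] V z.1 z.2 := by
  induction l with
  | zero => exact ⟨hV, fun z _ => rfl⟩
  | succ l ih =>
    simp only [Function.iterate_succ', Function.comp_apply]
    have h1 := hu.smooth_congr ih.2 ih.1
    refine ⟨hu.smooth_nab h ih.1 _, fun z hz => ?_⟩
    rw [← hu.nab_congr h ih.2 hz]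
    exact hu.nablaX_eq h h1 hz

/-! #### The metric -/

omit [FiniteDimensional ℂ E] in
lemma SmoothMap.eventually_inner (hz : z ∈ Ω) (hp : u z.1 z.2 ∈ (chartAt E p).source)
    (V W : ℝ → ℝ → E) :
    (fun z : ℝ × ℝ => metricAt h (u z.1 z.2) (V z.1 z.2) (W z.1 z.2)) =ᶠ[𝓝 z]
      fun z => metricInChart h p (coord E u p z) (rep u p V z) (rep u p W z) := by
  filter_upwards [hu.eventually_source hz hp] with z' hz' using metricAt_eq h hz'.2 _ _

lemma SmoothMap.contDiffAt_inner (hV : SmoothField u Ω V) (hW : SmoothField u Ω W) (hz : z ∈ Ω) :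
    ContDiffAt ℝ ∞ (fun z : ℝ × ℝ => metricAt h (u z.1 z.2) (V z.1 z.2) (W z.1 z.2)) z := by
  have hq := mem_chart_source E (u z.1 z.2)
  refine ContDiffAt.congr_of_eventuallyEq ?_ (hu.eventually_inner h hz hq V W)
  exact (((isLocalMetric_metricInChart h _).contDiffAt (coord_mem hq)).comp z
    (hu.contDiffAt_coord hz hq)).clm_apply (hV z hz _ hq) |>.clm_apply (hW z hz _ hq)

lemma SmoothMap.fderiv_inner (hV : SmoothField u Ω V) (hW : SmoothField u Ω W) (hz : z ∈ Ω)
    (d : ℝ × ℝ) :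
    fderiv ℝ (fun z : ℝ × ℝ => metricAt h (u z.1 z.2) (V z.1 z.2) (W z.1 z.2)) z d =
      metricAt h (u z.1 z.2) (nab h u d V z.1 z.2) (W z.1 z.2)
      + metricAt h (u z.1 z.2) (V z.1 z.2) (nab h u d W z.1 z.2) := by
  have hq := mem_chart_source E (u z.1 z.2)
  rw [(hu.eventually_inner h hz hq V W).fderiv_eq,
    (isLocalMetric_metricInChart h _).deriv_inner (coord_mem hq)
      (differentiableAt_of_smooth (hu.contDiffAt_coord hz hq))
      (differentiableAt_of_smooth (hV z hz _ hq)) (differentiableAt_of_smooth (hW z hz _ hq)),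
    metricAt_eq h hq, metricAt_eq h hq, toChart_self, toChart_self, toChart_self, toChart_self,
    rep_self, rep_self]
  rfl

/-! #### Torsion and curvature -/

lemma SmoothMap.torsion_free (hz : z ∈ Ω) (d d' : ℝ × ℝ) :
    nab h u d (vel E u d') z.1 z.2 = nab h u d' (vel E u d) z.1 z.2 := by
  have hq := mem_chart_source E (u z.1 z.2)
  have h1 : ∀ d, rep u (u z.1 z.2) (vel E u d) =ᶠ[𝓝 z]
      fun z' => fderiv ℝ (coord E u (u z.1 z.2)) z' d := fun d => by
    filter_upwards [hu.eventually_source hz hq] with z' hz' using hu.rep_vel hz'.1 hz'.2 d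
  rw [nab, nab, localCov_congr (EventuallyEq.refl _ _) (h1 d'),
    localCov_congr (EventuallyEq.refl _ _) (h1 d)]
  exact (isLocalMetric_metricInChart h _).torsion_free (coord_mem hq) (hu.contDiffAt_coord hz hq) d d'

lemma SmoothMap.nab_comm (hV : SmoothField u Ω V) (hz : z ∈ Ω) (d d' : ℝ × ℝ) :
    nab h u d (nab h u d' V) z.1 z.2 - nab h u d' (nab h u d V) z.1 z.2 =
      curvAt h (u z.1 z.2) (vel E u d z.1 z.2) (vel E u d' z.1 z.2) (V z.1 z.2) := by
  have hq := mem_chart_source E (u z.1 z.2)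
  have h1 : ∀ d, rep u (u z.1 z.2) (nab h u d V) =ᶠ[𝓝 z]
      localCov (chartChr h (u z.1 z.2)) (coord E u (u z.1 z.2)) d (rep u (u z.1 z.2) V) := fun d => by
    filter_upwards [hu.eventually_source hz hq] with z' hz' using hu.rep_nab h hV hz'.1 hz'.2 d
  have h2 := curvAt_eq h hq (vel E u d z.1 z.2) (vel E u d' z.1 z.2) (V z.1 z.2)
  simp only [toChart_self] at h2
  rw [nab, nab, localCov_congr (EventuallyEq.refl _ _) (h1 d'),
    localCov_congr (EventuallyEq.refl _ _) (h1 d), h2]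
  have h3 := (isLocalMetric_metricInChart h _).cov_comm (coord_mem hq) (hu.contDiffAt_coord hz hq)
    (hV z hz _ hq) d d'
  rw [rep_self] at h3
  exact h3

lemma SmoothMap.smooth_curv {X Y : ℝ → ℝ → E} (hX : SmoothField u Ω X) (hY : SmoothField u Ω Y)
    (hV : SmoothField u Ω V) :
    SmoothField u Ω (fun t x => curvAt h (u t x) (X t x) (Y t x) (V t x)) := by
  intro z hz p hp
  have : rep u p (fun t x => curvAt h (u t x) (X t x) (Y t x) (V t x)) =ᶠ[𝓝 z] fun z =>
      localCurv (chartChr h p) (coord E u p z) (rep u p X z) (rep u p Y z) (rep u p V z) := by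
    filter_upwards [hu.eventually_source hz hp] with z' hz' using curvAt_eq h hz'.2 _ _ _
  exact (contDiffAt_localCurv ((isLocalMetric_metricInChart h p).contDiffAt_chr (coord_mem hp))
    (hu.contDiffAt_coord hz hp) (hX z hz p hp) (hY z hz p hp) (hV z hz p hp)).congr_of_eventuallyEq this

/-! #### Algebra of fields -/

omit hu [FiniteDimensional ℂ E] in
lemma toChart_smul {q : N} (hq : q ∈ (chartAt E p).source) (c : ℂ) (v : E) :
    toChart E p q (c • v) = c • toChart E p q v := by
  conv_lhs => rw [← Complex.re_add_im c]
  conv_rhs => rw [← Complex.re_add_im c]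
  rw [add_smul, add_smul, mul_smul, mul_smul, map_add]
  have : ∀ (r : ℝ) (v : E), toChart E p q ((r : ℂ) • v) = (r : ℂ) • toChart E p q v := by
    intro r v
    rw [Complex.coe_smul, Complex.coe_smul, map_smul]
  rw [this, this, toChart_I hq]

omit hu in
lemma chartChr_smul (hK : IsKahler h) {y : E} (hy : y ∈ (extChartAt 𝓘(ℝ, E) p).target) (v : E)
    (c : ℂ) (w : E) : chartChr h p y v (c • w) = c • chartChr h p y v w := by
  conv_lhs => rw [← Complex.re_add_im c]
  conv_rhs => rw [← Complex.re_add_im c]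
  rw [add_smul, add_smul, mul_smul, mul_smul, map_add]
  have : ∀ (r : ℝ) (w : E), chartChr h p y v ((r : ℂ) • w) = (r : ℂ) • chartChr h p y v w := by
    intro r v
    rw [Complex.coe_smul, Complex.coe_smul, map_smul]
  rw [this, this, chartChr_I h hK p y hy]

omit hu [FiniteDimensional ℂ E] in
lemma SmoothField.add (hV : SmoothField u Ω V) (hW : SmoothField u Ω W) :
    SmoothField u Ω (fun t x => V t x + W t x) := by
  intro z hz p hp
  have : rep u p (fun t x => V t x + W t x) = fun z => rep u p V z + rep u p W z := by
    funext z; simp [rep]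
  rw [this]
  exact (hV z hz p hp).add (hW z hz p hp)

lemma SmoothMap.smooth_smul {f : ℝ × ℝ → ℂ} (hf : ∀ z ∈ Ω, ContDiffAt ℝ ∞ f z)
    (hV : SmoothField u Ω V) : SmoothField u Ω (fun t x => f (t, x) • V t x) := by
  intro z hz p hp
  have : rep u p (fun t x => f (t, x) • V t x) =ᶠ[𝓝 z] fun z => f z • rep u p V z := by
    filter_upwards [hu.eventually_source hz hp] with z' hz' using toChart_smul hz'.2 _ _
  exact ((hf z hz).smul (hV z hz p hp)).congr_of_eventuallyEq this

lemma SmoothMap.smooth_const_smul (c : ℂ) (hV : SmoothField u Ω V) :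
    SmoothField u Ω (fun t x => c • V t x) :=
  hu.smooth_smul (f := fun _ => c) (fun _ _ => contDiffAt_const) hV

omit hu [FiniteDimensional ℂ E] in
lemma smoothField_zero : SmoothField u Ω (fun _ _ => (0 : E)) := by
  intro z _ p _
  have : rep u p (fun _ _ => (0 : E)) = fun _ => 0 := by funext z; simp [rep]
  rw [this]
  exact contDiffAt_const

omit hu [FiniteDimensional ℂ E] in
lemma SmoothField.sum {ι : Type*} (s : Finset ι) {V : ι → ℝ → ℝ → E}
    (hV : ∀ i ∈ s, SmoothField u Ω (V i)) : SmoothField u Ω (fun t x => ∑ i ∈ s, V i t x) := by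
  classical
  induction s using Finset.induction_on with
  | empty => simpa using smoothField_zero
  | insert i s hi ih =>
    simp only [Finset.sum_insert hi]
    exact (hV i (by simp)).add (ih fun j hj => hV j (by simp [hj]))

lemma SmoothMap.nab_add (hV : SmoothField u Ω V) (hW : SmoothField u Ω W) (hz : z ∈ Ω)
    (d : ℝ × ℝ) : nab h u d (fun t x => V t x + W t x) z.1 z.2
      = nab h u d V z.1 z.2 + nab h u d W z.1 z.2 := by
  have hq := mem_chart_source E (u z.1 z.2)
  have : ∀ p, rep u p (fun t x => V t x + W t x) = fun z => rep u p V z + rep u p W z := by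
    intro p; funext z; simp [rep]
  rw [nab, this, localCov, fderiv_fun_add (differentiableAt_of_smooth (hV z hz _ hq))
    (differentiableAt_of_smooth (hW z hz _ hq))]
  simp only [nab, localCov, map_add, add_apply]
  abel

omit hu [FiniteDimensional ℂ E] in
lemma nab_zero (z d : ℝ × ℝ) :
    nab h u d (fun _ _ => (0 : E)) z.1 z.2 = 0 := by
  have : ∀ p, rep u p (fun _ _ => (0 : E)) = fun _ => 0 := by intro p; funext z; simp [rep]
  rw [nab, this, localCov]
  simp

lemma SmoothMap.nab_sum {ι : Type*} (s : Finset ι) {V : ι → ℝ → ℝ → E}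
    (hV : ∀ i ∈ s, SmoothField u Ω (V i)) (hz : z ∈ Ω) (d : ℝ × ℝ) :
    nab h u d (fun t x => ∑ i ∈ s, V i t x) z.1 z.2 = ∑ i ∈ s, nab h u d (V i) z.1 z.2 := by
  classical
  induction s using Finset.induction_on with
  | empty => simpa using nab_zero h z d
  | insert i s hi ih =>
    have hs := SmoothField.sum s (u := u) (Ω := Ω) (V := V) fun j hj => hV j (by simp [hj])
    simp only [Finset.sum_insert hi]
    rw [hu.nab_add h (hV i (by simp)) hs hz, ih fun j hj => hV j (by simp [hj])]

/-- The Leibniz rule holds for complex coefficients because ∇J = 0 makes the Christoffel symbols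
complex linear in the field. -/
lemma SmoothMap.nab_smul (hK : IsKahler h) {f : ℝ × ℝ → ℂ} (hf : ContDiffAt ℝ ∞ f z)
    (hV : SmoothField u Ω V) (hz : z ∈ Ω) (d : ℝ × ℝ) :
    nab h u d (fun t x => f (t, x) • V t x) z.1 z.2
      = fderiv ℝ f z d • V z.1 z.2 + f z • nab h u d V z.1 z.2 := by
  have hq := mem_chart_source E (u z.1 z.2)
  have h1 : rep u (u z.1 z.2) (fun t x => f (t, x) • V t x) =ᶠ[𝓝 z]
      fun z' => f z' • rep u (u z.1 z.2) V z' := by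
    filter_upwards [hu.eventually_source hz hq] with z' hz' using toChart_smul hz'.2 _ _
  have h2 := fderiv_fun_smul (differentiableAt_of_smooth hf) (differentiableAt_of_smooth (hV z hz _ hq))
  rw [nab, localCov_congr (EventuallyEq.refl _ _) h1, localCov]
  change fderiv ℝ (fun z' => f z' • rep u (u z.1 z.2) V z') z d + _ = _
  rw [h2, chartChr_smul h hK (coord_mem hq)]
  simp only [nab, localCov, add_apply, smul_apply,
    ContinuousLinearMap.smulRight_apply, smul_add, Prod.mk.eta, rep_self]
  abel

lemma SmoothMap.nab_const_smul (hK : IsKahler h) (c : ℂ)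
    (hV : SmoothField u Ω V) (hz : z ∈ Ω) (d : ℝ × ℝ) :
    nab h u d (fun t x => c • V t x) z.1 z.2 = c • nab h u d V z.1 z.2 := by
  have := hu.nab_smul h hK (f := fun _ => c) contDiffAt_const hV hz d
  simpa using this

end Fields

end KahlerFlow
end

noncomputable section
namespace KahlerFlow

/-! ### Polynomials in jets with smooth coefficients -/

section Jets

set_option maxSynthPendingDepth 3
set_option linter.unusedSectionVars false

open Set Filter

/-- A point `v` of an open set `O`, vectors `W k` which will be rapidly decreasing and vectors `Y k`
which will be bounded, all depending smoothly on two real parameters. -/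
structure JetData (E : Type*) [NormedAddCommGroup E] [NormedSpace ℂ E] (κ : Type*) where
  /-- the domain -/
  A : Set (ℝ × ℝ)
  /-- the range of `v` -/
  O : Set E
  /-- the point -/
  v : ℝ × ℝ → E
  /-- the decreasing vectors -/
  W : ℕ → ℝ × ℝ → E
  /-- the bounded vectors -/
  Y : κ → ℝ × ℝ → E
  isOpen_A : IsOpen A
  isOpen_O : IsOpen O
  mapsTo : MapsTo v A O
  smooth_v : ∀ z ∈ A, ContDiffAt ℝ ∞ v z
  smooth_W : ∀ k, ∀ z ∈ A, ContDiffAt ℝ ∞ (W k) z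
  smooth_Y : ∀ k, ∀ z ∈ A, ContDiffAt ℝ ∞ (Y k) z

variable {E : Type*} [NormedAddCommGroup E] [NormedSpace ℂ E] {κ : Type*}

/-- Polynomials in the components of `W k` and `Y k` whose coefficients are smooth functions of `v`.
If the flag is set, each monomial contains a component of some `W k`. -/
inductive JetPoly (D : JetData E κ) : Bool → (ℝ × ℝ → ℂ) → Prop
  | base (g : E → ℂ) (hg : ContDiffOn ℝ ∞ g D.O) : JetPoly D false (fun z => g (D.v z))
  | jet (k : ℕ) (φ : E →L[ℝ] ℂ) : JetPoly D true (fun z => φ (D.W k z))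
  | bdd (k : κ) (φ : E →L[ℝ] ℂ) : JetPoly D false (fun z => φ (D.Y k z))
  | add {b : Bool} {f g : ℝ × ℝ → ℂ} (hf : JetPoly D b f) (hg : JetPoly D b g) :
      JetPoly D b (fun z => f z + g z)
  | mul_false {b : Bool} {f g : ℝ × ℝ → ℂ} (hf : JetPoly D false f) (hg : JetPoly D b g) :
      JetPoly D b (fun z => f z * g z)
  | weaken {f : ℝ × ℝ → ℂ} (hf : JetPoly D true f) : JetPoly D false f
  | congr {b : Bool} {f g : ℝ × ℝ → ℂ} (hf : JetPoly D b f) (hfg : ∀ z ∈ D.A, g z = f z) :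
      JetPoly D b g

/-- Vector-valued functions with components in `JetPoly`. -/
def JetVec (D : JetData E κ) (b : Bool) (f : ℝ × ℝ → E) : Prop :=
  ∀ φ : E →L[ℝ] ℂ, JetPoly D b (fun z => φ (f z))

namespace JetPoly

variable {D : JetData E κ} {b b' : Bool} {f g : ℝ × ℝ → ℂ}

lemma smooth (hf : JetPoly D b f) : ∀ z ∈ D.A, ContDiffAt ℝ ∞ f z := by
  induction hf with
  | base g hg =>
    intro z hz
    exact (hg.contDiffAt (D.isOpen_O.mem_nhds (D.mapsTo hz))).comp z (D.smooth_v z hz)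
  | jet k φ => exact fun z hz => φ.contDiff.contDiffAt.comp z (D.smooth_W k z hz)
  | bdd k φ => exact fun z hz => φ.contDiff.contDiffAt.comp z (D.smooth_Y k z hz)
  | add _ _ hf hg => exact fun z hz => (hf z hz).add (hg z hz)
  | mul_false _ _ hf hg => exact fun z hz => (hf z hz).mul (hg z hz)
  | weaken _ hf => exact hf
  | congr _ hfg hf =>
    intro z hz
    refine (hf z hz).congr_of_eventuallyEq ?_
    filter_upwards [D.isOpen_A.mem_nhds hz] with z' hz' using hfg z' hz'

lemma to_false (hf : JetPoly D b f) : JetPoly D false f := by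
  cases b with
  | false => exact hf
  | true => exact hf.weaken

/-- A product decays as soon as one factor does. The constructor keeps the flag of its second factor
only, so for a flagged first factor the product is commuted. -/
lemma mul (hf : JetPoly D b f) (hg : JetPoly D b' g) : JetPoly D (b || b') (fun z => f z * g z) := by
  cases b with
  | false => exact hf.mul_false hg
  | true => exact (hg.to_false.mul_false hf).congr fun z _ => mul_comm _ _

lemma const (c : ℂ) : JetPoly D false (fun _ => c) := base (fun _ => c) contDiffOn_const

lemma const_mul (c : ℂ) (hf : JetPoly D b f) : JetPoly D b (fun z => c * f z) :=
  (const c).mul_false hf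

lemma neg (hf : JetPoly D b f) : JetPoly D b (fun z => -f z) :=
  (hf.const_mul (-1)).congr fun z _ => by ring

lemma sub (hf : JetPoly D b f) (hg : JetPoly D b g) : JetPoly D b (fun z => f z - g z) :=
  (hf.add hg.neg).congr fun z _ => by ring

lemma zero : JetPoly D b (fun _ => 0) := by
  have : JetPoly D true (fun _ => 0) := (jet 0 0).congr fun z _ => by simp
  cases b with
  | false => exact this.weaken
  | true => exact this

lemma sum {ι : Type*} (s : Finset ι) {f : ι → ℝ × ℝ → ℂ} (hf : ∀ i ∈ s, JetPoly D b (f i)) :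
    JetPoly D b (fun z => ∑ i ∈ s, f i z) := by
  classical
  induction s using Finset.induction_on with
  | empty => simpa using zero
  | insert i s hi ih =>
    simp only [Finset.sum_insert hi]
    exact (hf i (by simp)).add (ih fun j hj => hf j (by simp [hj]))

lemma conj (hf : JetPoly D b f) : JetPoly D b (fun z => (starRingEnd ℂ) (f z)) := by
  induction hf with
  | base g hg =>
    have := base (D := D) (fun y => (starRingEnd ℂ) (g y))
      (Complex.conjCLE.contDiff.comp_contDiffOn hg)
    exact this
  | jet k φ => exact jet k ((Complex.conjCLE : ℂ →L[ℝ] ℂ).comp φ)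
  | bdd k φ => exact bdd k ((Complex.conjCLE : ℂ →L[ℝ] ℂ).comp φ)
  | add _ _ hf hg => exact (hf.add hg).congr fun z _ => map_add _ _ _
  | mul_false _ _ hf hg => exact (hf.mul_false hg).congr fun z _ => map_mul _ _ _
  | weaken _ hf => exact hf.weaken
  | congr _ hfg hf => exact hf.congr fun z hz => by rw [hfg z hz]

/-- The coordinates with respect to a fixed real basis, as complex valued functionals. -/
def coordL (E : Type*) [NormedAddCommGroup E] [NormedSpace ℂ E] [FiniteDimensional ℂ E]
    (i : Fin (Module.finrank ℝ E)) : E →L[ℝ] ℂ :=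
  Complex.ofRealCLM.comp (LinearMap.toContinuousLinearMap ((Module.finBasis ℝ E).coord i))

variable [FiniteDimensional ℂ E]

lemma sum_coordL (L : E →L[ℝ] ℂ) (w : E) :
    L w = ∑ i, coordL E i w * L (Module.finBasis ℝ E i) := by
  conv_lhs => rw [← (Module.finBasis ℝ E).sum_repr w]
  rw [map_sum]
  refine Finset.sum_congr rfl fun i _ => ?_
  rw [map_smul, Complex.real_smul]
  rfl

lemma clm_apply {L : ℝ × ℝ → E →L[ℝ] ℂ} {f : ℝ × ℝ → E} (hL : ∀ e, JetPoly D b (fun z => L z e))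
    (hf : JetVec D b' f) : JetPoly D (b || b') (fun z => L z (f z)) := by
  refine congr (f := fun z => ∑ i, coordL E i (f z) * L z (Module.finBasis ℝ E i)) ?_
    fun z _ => sum_coordL _ _
  refine sum _ fun i _ => ?_
  rw [Bool.or_comm]
  exact (hf _).mul (hL _)

/-- Smooth forms of degree one. -/
lemma form₁ {L : E → E →L[ℝ] ℂ} (hL : ContDiffOn ℝ ∞ L D.O) {f : ℝ × ℝ → E}
    (hf : JetVec D b f) : JetPoly D b (fun z => L (D.v z) (f z)) := by
  have := clm_apply (b := false) (L := fun z => L (D.v z))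
    (fun e => base (fun y => L y e) (hL.clm_apply contDiffOn_const)) hf
  simpa using this

/-- Derivatives in a direction in which the derivatives of `v`, `W k`, `Y k` are polynomials. -/
lemma fderiv {d : ℝ × ℝ} (hv : JetVec D true (fun z => fderiv ℝ D.v z d))
    (hW : ∀ k, JetVec D true (fun z => _root_.fderiv ℝ (D.W k) z d))
    (hY : ∀ k, JetVec D true (fun z => _root_.fderiv ℝ (D.Y k) z d)) (hf : JetPoly D b f) :
    JetPoly D true (fun z => _root_.fderiv ℝ f z d) := by
  induction hf with
  | base g hg =>
    refine (form₁ (hg.fderiv_of_isOpen D.isOpen_O (m := ∞) (by simp)) hv).congr fun z hz => ?_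
    exact fderiv_comp_apply (differentiableAt_of_smooth
      (hg.contDiffAt (D.isOpen_O.mem_nhds (D.mapsTo hz)))) (differentiableAt_of_smooth
      (D.smooth_v z hz)) d
  | jet k φ =>
    refine (hW k φ).congr fun z hz => ?_
    rw [fderiv_comp_apply (A := φ) (by fun_prop) (differentiableAt_of_smooth (D.smooth_W k z hz)),
      φ.fderiv]
  | bdd k φ =>
    refine (hY k φ).congr fun z hz => ?_
    rw [fderiv_comp_apply (A := φ) (by fun_prop) (differentiableAt_of_smooth (D.smooth_Y k z hz)),
      φ.fderiv]
  | add hf hg hf' hg' =>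
    refine (hf'.add hg').congr fun z hz => ?_
    rw [fderiv_fun_add (differentiableAt_of_smooth (hf.smooth z hz))
      (differentiableAt_of_smooth (hg.smooth z hz))]
    rfl
  | @mul_false b f g hf hg hf' hg' =>
    refine ((hf.mul_false hg').add (hg.to_false.mul_false hf')).congr fun z hz => ?_
    rw [fderiv_fun_mul (differentiableAt_of_smooth (hf.smooth z hz))
      (differentiableAt_of_smooth (hg.smooth z hz))]
    simp
  | weaken _ hf => exact hf
  | congr _ hfg hf =>
    refine hf.congr fun z hz => ?_
    rw [EventuallyEq.fderiv_eq (eventually_of_mem (D.isOpen_A.mem_nhds hz) hfg)]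

/-- The coefficients are continuous functions of v, hence bounded while v stays in the compact set
K. Each flagged monomial then gains one factor (1+x²)⁻¹ from a decreasing vector. -/
lemma bound {R : Set (ℝ × ℝ)} (hR : R ⊆ D.A) {K : Set E} (hK : IsCompact K) (hKO : K ⊆ D.O)
    (hv : MapsTo D.v R K) (hW : ∀ k, ∃ C, ∀ z ∈ R, ‖D.W k z‖ ≤ C * (1 + z.2 ^ 2)⁻¹)
    (hY : ∀ k, ∃ C, ∀ z ∈ R, ‖D.Y k z‖ ≤ C) (hf : JetPoly D b f) :
    ∃ C, 0 ≤ C ∧ ∀ z ∈ R, ‖f z‖ ≤ C * (bif b then (1 + z.2 ^ 2)⁻¹ else 1) := by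
  have h1 : ∀ x : ℝ, (0 : ℝ) ≤ (1 + x ^ 2)⁻¹ := fun x => by positivity
  have h2 : ∀ x : ℝ, (1 + x ^ 2)⁻¹ ≤ (1 : ℝ) := fun x => inv_le_one_of_one_le₀ (by nlinarith)
  have h3 : ∀ (b : Bool) (x : ℝ), (0 : ℝ) ≤ bif b then (1 + x ^ 2)⁻¹ else 1 := by
    intro b x; cases b with
    | true => exact h1 x
    | false => simp
  have pos : ∀ C : ℝ, C ≤ max C 0 := fun C => le_max_left _ _
  induction hf with
  | base g hg =>
    obtain ⟨C, hC⟩ := hK.exists_bound_of_continuousOn (hg.continuousOn.mono hKO)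
    exact ⟨max C 0, le_max_right _ _, fun z hz => by simpa using Or.inl (hC _ (hv hz))⟩
  | jet k φ =>
    obtain ⟨C, hC⟩ := hW k
    refine ⟨‖φ‖ * max C 0, by positivity, fun z hz => (φ.le_opNorm _).trans ?_⟩
    rw [mul_assoc]
    exact mul_le_mul_of_nonneg_left ((hC z hz).trans (mul_le_mul_of_nonneg_right (pos C) (h1 _)))
      (norm_nonneg _)
  | bdd k φ =>
    obtain ⟨C, hC⟩ := hY k
    refine ⟨‖φ‖ * max C 0, by positivity, fun z hz => (φ.le_opNorm _).trans ?_⟩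
    rw [mul_assoc]
    exact mul_le_mul_of_nonneg_left ((hC z hz).trans (by simp)) (norm_nonneg _)
  | add _ _ hf hg =>
    obtain ⟨C, hC0, hC⟩ := hf
    obtain ⟨C', hC0', hC'⟩ := hg
    refine ⟨C + C', by positivity, fun z hz => (norm_add_le _ _).trans ?_⟩
    rw [add_mul]
    exact add_le_add (hC z hz) (hC' z hz)
  | mul_false _ _ hf hg =>
    obtain ⟨C, hC0, hC⟩ := hf
    obtain ⟨C', hC0', hC'⟩ := hg
    refine ⟨C * C', by positivity, fun z hz => ?_⟩
    rw [norm_mul, mul_assoc]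
    exact mul_le_mul (by simpa using hC z hz) (hC' z hz) (norm_nonneg _) hC0
  | weaken _ hf =>
    obtain ⟨C, hC0, hC⟩ := hf
    refine ⟨C, hC0, fun z hz => (hC z hz).trans (mul_le_mul_of_nonneg_left ?_ hC0)⟩
    simpa using h2 z.2
  | congr _ hfg hf =>
    obtain ⟨C, hC0, hC⟩ := hf
    exact ⟨C, hC0, fun z hz => by rw [hfg z (hR hz)]; exact hC z hz⟩

end JetPoly

/-! ### Vector-valued polynomials in jets -/

namespace JetVec

variable {D : JetData E κ} {b b' b'' : Bool} {f g k : ℝ × ℝ → E}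

lemma congr (hf : JetVec D b f) (hfg : ∀ z ∈ D.A, g z = f z) : JetVec D b g :=
  fun φ => (hf φ).congr fun z hz => by rw [hfg z hz]

lemma add (hf : JetVec D b f) (hg : JetVec D b g) : JetVec D b (fun z => f z + g z) :=
  fun φ => ((hf φ).add (hg φ)).congr fun _ _ => map_add _ _ _

lemma sub (hf : JetVec D b f) (hg : JetVec D b g) : JetVec D b (fun z => f z - g z) :=
  fun φ => ((hf φ).sub (hg φ)).congr fun _ _ => map_sub _ _ _

lemma jet (n : ℕ) : JetVec D true (D.W n) := fun φ => JetPoly.jet n φ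

lemma bdd (i : κ) : JetVec D false (D.Y i) := fun φ => JetPoly.bdd i φ

lemma base {g : E → E} (hg : ContDiffOn ℝ ∞ g D.O) : JetVec D false (fun z => g (D.v z)) :=
  fun φ => JetPoly.base (fun y => φ (g y)) (φ.contDiff.comp_contDiffOn hg)

lemma clm (L : E →L[ℝ] E) (hf : JetVec D b f) : JetVec D b (fun z => L (f z)) :=
  fun φ => hf (φ.comp L)

lemma const_smul (c : ℂ) (hf : JetVec D b f) : JetVec D b (fun z => c • f z) :=
  clm (c • ContinuousLinearMap.id ℝ E) hf

variable [FiniteDimensional ℂ E]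

lemma clm_apply {L : ℝ × ℝ → E →L[ℝ] E} (hL : ∀ e, JetVec D b (fun z => L z e))
    (hf : JetVec D b' f) : JetVec D (b || b') (fun z => L z (f z)) :=
  fun φ => JetPoly.clm_apply (L := fun z => φ.comp (L z)) (fun e => hL e φ) hf

lemma clm_apply₂ {B : ℝ × ℝ → E →L[ℝ] E →L[ℝ] E} (hB : ∀ e e', JetVec D b (fun z => B z e e'))
    (hf : JetVec D b' f) (hg : JetVec D b'' g) :
    JetVec D (b || b' || b'') (fun z => B z (f z) (g z)) :=
  clm_apply (L := fun z => B z (f z)) (fun e => clm_apply (L := fun z => (B z).flip e)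
    (fun e' => hB e' e) hf) hg

/-- Smooth bilinear maps. -/
lemma form₂ {B : E → E →L[ℝ] E →L[ℝ] E} (hB : ContDiffOn ℝ ∞ B D.O)
    (hf : JetVec D b f) (hg : JetVec D b' g) :
    JetVec D (b || b') (fun z => B (D.v z) (f z) (g z)) := by
  have := clm_apply₂ (b := false) (B := fun z => B (D.v z)) (fun e e' => base
    (g := fun y => B y e e') ((hB.clm_apply contDiffOn_const).clm_apply contDiffOn_const)) hf hg
  simpa using this

/-- Smooth trilinear maps. -/
lemma form₃ {B : E → E →L[ℝ] E →L[ℝ] E →L[ℝ] E} (hB : ContDiffOn ℝ ∞ B D.O)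
    (hf : JetVec D b f) (hg : JetVec D b' g) (hk : JetVec D b'' k) :
    JetVec D (b || b' || b'') (fun z => B (D.v z) (f z) (g z) (k z)) :=
  clm_apply₂ (B := fun z => B (D.v z) (f z)) (fun e e' => by
    have := clm_apply (b := false) (b' := b) (L := fun z => ((B (D.v z)).flip e).flip e')
      (fun e'' => base (g := fun y => B y e'' e e')
        (((hB.clm_apply contDiffOn_const).clm_apply contDiffOn_const).clm_apply contDiffOn_const)) hf
    simpa using this) hg hk

lemma curv {Γ : E → E →L[ℝ] E →L[ℝ] E} (hΓ : ContDiffOn ℝ ∞ Γ D.O)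
    (hf : JetVec D b f) (hg : JetVec D b' g) (hk : JetVec D b'' k) :
    JetVec D (b || b' || b'') (fun z => localCurv Γ (D.v z) (f z) (g z) (k z)) := by
  have hd : ContDiffOn ℝ ∞ (fderiv ℝ Γ) D.O := hΓ.fderiv_of_isOpen D.isOpen_O (by simp)
  have h1 := form₃ hd hf hg hk
  have h2 := form₃ hd hg hf hk
  have h3 := form₂ hΓ hf (form₂ hΓ hg hk)
  have h4 := form₂ hΓ hg (form₂ hΓ hf hk)
  rw [← Bool.or_assoc] at h3 h4
  rw [Bool.or_comm b' b] at h2 h4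
  exact ((h1.sub h2).add h3).sub h4

lemma smooth (hf : JetVec D b f) : ∀ z ∈ D.A, ContDiffAt ℝ ∞ f z := by
  intro z hz
  have h1 : f = fun z => ∑ i, (Module.finBasis ℝ E).repr (f z) i • Module.finBasis ℝ E i := by
    funext z
    exact ((Module.finBasis ℝ E).sum_repr (f z)).symm
  have h2 : ∀ i, ContDiffAt ℝ ∞ (fun z => (Module.finBasis ℝ E).repr (f z) i) z := fun i =>
    Complex.reCLM.contDiff.contDiffAt.comp z ((hf (JetPoly.coordL E i)).smooth z hz)
  rw [h1]
  exact ContDiffAt.sum fun i _ => (h2 i).smul (contDiffAt_const (c := Module.finBasis ℝ E i))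

lemma fderiv {d : ℝ × ℝ} (hv : JetVec D true (fun z => fderiv ℝ D.v z d))
    (hW : ∀ k, JetVec D true (fun z => _root_.fderiv ℝ (D.W k) z d))
    (hY : ∀ k, JetVec D true (fun z => _root_.fderiv ℝ (D.Y k) z d)) (hf : JetVec D b f) :
    JetVec D true (fun z => _root_.fderiv ℝ f z d) := by
  intro φ
  refine ((hf φ).fderiv hv hW hY).congr fun z hz => ?_
  rw [fderiv_comp_apply (A := φ) (by fun_prop) (differentiableAt_of_smooth (hf.smooth z hz)),
    φ.fderiv]

end JetVec

end Jets

end KahlerFlow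
end

noncomputable section
namespace KahlerFlow

/-! ### Behaviour of an admissible map as `x → -∞` -/

section Infinity

set_option maxSynthPendingDepth 3
set_option linter.unusedSectionVars false

open Set Filter

variable {E : Type*} [NormedAddCommGroup E] [NormedSpace ℂ E]
  {N : Type*} [TopologicalSpace N] [ChartedSpace E N] [IsManifold 𝓘(ℂ, E) ω N]

lemma isOpen_timeInterval (T : EReal) : IsOpen (timeInterval T) := by
  have h1 : Continuous fun t : ℝ => ((|t| : ℝ) : EReal) :=
    continuous_coe_real_ereal.comp continuous_abs
  exact isOpen_lt h1 continuous_const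

/-- A metric in local coordinates controls the norm, uniformly on compact sets. -/
lemma IsLocalMetric.exists_norm_le [FiniteDimensional ℂ E] {O : Set E} {G : E → E →L[ℝ] E →L[ℝ] ℝ}
    (hG : IsLocalMetric O G) {K : Set E} (hK : IsCompact K) (hKO : K ⊆ O) :
    ∃ c, 0 ≤ c ∧ ∀ y ∈ K, ∀ w, ‖w‖ ≤ c * √(G y w w) := by
  have := FiniteDimensional.proper ℝ E
  have hc : ContinuousOn (fun z : E × E => G z.1 z.2 z.2) (K ×ˢ Metric.sphere (0 : E) 1) := by
    have h1 : ContinuousOn (fun z : E × E => G z.1) (K ×ˢ Metric.sphere (0 : E) 1) :=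
      (hG.smooth.continuousOn.mono hKO).comp continuousOn_fst fun z hz => hz.1
    exact (h1.clm_apply continuousOn_snd).clm_apply continuousOn_snd
  -- A positive lower bound m for G on K times the unit sphere, by compactness. This form of the
  -- extreme value theorem also covers an empty sphere.
  obtain ⟨m, hm0, hm⟩ := (hK.prod (isCompact_sphere (0 : E) 1)).exists_forall_le' hc
    (a := 0) (fun z hz => hG.pos _ (hKO hz.1) _ (by
      intro h0
      have h2 : z.2 ∈ Metric.sphere (0 : E) 1 := hz.2
      rw [h0] at h2
      simp at h2))
  -- Scaling w to the unit sphere gives m‖w‖² ≤ G(w, w), whence the constant m^(-1/2).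
  refine ⟨(√m)⁻¹, by positivity, fun y hy w => ?_⟩
  rcases eq_or_ne w 0 with rfl | hw
  · simp
  have h3 := hm (y, (‖w‖⁻¹ : ℝ) • w) ⟨hy, by
    have hn : ‖w‖ ≠ 0 := norm_ne_zero_iff.2 hw
    simp [norm_smul, hn]⟩
  simp only [map_smul, FunLike.coe_smul, Pi.smul_apply, smul_eq_mul] at h3
  have hw' : 0 < ‖w‖ := norm_pos_iff.2 hw
  have h4 : m * ‖w‖ ^ 2 ≤ G y w w := by
    calc m * ‖w‖ ^ 2 ≤ (‖w‖⁻¹ * (‖w‖⁻¹ * G y w w)) * ‖w‖ ^ 2 :=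
          mul_le_mul_of_nonneg_right h3 (by positivity)
      _ = G y w w := by field_simp
  have h5 : √m * ‖w‖ ≤ √(G y w w) := by
    rw [← Real.sqrt_sq (norm_nonneg w), ← Real.sqrt_mul hm0.le]
    exact Real.sqrt_le_sqrt h4
  have h6 : 0 < √m := Real.sqrt_pos.2 hm0
  rw [inv_mul_eq_div, le_div_iff₀ h6, mul_comm]
  exact h5

/-- `∇_x^l u_x`. -/
def jetField (h : RMetric E N) (u : ℝ → ℝ → N) (l : ℕ) : ℝ → ℝ → E :=
  (nab h u (0, 1))^[l] (vel E u (0, 1))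

/-- A smooth map converging to a point as `x → -∞`, with rapidly decreasing `x`-derivatives. -/
structure DecayingMap (h : RMetric E N) (I : Set ℝ) (uinf : N) (u : ℝ → ℝ → N) : Prop where
  isOpen : IsOpen I
  map : SmoothMap E u (I ×ˢ univ)
  tendsto : ∀ t ∈ I, Tendsto (u t) atBot (𝓝 uinf)
  schwartz : ∀ k l : ℕ, ∀ K ⊆ I, IsCompact K → ∃ C : ℝ, ∀ t ∈ K, ∀ x : ℝ,
    |x| ^ k * √(metricAt h (u t x) (jetField h u l t x) (jetField h u l t x)) ≤ C

variable {h : RMetric E N} {I : Set ℝ} {uinf : N} {u : ℝ → ℝ → N}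

/-- The Schwartz bounds with weights 1 and x² add up to the integrable weight (1+x²)⁻¹; no stronger
decay is used below. -/
lemma DecayingMap.exists_decay (hu : DecayingMap h I uinf u) (l : ℕ) {K : Set ℝ} (hK : IsCompact K)
    (hKI : K ⊆ I) : ∃ C, ∀ t ∈ K, ∀ x,
      √(metricAt h (u t x) (jetField h u l t x) (jetField h u l t x)) ≤ C * (1 + x ^ 2)⁻¹ := by
  obtain ⟨C, hC⟩ := hu.schwartz 0 l K hKI hK
  obtain ⟨C', hC'⟩ := hu.schwartz 2 l K hKI hK
  refine ⟨C + C', fun t ht x => ?_⟩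
  have h1 := hC t ht x
  have h2 := hC' t ht x
  rw [sq_abs] at h2
  rw [← div_eq_mul_inv, le_div_iff₀ (by positivity)]
  linarith

section

variable [FiniteDimensional ℂ E]

lemma SmoothMap.smooth_jetField {Ω : Set (ℝ × ℝ)} (hu : SmoothMap E u Ω) (l : ℕ) :
    SmoothField u Ω (jetField h u l) := (hu.nablaX_iterate_eq h (hu.smooth_vel _) l).1

lemma SmoothMap.iterate_velX_eq {Ω : Set (ℝ × ℝ)} (hu : SmoothMap E u Ω) (l : ℕ) :
    ∀ z ∈ Ω, ((nablaX h u)^[l] (velX E u) z.1 z.2 : E) = jetField h u l z.1 z.2 := by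
  induction l with
  | zero => exact fun z hz => hu.velX_eq hz
  | succ l ih =>
    intro z hz
    have h2 := hu.smooth_congr ih (hu.smooth_jetField l)
    simp only [jetField, Function.iterate_succ', Function.comp_apply]
    rw [hu.nablaX_eq h h2 hz]
    exact hu.nab_congr h ih hz _

lemma IsAdmissible.decayingMap {T : EReal} (hu : IsAdmissible h T uinf u) :
    DecayingMap h (timeInterval T) uinf u := by
  have hm : SmoothMap E u (timeInterval T ×ˢ univ) :=
    ⟨(isOpen_timeInterval T).prod isOpen_univ, hu.smooth⟩
  refine ⟨isOpen_timeInterval T, hm, hu.tendsto, fun k l K hKI hK => ?_⟩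
  obtain ⟨C, hC⟩ := hu.schwartz k l K hKI hK
  refine ⟨C, fun t ht x => ?_⟩
  have hz : (t, x) ∈ timeInterval T ×ˢ (univ : Set ℝ) := ⟨hKI ht, mem_univ _⟩
  have h1 : (metricAt h (u t x) (jetField h u l t x) (jetField h u l t x)) =
    h.inner (u t x) ((nablaX h u)^[l] (velX E u) t x) ((nablaX h u)^[l] (velX E u) t x) := by
    rw [← hm.iterate_velX_eq l _ hz]
    rfl
  rw [h1]
  exact hC t ht x

variable (hu : DecayingMap h I uinf u)
include hu

lemma DecayingMap.mem {t x : ℝ} (ht : t ∈ I) : (t, x) ∈ I ×ˢ (univ : Set ℝ) := ⟨ht, mem_univ _⟩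

lemma DecayingMap.continuous {t : ℝ} (ht : t ∈ I) : Continuous (u t) :=
  continuous_slice hu.map.smooth.continuousOn ht

lemma DecayingMap.tendsto_coord {t : ℝ} (ht : t ∈ I) :
    Tendsto (fun x => coord E u uinf (t, x)) atBot (𝓝 (extChartAt 𝓘(ℝ, E) uinf uinf)) :=
  (continuousAt_extChartAt (I := 𝓘(ℝ, E)) uinf).tendsto.comp (hu.tendsto t ht)

/-- Locally uniformly in `t`, the map stays in a compact part of a chart as `x → -∞`. -/
lemma DecayingMap.exists_region [T2Space N] {t₀ : ℝ} (ht₀ : t₀ ∈ I) :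
    ∃ S ∈ 𝓝 t₀, IsCompact S ∧ S ⊆ I ∧ ∃ x₀ : ℝ, ∃ K : Set E, IsCompact K ∧
      K ⊆ (extChartAt 𝓘(ℝ, E) uinf).target ∧ (∀ t ∈ S, ∀ x ≤ x₀,
        u t x ∈ (chartAt E uinf).source ∧ coord E u uinf (t, x) ∈ K) := by
  have := FiniteDimensional.proper ℝ E
  set y := extChartAt 𝓘(ℝ, E) uinf uinf with hy
  obtain ⟨r, hr0, hr⟩ := Metric.nhds_basis_closedBall.mem_iff.1
    ((isOpen_extChartAt_target (I := 𝓘(ℝ, E)) uinf).mem_nhds (mem_extChartAt_target uinf))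
  obtain ⟨ε, hε0, hε⟩ := Metric.nhds_basis_closedBall.mem_iff.1 (hu.isOpen.mem_nhds ht₀)
  have hSc : IsCompact (Metric.closedBall t₀ ε) := isCompact_closedBall _ _
  have hKc : IsCompact (Metric.closedBall y r) := isCompact_closedBall _ _
  obtain ⟨c, hc0, hc⟩ := (isLocalMetric_metricInChart h uinf).exists_norm_le hKc hr
  obtain ⟨C, hC⟩ := hu.exists_decay 0 hSc hε
  set c' := c * C
  -- In the chart the speed is at most c'(1+s²)⁻¹, so c'(arctan x + π/2) bounds the length of the
  -- curve on (−∞, x]. The choice of x₀ makes it at most r/2 for all t in the compact interval at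
  -- once.
  obtain ⟨x₀, hx₀⟩ : ∃ x₀ : ℝ, ∀ x ≤ x₀, c' * (Real.arctan x + Real.pi / 2) ≤ r / 2 := by
    have h1 : Tendsto (fun x => c' * (Real.arctan x + Real.pi / 2)) atBot (𝓝 (c' * 0)) := by
      refine Tendsto.const_mul _ ?_
      have := (tendsto_nhds_of_tendsto_nhdsWithin Real.tendsto_arctan_atBot).add_const (Real.pi / 2)
      simpa using this
    rw [mul_zero] at h1
    exact eventually_atBot.1 (h1.eventually (eventually_le_nhds (by positivity)))
  set U : Set N := (extChartAt 𝓘(ℝ, E) uinf).source ∩ extChartAt 𝓘(ℝ, E) uinf ⁻¹' Metric.ball y r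
  have hU : IsOpen U := (continuousOn_extChartAt uinf).isOpen_inter_preimage
    (isOpen_extChartAt_source uinf) Metric.isOpen_ball
  -- The part of the chart over the ball of half the radius. It is compact, hence closed in the
  -- Hausdorff space N, so a limit of points of F cannot leave the chart domain.
  set F : Set N := (extChartAt 𝓘(ℝ, E) uinf).symm '' Metric.closedBall y (r / 2)
  have hhalf : Metric.closedBall y (r / 2) ⊆ Metric.ball y r :=
    Metric.closedBall_subset_ball (by linarith)
  have hF : IsClosed F := by
    refine (IsCompact.image_of_continuousOn (isCompact_closedBall _ _) ?_).isClosed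
    exact (continuousOn_extChartAt_symm uinf).mono
      ((hhalf.trans Metric.ball_subset_closedBall).trans hr)
  have hFU : F ⊆ U := by
    rintro _ ⟨w, hw, rfl⟩
    have hw' := hr (Metric.ball_subset_closedBall (hhalf hw))
    refine ⟨(extChartAt 𝓘(ℝ, E) uinf).map_target hw', ?_⟩
    rw [mem_preimage, (extChartAt 𝓘(ℝ, E) uinf).right_inv hw']
    exact hhalf hw
  have key : ∀ t ∈ Metric.closedBall t₀ ε, ∀ x ≤ x₀, u t x ∈ U := by
    intro t ht
    have htI := hε ht
    have hγ := hu.continuous htI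
    by_contra! hne
    obtain ⟨x₁, hx₁, hx₁'⟩ := hne
    -- The parameters at which the curve is outside U. This set is bounded below because u(t,·) →
    -- u^∞, so its infimum m is the first exit after −∞.
    set Z : Set ℝ := {x | x ≤ x₀} ∩ u t ⁻¹' Uᶜ with hZ
    have hZc : IsClosed Z := isClosed_Iic.inter (hU.isClosed_compl.preimage hγ)
    obtain ⟨m₀, hm₀⟩ := eventually_atBot.1 ((hu.tendsto t htI).eventually (hU.mem_nhds
      ⟨mem_extChartAt_source uinf, Metric.mem_ball_self hr0⟩))
    have hZb : BddBelow Z := ⟨m₀, fun x hx => by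
      by_contra hlt
      exact hx.2 (hm₀ x (not_le.1 hlt).le)⟩
    have hm := hZc.csInf_mem ⟨x₁, hx₁, hx₁'⟩ hZb
    set m := sInf Z
    have hlt : ∀ x < m, u t x ∈ U := fun x hx => by
      by_contra hxU
      exact notMem_of_lt_csInf hx hZb ⟨hx.le.trans hm.1, hxU⟩
    have hderiv : ∀ x < m, HasDerivAt (fun x => coord E u uinf (t, x))
        (rep u uinf (vel E u (0, 1)) (t, x)) x ∧
        ‖rep u uinf (vel E u (0, 1)) (t, x)‖ ≤ c' * (1 / (1 + x ^ 2)) := by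
      intro x hx
      have hs : u t x ∈ (chartAt E uinf).source := by
        have := (hlt x hx).1
        rwa [extChartAt_source] at this
      have hz : (t, x) ∈ I ×ˢ (univ : Set ℝ) := hu.mem htI
      refine ⟨?_, ?_⟩
      · rw [hu.map.rep_vel hz hs]
        exact deriv_slice (differentiableAt_of_smooth (hu.map.contDiffAt_coord hz hs))
      · refine (hc _ (Metric.ball_subset_closedBall (hlt x hx).2) _).trans ?_
        rw [rep, ← metricAt_eq h hs, mul_assoc, one_div]
        exact mul_le_mul_of_nonneg_left (hC t ht x) hc0
    -- Before m the curve lies in the chart, where the speed bound holds. The mean value inequality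
    -- on [x', x] with comparison function c'(arctan s − arctan x'), followed by x' → −∞, bounds the
    -- distance to the limit point.
    have hdist : ∀ x < m, ‖coord E u uinf (t, x) - y‖ ≤ r / 2 := by
      intro x hx
      have hx' : c' * (Real.arctan x + Real.pi / 2) ≤ r / 2 := hx₀ x (hx.le.trans hm.1)
      have hlim : Tendsto (fun x' => ‖coord E u uinf (t, x) - coord E u uinf (t, x')‖) atBot
          (𝓝 ‖coord E u uinf (t, x) - y‖) :=
        (tendsto_const_nhds.sub (hu.tendsto_coord htI)).norm
      refine le_of_tendsto hlim ?_
      filter_upwards [eventually_lt_atBot x] with x' hx'x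
      have hb := image_norm_le_of_norm_deriv_right_le_deriv_boundary
        (f := fun s => coord E u uinf (t, s) - coord E u uinf (t, x'))
        (f' := fun s => rep u uinf (vel E u (0, 1)) (t, s)) (a := x') (b := x)
        (B := fun s => c' * (Real.arctan s - Real.arctan x'))
        (B' := fun s => c' * (1 / (1 + s ^ 2))) ?_ ?_ ?_ ?_ ?_ (right_mem_Icc.2 hx'x.le)
      · refine hb.trans (le_trans ?_ hx')
        have hc'0 : 0 ≤ c' := by
          have h1 := (norm_nonneg _).trans (hderiv x hx).2
          have h2 : (0 : ℝ) < 1 / (1 + x ^ 2) := by positivity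
          exact nonneg_of_mul_nonneg_left h1 h2
        refine mul_le_mul_of_nonneg_left ?_ hc'0
        have := Real.neg_pi_div_two_lt_arctan x'
        linarith
      · intro s hs
        exact ((hderiv s (hs.2.trans_lt hx)).1.sub_const _).continuousAt.continuousWithinAt
      · intro s hs
        exact ((hderiv s (hs.2.trans hx)).1.sub_const _).hasDerivWithinAt
      · simp
      · intro s
        exact ((Real.hasDerivAt_arctan s).sub_const _).const_mul _
      · intro s hs
        exact (hderiv s (hs.2.trans hx)).2
    -- At the exit parameter the curve is a limit of points of F, so it lies in F and hence still in
    -- U, a contradiction.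
    have hmF : u t m ∈ F := by
      refine hF.mem_of_tendsto (b := 𝓝[<] m) (f := u t) (hγ.continuousAt.mono_left inf_le_left) ?_
      filter_upwards [self_mem_nhdsWithin] with x hx
      exact ⟨coord E u uinf (t, x), mem_closedBall_iff_norm.2 (hdist x hx),
        (extChartAt 𝓘(ℝ, E) uinf).left_inv (hlt x hx).1⟩
    exact hm.2 (hFU hmF)
  refine ⟨_, Metric.closedBall_mem_nhds t₀ hε0, hSc, hε, x₀, _, hKc, hr, fun t ht x hx => ?_⟩
  have := key t ht x hx
  refine ⟨?_, Metric.ball_subset_closedBall this.2⟩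
  have h2 := this.1
  rwa [extChartAt_source] at h2

end

end Infinity

end KahlerFlow
end

noncomputable section
namespace KahlerFlow

/-! ### Jets of an admissible map near `x = -∞` -/

section FlowJets

set_option maxSynthPendingDepth 3
set_option linter.unusedSectionVars false

open Set Filter

variable {E : Type*} [NormedAddCommGroup E] [NormedSpace ℂ E] [FiniteDimensional ℂ E]
  {N : Type*} [TopologicalSpace N] [ChartedSpace E N] [IsManifold 𝓘(ℂ, E) ω N]
  {h : RMetric E N} {I : Set ℝ} {uinf : N} {u : ℝ → ℝ → N} {κ : Type*}

/-- The jets of `u`, together with smooth fields `Y`, in the preferred chart at `u^∞`. -/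
def DecayingMap.jets (hu : DecayingMap h I uinf u) {Y : κ → ℝ → ℝ → E}
    (hY : ∀ k, SmoothField u (I ×ˢ univ) (Y k)) : JetData E κ where
  A := {z | z ∈ I ×ˢ (univ : Set ℝ) ∧ u z.1 z.2 ∈ (chartAt E uinf).source}
  O := (extChartAt 𝓘(ℝ, E) uinf).target
  v := coord E u uinf
  W l := rep u uinf (jetField h u l)
  Y k := rep u uinf (Y k)
  isOpen_A := isOpen_iff_mem_nhds.2 fun _ hz => hu.map.eventually_source hz.1 hz.2
  isOpen_O := isOpen_extChartAt_target uinf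
  mapsTo _ hz := coord_mem hz.2
  smooth_v _ hz := hu.map.contDiffAt_coord hz.1 hz.2
  smooth_W l z hz := hu.map.smooth_jetField l z hz.1 _ hz.2
  smooth_Y k z hz := hY k z hz.1 _ hz.2

variable (hu : DecayingMap h I uinf u) {Y : κ → ℝ → ℝ → E}
  (hY : ∀ k, SmoothField u (I ×ˢ univ) (Y k))

lemma contDiffOn_chartChr (h : RMetric E N) (p : N) :
    ContDiffOn ℝ ∞ (chartChr h p) (extChartAt 𝓘(ℝ, E) p).target :=
  fun _ hy => (contDiffAt_chartChr h hy).contDiffWithinAt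

lemma DecayingMap.fderiv_coord {z : ℝ × ℝ} (hz : z ∈ (hu.jets hY).A) :
    fderiv ℝ (coord E u uinf) z (0, 1) = rep u uinf (jetField h u 0) z :=
  (hu.map.rep_vel hz.1 hz.2 _).symm

lemma DecayingMap.rep_jetField_succ {z : ℝ × ℝ} (hz : z ∈ (hu.jets hY).A) (l : ℕ) :
    rep u uinf (jetField h u (l + 1)) z = fderiv ℝ (rep u uinf (jetField h u l)) z (0, 1)
      + chartChr h uinf (coord E u uinf z) (rep u uinf (jetField h u 0) z)
        (rep u uinf (jetField h u l) z) := by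
  have := hu.map.rep_nab h (hu.map.smooth_jetField (h := h) l) hz.1 hz.2 (0, 1)
  rw [localCov, hu.fderiv_coord hY hz] at this
  rw [← this, jetField, Function.iterate_succ']
  rfl

lemma DecayingMap.jetVec_deriv_coord : JetVec (hu.jets hY) true
    (fun z => fderiv ℝ (hu.jets hY).v z (0, 1)) :=
  (JetVec.jet (D := hu.jets hY) 0).congr fun _ hz => hu.fderiv_coord hY hz

/-- The ordinary x derivative of a jet in the chart is the next jet minus a Christoffel term, so no
functions outside the class arise. -/
lemma DecayingMap.jetVec_deriv_jet (l : ℕ) : JetVec (hu.jets hY) true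
    (fun z => fderiv ℝ ((hu.jets hY).W l) z (0, 1)) := by
  have h1 := JetVec.form₂ (D := hu.jets hY) (contDiffOn_chartChr h uinf) (JetVec.jet 0)
    (JetVec.jet l)
  refine ((JetVec.jet (D := hu.jets hY) (l + 1)).sub h1).congr fun z hz => ?_
  exact eq_sub_of_add_eq (hu.rep_jetField_succ hY hz l).symm

/-- Parallel fields satisfy a linear equation in the chart. -/
lemma DecayingMap.jetVec_deriv_parallel {k : κ}
    (hp : ∀ z ∈ I ×ˢ (univ : Set ℝ), nab h u (0, 1) (Y k) z.1 z.2 = 0) : JetVec (hu.jets hY) true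
    (fun z => fderiv ℝ ((hu.jets hY).Y k) z (0, 1)) := by
  have h1 := JetVec.form₂ (D := hu.jets hY) (contDiffOn_chartChr h uinf) (JetVec.jet 0)
    (JetVec.bdd k)
  refine (h1.const_smul (-1)).congr fun z hz => ?_
  have := hu.map.rep_nab h (hY k) hz.1 hz.2 (0, 1)
  rw [localCov, hu.fderiv_coord hY hz, rep, hp z hz.1, map_zero] at this
  rw [neg_smul, one_smul]
  exact eq_neg_of_add_eq_zero_left this.symm

/-- The right hand side of the equation. -/
def flowField (h : RMetric E N) (a lam b c : ℝ) (u : ℝ → ℝ → N) (t x : ℝ) : E :=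
  a • (Complex.I • jetField h u 3 t x) + lam • (Complex.I • jetField h u 1 t x)
    + b • curvAt h (u t x) (jetField h u 1 t x) (jetField h u 0 t x)
        (Complex.I • jetField h u 0 t x)
    + c • curvAt h (u t x) (Complex.I • jetField h u 0 t x) (jetField h u 0 t x)
        (jetField h u 1 t x)

lemma DecayingMap.jetVec_flowField (a lam b c : ℝ) :
    JetVec (hu.jets hY) true (rep u uinf (flowField h a lam b c u)) := by
  set D := hu.jets hY
  have hc := contDiffOn_chartChr h uinf
  have j := fun l => JetVec.jet (D := D) l
  have h1 := (j 3).const_smul (a * Complex.I)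
  have h2 := (j 1).const_smul (lam * Complex.I)
  have h3 := (JetVec.curv hc (j 1) (j 0) ((j 0).const_smul Complex.I)).const_smul b
  have h4 := (JetVec.curv hc ((j 0).const_smul Complex.I) (j 0) (j 1)).const_smul c
  refine (((h1.add h2).add h3).add h4).congr fun z hz => ?_
  simp only [rep, flowField, map_add, map_smul, curvAt_eq h hz.2, toChart_I hz.2, mul_smul,
    Complex.coe_smul]
  rfl

/-! ### Time derivatives of the jets by means of the equation -/

section Time

variable {a lam b c : ℝ} (hflow : ∀ z ∈ I ×ˢ (univ : Set ℝ),
  vel E u (1, 0) z.1 z.2 = flowField h a lam b c u z.1 z.2)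

include hflow

/-- Here the equation enters: u_t is a polynomial in the spatial jets, so it decays although decay
is assumed for x derivatives only. -/
lemma DecayingMap.jetVec_time_coord : JetVec (hu.jets hY) true
    (fun z => fderiv ℝ (hu.jets hY).v z (1, 0)) := by
  refine (hu.jetVec_flowField hY a lam b c).congr fun z hz => ?_
  rw [rep, ← hflow z hz.1]
  exact (hu.map.rep_vel hz.1 hz.2 _).symm

/-- The time derivatives of the jets of `u` are polynomials in the jets. -/
lemma DecayingMap.jetVec_time_jet {Y : Empty → ℝ → ℝ → E}
    (hY : ∀ k, SmoothField u (I ×ˢ univ) (Y k)) (l : ℕ) : JetVec (hu.jets hY) true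
    (fun z => fderiv ℝ ((hu.jets hY).W l) z (1, 0)) := by
  have hc := contDiffOn_chartChr h uinf
  have hdc : ContDiffOn ℝ ∞ (fderiv ℝ (chartChr h uinf)) (extChartAt 𝓘(ℝ, E) uinf).target :=
    hc.fderiv_of_isOpen (isOpen_extChartAt_target uinf) (by simp)
  have comm : ∀ {f : ℝ × ℝ → E} {z : ℝ × ℝ}, ContDiffAt ℝ ∞ f z →
      fderiv ℝ (fun z => fderiv ℝ f z (0, 1)) z (1, 0)
        = fderiv ℝ (fun z => fderiv ℝ f z (1, 0)) z (0, 1) := by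
    intro f z hf
    have hd := differentiableAt_of_smooth (contDiffAt_fderiv hf)
    rw [fderiv_clm_apply_const hd, fderiv_clm_apply_const hd, fderiv_fderiv_symm hf]
  -- With an empty family of bounded fields, the class is closed under ∂_x without further
  -- hypotheses.
  have dX : ∀ {b f}, JetVec (hu.jets hY) b f → JetVec (hu.jets hY) true
      (fun z => fderiv ℝ f z (0, 1)) := fun hf =>
    JetVec.fderiv (hu.jetVec_deriv_coord hY) (hu.jetVec_deriv_jet hY) (fun k => k.elim) hf
  -- The zeroth jet is ∂_x v in the chart, so its t derivative is the x derivative of ∂_t v. Higher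
  -- jets follow by differentiating the recursion in t and commuting ∂_t with ∂_x.
  have h0 : JetVec (hu.jets hY) true (fun z => fderiv ℝ ((hu.jets hY).W 0) z (1, 0)) := by
    refine (dX (hu.jetVec_time_coord hY hflow)).congr fun z hz => ?_
    rw [← comm ((hu.jets hY).smooth_v z hz)]
    have : (hu.jets hY).W 0 =ᶠ[𝓝 z] fun z => fderiv ℝ (hu.jets hY).v z (0, 1) :=
      eventually_of_mem ((hu.jets hY).isOpen_A.mem_nhds hz) fun z' hz' =>
        (hu.fderiv_coord hY hz').symm
    rw [this.fderiv_eq]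
  induction l with
  | zero => exact h0
  | succ l ih =>
    have h1 := dX ih
    have h2 := JetVec.form₃ (D := hu.jets hY) hdc (hu.jetVec_time_coord hY hflow) (JetVec.jet 0)
      (JetVec.jet l)
    have h3 := JetVec.form₂ (D := hu.jets hY) hc h0 (JetVec.jet l)
    have h4 := JetVec.form₂ (D := hu.jets hY) hc (JetVec.jet 0) ih
    refine (h1.add ((h2.add h3).add h4)).congr fun z hz => ?_
    have s0 := (hu.jets hY).smooth_W 0 z hz
    have sl := (hu.jets hY).smooth_W l z hz
    have sv := (hu.jets hY).smooth_v z hz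
    have sc := contDiffAt_chartChr h ((hu.jets hY).mapsTo hz)
    have scv : ContDiffAt ℝ ∞ (fun z => chartChr h uinf ((hu.jets hY).v z)) z := sc.comp z sv
    have : (hu.jets hY).W (l + 1) =ᶠ[𝓝 z] fun z => fderiv ℝ ((hu.jets hY).W l) z (0, 1)
        + chartChr h uinf ((hu.jets hY).v z) ((hu.jets hY).W 0 z) ((hu.jets hY).W l z) :=
      eventually_of_mem ((hu.jets hY).isOpen_A.mem_nhds hz) fun z' hz' =>
        hu.rep_jetField_succ hY hz' l
    rw [this.fderiv_eq, fderiv_fun_add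
      (differentiableAt_of_smooth ((contDiffAt_fderiv sl).clm_apply contDiffAt_const))
      (differentiableAt_of_smooth ((scv.clm_apply s0).clm_apply sl))]
    have e1 := fderiv_clm_apply₂ (differentiableAt_of_smooth scv) (differentiableAt_of_smooth s0)
      (differentiableAt_of_smooth sl) (1, 0)
    have e2 := fderiv_comp_apply (differentiableAt_of_smooth sc) (differentiableAt_of_smooth sv) (1, 0)
    rw [e2] at e1
    change fderiv ℝ (fun z => fderiv ℝ ((hu.jets hY).W l) z (0, 1)) z (1, 0) + fderiv ℝ (fun z =>
      chartChr h uinf ((hu.jets hY).v z) ((hu.jets hY).W 0 z) ((hu.jets hY).W l z)) z (1, 0) = _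
    rw [e1, comm sl]

end Time

/-- Locally uniform bounds for polynomials in the jets. -/
lemma DecayingMap.exists_bound [T2Space N] {b : Bool} {f : ℝ × ℝ → ℂ}
    (hf : JetPoly (hu.jets hY) b f)
    (hYb : ∀ k, ∃ C, ∀ z ∈ I ×ˢ (univ : Set ℝ),
      metricAt h (u z.1 z.2) (Y k z.1 z.2) (Y k z.1 z.2) ≤ C)
    {t₀ : ℝ} (ht₀ : t₀ ∈ I) : ∃ S ∈ 𝓝 t₀, IsCompact S ∧ S ⊆ I ∧ ∃ x₀ C : ℝ, 0 ≤ C ∧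
      ∀ t ∈ S, ∀ x ≤ x₀, u t x ∈ (chartAt E uinf).source ∧
        ‖f (t, x)‖ ≤ C * (bif b then (1 + x ^ 2)⁻¹ else 1) := by
  obtain ⟨S, hS, hSc, hSI, x₀, K, hK, hKO, hR⟩ := hu.exists_region ht₀
  obtain ⟨c, hc0, hc⟩ := (isLocalMetric_metricInChart h uinf).exists_norm_le hK hKO
  have hW : ∀ l, ∃ C, ∀ z ∈ S ×ˢ Iic x₀, ‖(hu.jets hY).W l z‖ ≤ C * (1 + z.2 ^ 2)⁻¹ := by
    intro l
    obtain ⟨C, hC⟩ := hu.exists_decay l hSc hSI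
    refine ⟨c * C, fun z hz => ?_⟩
    have h1 := hR z.1 hz.1 z.2 hz.2
    refine (hc _ h1.2 _).trans ?_
    change c * √(metricInChart h uinf (coord E u uinf z) (rep u uinf _ z) (rep u uinf _ z)) ≤ _
    rw [rep, coord, ← metricAt_eq h h1.1, mul_assoc]
    exact mul_le_mul_of_nonneg_left (hC z.1 hz.1 z.2) hc0
  have hY' : ∀ k, ∃ C, ∀ z ∈ S ×ˢ Iic x₀, ‖(hu.jets hY).Y k z‖ ≤ C := by
    intro k
    obtain ⟨C, hC⟩ := hYb k
    refine ⟨c * √C, fun z hz => ?_⟩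
    have h1 := hR z.1 hz.1 z.2 hz.2
    refine (hc _ h1.2 _).trans ?_
    change c * √(metricInChart h uinf (coord E u uinf z) (rep u uinf _ z) (rep u uinf _ z)) ≤ _
    rw [rep, coord, ← metricAt_eq h h1.1]
    exact mul_le_mul_of_nonneg_left (Real.sqrt_le_sqrt (hC z ⟨hSI hz.1, mem_univ _⟩)) hc0
  obtain ⟨C, hC0, hC⟩ := hf.bound (D := hu.jets hY) (R := S ×ˢ Iic x₀) (K := K)
    (fun z hz => ⟨⟨hSI hz.1, mem_univ _⟩, (hR z.1 hz.1 z.2 hz.2).1⟩) hK hKO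
    (fun z hz => (hR z.1 hz.1 z.2 hz.2).2) hW hY'
  exact ⟨S, hS, hSc, hSI, x₀, C, hC0, fun t ht x hx => ⟨(hR t ht x hx).1, hC (t, x) ⟨ht, hx⟩⟩⟩

/-- The jet expression controls f only near −∞, where u lies in the chart. On the remaining compact
set S × [x₀, X] plain continuity suffices, which is why it is a separate hypothesis. -/
lemma DecayingMap.decaysAtBot [T2Space N] {f : ℝ × ℝ → ℂ}
    (hf : JetPoly (hu.jets hY) true f)
    (hYb : ∀ k, ∃ C, ∀ z ∈ I ×ˢ (univ : Set ℝ),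
      metricAt h (u z.1 z.2) (Y k z.1 z.2) (Y k z.1 z.2) ≤ C)
    (hfc : ContinuousOn f (I ×ˢ univ)) : DecaysAtBot I (fun t x => f (t, x)) := by
  intro t₀ ht₀ X
  obtain ⟨S, hS, hSc, hSI, x₀, C, hC0, hC⟩ := hu.exists_bound hY hf hYb ht₀
  obtain ⟨M, hM⟩ := (hSc.prod (isCompact_Icc (a := x₀) (b := X))).exists_bound_of_continuousOn
    (hfc.mono (prod_mono hSI (subset_univ _)))
  -- On [x₀, X] one has x² ≤ x₀² + X², so this factor turns the bound M into one by a multiple of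
  -- (1+x²)⁻¹.
  set M' := max M 0 * (1 + (x₀ ^ 2 + X ^ 2))
  have hM'0 : 0 ≤ M' := mul_nonneg (le_max_right _ _) (by positivity)
  refine ⟨C + M', by positivity, ?_⟩
  filter_upwards [hS] with t ht x hx
  have hpos : (0 : ℝ) < (1 + x ^ 2)⁻¹ := by positivity
  rw [add_mul]
  rcases le_total x x₀ with hx0 | hx0
  · have := (hC t ht x hx0).2
    simp only [cond_true] at this
    have h2 : 0 ≤ M' * (1 + x ^ 2)⁻¹ := by positivity
    linarith
  · have h1 : ‖f (t, x)‖ ≤ max M 0 := (hM (t, x) ⟨ht, hx0, hx⟩).trans (le_max_left _ _)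
    have h2 : 0 ≤ C * (1 + x ^ 2)⁻¹ := by positivity
    have h3 : x ^ 2 ≤ x₀ ^ 2 + X ^ 2 := by
      rcases le_total 0 x with h0 | h0 <;> nlinarith
    have h4 : max M 0 ≤ M' * (1 + x ^ 2)⁻¹ := by
      rw [← div_eq_mul_inv, le_div_iff₀ (by positivity)]
      exact mul_le_mul_of_nonneg_left (by linarith) (le_max_right _ _)
    linarith

end FlowJets

end KahlerFlow
end

noncomputable section
namespace KahlerFlow

/-! ### A finite family of vector fields spanning the tangent bundle -/

section Spanning

set_option maxSynthPendingDepth 3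
set_option linter.unusedSectionVars false

open Set Filter

variable {E : Type*} [NormedAddCommGroup E] [NormedSpace ℂ E]
  {N : Type*} [TopologicalSpace N] [ChartedSpace E N] [IsManifold 𝓘(ℂ, E) ω N]

/-- Finitely many smooth vector fields `X i` and forms `ξ i` on `N` with `∑ ξ i (v) X i = v`. -/
structure SpanningFields (E : Type*) [NormedAddCommGroup E] [NormedSpace ℂ E]
    (N : Type*) [TopologicalSpace N] [ChartedSpace E N] [IsManifold 𝓘(ℂ, E) ω N]
    (ι : Type*) [Fintype ι] where
  /-- the vector fields -/
  X : ι → N → E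
  /-- the forms -/
  ξ : ι → N → E →L[ℝ] ℂ
  smooth_X : ∀ i p, ContDiffOn ℝ ∞ (fun y => toChart E p ((extChartAt 𝓘(ℝ, E) p).symm y)
    (X i ((extChartAt 𝓘(ℝ, E) p).symm y))) (extChartAt 𝓘(ℝ, E) p).target
  smooth_ξ : ∀ i p, ContDiffOn ℝ ∞ (fun y => (ξ i ((extChartAt 𝓘(ℝ, E) p).symm y)).comp
    (ofChart E p ((extChartAt 𝓘(ℝ, E) p).symm y))) (extChartAt 𝓘(ℝ, E) p).target
  sum_eq : ∀ q v, ∑ i, ξ i q v • X i q = v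

lemma contDiffOn_comp_symm {f : N → ℝ} (hf : ContMDiff 𝓘(ℝ, E) 𝓘(ℝ, ℝ) ∞ f) (p : N) :
    ContDiffOn ℝ ∞ (fun y => f ((extChartAt 𝓘(ℝ, E) p).symm y)) (extChartAt 𝓘(ℝ, E) p).target :=
  (hf.comp_contMDiffOn (contMDiffOn_extChartAt_symm (I := 𝓘(ℝ, E)) (n := ∞) p)).contDiffOn

/-- Inside the chart domain of p' the product is smooth factor by factor; at any other point of the
chart at p the cut-off vanishes nearby. -/
lemma contDiffOn_cutoff {F : Type*} [NormedAddCommGroup F] [NormedSpace ℝ F] {f : N → ℝ}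
    (hf : ContMDiff 𝓘(ℝ, E) 𝓘(ℝ, ℝ) ∞ f) {p p' : N} (hs : tsupport f ⊆ (chartAt E p').source)
    {g : E → F} (hg : ContDiffOn ℝ ∞ g (transitionSource E p p')) :
    ContDiffOn ℝ ∞ (fun y => f ((extChartAt 𝓘(ℝ, E) p).symm y) • g y)
      (extChartAt 𝓘(ℝ, E) p).target := by
  intro y hy
  refine ContDiffAt.contDiffWithinAt ?_
  have h1 := (contDiffOn_comp_symm hf p).contDiffAt ((isOpen_extChartAt_target p).mem_nhds hy)
  by_cases hy' : (extChartAt 𝓘(ℝ, E) p).symm y ∈ (chartAt E p').source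
  · exact h1.smul (hg.contDiffAt ((isOpen_transitionSource p p').mem_nhds ⟨hy, hy'⟩))
  · have h2 : ContinuousAt (extChartAt 𝓘(ℝ, E) p).symm y :=
      (continuousOn_extChartAt_symm p).continuousAt ((isOpen_extChartAt_target p).mem_nhds hy)
    have h3 := h2.eventually ((isClosed_tsupport f).isOpen_compl.mem_nhds fun h => hy' (hs h))
    refine (contDiffAt_const (c := (0 : F))).congr_of_eventuallyEq ?_
    filter_upwards [h3] with y' hy''
    rw [image_eq_zero_of_notMem_tsupport hy'', zero_smul]

lemma ofChart_smul {p q : N} (hq : q ∈ (chartAt E p).source) (c : ℂ) (v : E) :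
    ofChart E p q (c • v) = c • ofChart E p q v := by
  apply toChart_injective hq
  rw [toChart_smul hq, toChart_ofChart hq, toChart_ofChart hq]

lemma contDiffOn_toChart_ofChart [FiniteDimensional ℂ E] (p p' : N) (w : E) :
    ContDiffOn ℝ ∞ (fun y => toChart E p ((extChartAt 𝓘(ℝ, E) p).symm y)
      (ofChart E p' ((extChartAt 𝓘(ℝ, E) p).symm y) w)) (transitionSource E p p') := by
  have h1 : ContDiffOn ℝ ∞ (fderiv ℝ (transition E p' p)) (transitionSource E p' p) :=
    (contDiffOn_transition p' p).fderiv_of_isOpen (isOpen_transitionSource p' p) (by simp)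
  refine ContDiffOn.congr (f := fun y => fderiv ℝ (transition E p' p) (transition E p p' y) w) ?_ ?_
  · refine ContDiffOn.clm_apply (h1.comp (contDiffOn_transition p p') fun y hy => ?_)
      contDiffOn_const
    exact mem_transitionSource hy.2 (symm_mem_source hy.1)
  · intro y hy
    rw [toChart_change hy.2 (symm_mem_source hy.1), toChart_ofChart hy.2]
    rfl

lemma contDiffOn_toChart_comp_ofChart (p p' : N) :
    ContDiffOn ℝ ∞ (fun y => (toChart E p' ((extChartAt 𝓘(ℝ, E) p).symm y)).comp
      (ofChart E p ((extChartAt 𝓘(ℝ, E) p).symm y))) (transitionSource E p p') := by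
  have h1 : ContDiffOn ℝ ∞ (fderiv ℝ (transition E p p')) (transitionSource E p p') :=
    (contDiffOn_transition p p').fderiv_of_isOpen (isOpen_transitionSource p p') (by simp)
  refine h1.congr fun y hy => ?_
  ext w
  rw [ContinuousLinearMap.comp_apply, toChart_change (symm_mem_source hy.1) hy.2,
    toChart_ofChart (symm_mem_source hy.1), (extChartAt 𝓘(ℝ, E) p).right_inv hy.1]

/-- Coordinate frames of finitely many charts, cut off by a partition of unity. Global fields are
needed because u may leave every single chart, while the linear equation for parallel fields has to
be solved on the whole line. Compactness of N makes the family finite. -/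
theorem exists_spanningFields [FiniteDimensional ℂ E] [T2Space N] [CompactSpace N] :
    ∃ (s : Finset N), Nonempty (SpanningFields E N (s × Fin (Module.finrank ℂ E))) := by
  obtain ⟨s, hs⟩ := isCompact_univ.elim_finite_subcover (fun p : N => (chartAt E p).source)
    (fun p => (chartAt E p).open_source) fun p _ => mem_iUnion.2 ⟨p, mem_chart_source E p⟩
  have hs' : (univ : Set N) ⊆ ⋃ i : s, (chartAt E (i : N)).source := fun q hq => by
    obtain ⟨i, hi, hq⟩ := mem_iUnion₂.1 (hs hq)
    exact mem_iUnion.2 ⟨⟨i, hi⟩, hq⟩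
  obtain ⟨ρ, hρ⟩ := SmoothPartitionOfUnity.exists_isSubordinate 𝓘(ℝ, E) isClosed_univ
    (fun i : s => (chartAt E (i : N)).source) (fun i => (chartAt E (i : N)).open_source) hs'
  -- The cut-off ρ_i enters both the field and the form, so the sum of squares is what has to be
  -- normalised. It is positive because the ρ_i sum to 1 and cannot all vanish.
  set σ : N → ℝ := fun q => ∑ i, ρ i q ^ 2 with hσ
  have hρ1 : ∀ q, ∑ i, ρ i q = 1 := fun q => by
    rw [← finsum_eq_sum_of_fintype]; exact ρ.sum_eq_one (mem_univ q)
  have hσ0 : ∀ q, 0 < σ q := fun q => by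
    refine (Finset.sum_nonneg fun i _ => sq_nonneg _).lt_of_ne fun h0 => ?_
    have h1 := (Finset.sum_eq_zero_iff_of_nonneg fun i _ => sq_nonneg (ρ i q)).1 h0.symm
    have h2 := hρ1 q
    rw [Finset.sum_eq_zero fun i hi => pow_eq_zero_iff (two_ne_zero) |>.1 (h1 i hi)] at h2
    exact zero_ne_one h2
  have hρσ : ∀ i, ContMDiff 𝓘(ℝ, E) 𝓘(ℝ, ℝ) ∞ (fun q => (σ q)⁻¹ * ρ i q) := fun i => by
    have h1 : ContMDiff 𝓘(ℝ, E) 𝓘(ℝ, ℝ) ∞ σ :=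
      contMDiff_finsetSum fun i _ => (ρ i).contMDiff.pow 2
    exact (h1.inv₀ fun q => (hσ0 q).ne').mul (ρ i).contMDiff
  have hts : ∀ i, tsupport (fun q => (σ q)⁻¹ * ρ i q) ⊆ (chartAt E (i : N)).source := fun i =>
    (closure_mono fun q hq => by
      rw [Function.mem_support] at hq ⊢
      exact right_ne_zero_of_mul hq).trans (hρ i)
  set β := Module.finBasis ℂ E
  set βc : Fin (Module.finrank ℂ E) → E →L[ℝ] ℂ := fun k =>
    (LinearMap.toContinuousLinearMap (β.coord k)).restrictScalars ℝ
  refine ⟨s, ⟨⟨fun i q => ρ i.1 q • ofChart E (i.1 : N) q (β i.2),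
    fun i q => ((σ q)⁻¹ * ρ i.1 q) • (βc i.2).comp (toChart E (i.1 : N) q), ?_, ?_, ?_⟩⟩⟩
  · intro i p
    simp only [map_smul]
    exact contDiffOn_cutoff (ρ i.1).contMDiff (hρ i.1) (contDiffOn_toChart_ofChart p _ _)
  · intro i p
    have h1 : ContDiffOn ℝ ∞ (fun y => (βc i.2).comp ((toChart E (i.1 : N)
        ((extChartAt 𝓘(ℝ, E) p).symm y)).comp (ofChart E p ((extChartAt 𝓘(ℝ, E) p).symm y))))
        (transitionSource E p (i.1 : N)) :=
      contDiffOn_const.clm_comp (contDiffOn_toChart_comp_ofChart p _)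
    exact contDiffOn_cutoff (hρσ i.1) (hts i.1) h1
  · intro q v
    rw [Fintype.sum_prod_type]
    have h1 : ∀ i : s, ∑ k, (((σ q)⁻¹ * ρ i q) • (βc k).comp (toChart E (i : N) q)) v •
        ρ i q • ofChart E (i : N) q (β k) = ((σ q)⁻¹ * ρ i q ^ 2) • v := by
      intro i
      by_cases h0 : ρ i q = 0
      · simp [h0]
      have hq : q ∈ (chartAt E (i : N)).source := hρ i (subset_tsupport _ h0)
      have h2 : v = ∑ k, βc k (toChart E (i : N) q v) • ofChart E (i : N) q (β k) := by
        conv_lhs => rw [← ofChart_toChart hq v, ← β.sum_repr (toChart E (i : N) q v), map_sum]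
        exact Finset.sum_congr rfl fun k _ => ofChart_smul hq _ _
      conv_rhs => rw [h2, Finset.smul_sum]
      refine Finset.sum_congr rfl fun k _ => ?_
      rw [smul_apply, ContinuousLinearMap.comp_apply, smul_assoc, smul_comm (_ : ℂ) (ρ i q),
        smul_smul]
      congr 1
      ring
    simp only [h1]
    rw [← Finset.sum_smul, ← Finset.mul_sum, inv_mul_cancel₀ (hσ0 q).ne', one_smul]

variable {ι : Type*} [Fintype ι] (P : SpanningFields E N ι) {u : ℝ → ℝ → N} {Ω : Set (ℝ × ℝ)}

/-- The coordinate expression of the `i`-th vector field. -/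
def SpanningFields.XChart (i : ι) (p : N) (y : E) : E :=
  toChart E p ((extChartAt 𝓘(ℝ, E) p).symm y) (P.X i ((extChartAt 𝓘(ℝ, E) p).symm y))

/-- The coordinate expression of the `i`-th form. -/
def SpanningFields.ξChart (i : ι) (p : N) (y : E) : E →L[ℝ] ℂ :=
  (P.ξ i ((extChartAt 𝓘(ℝ, E) p).symm y)).comp (ofChart E p ((extChartAt 𝓘(ℝ, E) p).symm y))

lemma SpanningFields.rep_X (i : ι) {p : N} {z : ℝ × ℝ} (hz : u z.1 z.2 ∈ (chartAt E p).source) :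
    rep u p (fun t x => P.X i (u t x)) z = P.XChart i p (coord E u p z) := by
  rw [XChart, coord, (extChartAt 𝓘(ℝ, E) p).left_inv (by rwa [extChartAt_source])]
  rfl

lemma SpanningFields.ξ_apply (i : ι) {p : N} {z : ℝ × ℝ} (hz : u z.1 z.2 ∈ (chartAt E p).source)
    (V : ℝ → ℝ → E) :
    P.ξ i (u z.1 z.2) (V z.1 z.2) = P.ξChart i p (coord E u p z) (rep u p V z) := by
  rw [ξChart, coord, (extChartAt 𝓘(ℝ, E) p).left_inv (by rwa [extChartAt_source]), rep,
    ContinuousLinearMap.comp_apply, ofChart_toChart hz]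

variable (hu : SmoothMap E u Ω)
include hu

lemma SmoothMap.smooth_X (i : ι) : SmoothField u Ω (fun t x => P.X i (u t x)) := by
  intro z hz p hp
  have h1 := (P.smooth_X i p).contDiffAt ((isOpen_extChartAt_target p).mem_nhds (coord_mem hp))
  refine (h1.comp z (hu.contDiffAt_coord hz hp)).congr_of_eventuallyEq ?_
  filter_upwards [hu.eventually_source hz hp] with z' hz' using P.rep_X i hz'.2

lemma SmoothMap.smooth_ξ (i : ι) {V : ℝ → ℝ → E} (hV : SmoothField u Ω V) {z : ℝ × ℝ} (hz : z ∈ Ω) :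
    ContDiffAt ℝ ∞ (fun z : ℝ × ℝ => P.ξ i (u z.1 z.2) (V z.1 z.2)) z := by
  have hp := mem_chart_source E (u z.1 z.2)
  have h1 := (P.smooth_ξ i (u z.1 z.2)).contDiffAt
    ((isOpen_extChartAt_target _).mem_nhds (coord_mem hp))
  refine ((h1.comp z (hu.contDiffAt_coord hz hp)).clm_apply
    (hV z hz _ hp)).congr_of_eventuallyEq ?_
  filter_upwards [hu.eventually_source hz hp] with z' hz' using P.ξ_apply i hz'.2 V

end Spanning

end KahlerFlow
end

noncomputable section
namespace KahlerFlow

/-! ### Parallel fields with prescribed value at `x = -∞` -/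

section Parallel

set_option maxSynthPendingDepth 3
set_option linter.unusedSectionVars false

open Set Filter

variable {E : Type*} [NormedAddCommGroup E] [NormedSpace ℂ E] [FiniteDimensional ℂ E]
  {N : Type*} [TopologicalSpace N] [ChartedSpace E N] [IsManifold 𝓘(ℂ, E) ω N]
  {h : RMetric E N} {I : Set ℝ} {uinf : N} {u : ℝ → ℝ → N} {κ : Type*}

lemma tendsto_tangentBundle_iff {γ : ℝ → N} {V : ℝ → E} {p : N} {w : E} {l : Filter ℝ} :
    Tendsto (fun x => (⟨γ x, V x⟩ : TangentBundle 𝓘(ℝ, E) N)) l (𝓝 ⟨p, w⟩) ↔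
      Tendsto γ l (𝓝 p) ∧ Tendsto (fun x => toChart E p (γ x) (V x)) l (𝓝 w) := by
  rw [(trivializationAt E (TangentSpace 𝓘(ℝ, E)) p).tendsto_nhds_iff (by
    rw [TangentBundle.trivializationAt_source]; exact mem_chart_source E p)]
  simp only [trivializationAt_snd, toChart_self]
  rfl

lemma tendsto_clm_apply {F F' : Type*} [NormedAddCommGroup F] [NormedSpace ℝ F]
    [NormedAddCommGroup F'] [NormedSpace ℝ F'] {l : Filter ℝ} {L : ℝ → F →L[ℝ] F'} {v : ℝ → F}
    {L₀ : F →L[ℝ] F'} {v₀ : F} (hL : Tendsto L l (𝓝 L₀)) (hv : Tendsto v l (𝓝 v₀)) :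
    Tendsto (fun x => L x (v x)) l (𝓝 (L₀ v₀)) :=
  (isBoundedBilinearMap_apply.continuous.tendsto (L₀, v₀)).comp (hL.prodMk_nhds hv)

variable (hu : DecayingMap h I uinf u)
include hu

lemma DecayingMap.eventually_mem_source {t : ℝ} (ht : t ∈ I) :
    ∀ᶠ x in atBot, u t x ∈ (chartAt E uinf).source :=
  (hu.tendsto t ht).eventually ((chartAt E uinf).open_source.mem_nhds (mem_chart_source E uinf))

lemma DecayingMap.tendsto_inner {V W : ℝ → ℝ → E} {t : ℝ} (ht : t ∈ I) {v w : E}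
    (hV : Tendsto (fun x => rep u uinf V (t, x)) atBot (𝓝 v))
    (hW : Tendsto (fun x => rep u uinf W (t, x)) atBot (𝓝 w)) :
    Tendsto (fun x => metricAt h (u t x) (V t x) (W t x)) atBot (𝓝 (metricAt h uinf v w)) := by
  have h1 := ((isLocalMetric_metricInChart h uinf).contDiffAt
    (mem_extChartAt_target uinf)).continuousAt.tendsto.comp (hu.tendsto_coord ht)
  have h2 := tendsto_clm_apply (tendsto_clm_apply h1 hV) hW
  have h3 := metricAt_eq h (mem_chart_source E uinf) v w
  rw [toChart_self, toChart_self] at h3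
  rw [h3]
  refine h2.congr' ?_
  filter_upwards [hu.eventually_mem_source ht] with x hx
  exact (metricAt_eq h hx _ _).symm

lemma DecayingMap.tendsto_zero [T2Space N] {Y : κ → ℝ → ℝ → E}
    (hY : ∀ k, SmoothField u (I ×ˢ univ) (Y k)) {f : ℝ × ℝ → ℂ}
    (hf : JetPoly (hu.jets hY) true f)
    (hYb : ∀ k, ∃ C, ∀ z ∈ I ×ˢ (univ : Set ℝ),
      metricAt h (u z.1 z.2) (Y k z.1 z.2) (Y k z.1 z.2) ≤ C)
    {t : ℝ} (ht : t ∈ I) : Tendsto (fun x => f (t, x)) atBot (𝓝 0) := by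
  obtain ⟨S, hS, -, -, x₀, C, -, hC⟩ := hu.exists_bound hY hf hYb ht
  have h1 : Tendsto (fun x : ℝ => C * (1 + x ^ 2)⁻¹) atBot (𝓝 0) := by
    have h2 : Tendsto (fun x : ℝ => 1 + x ^ 2) atBot atTop := by
      refine tendsto_atTop_add_const_left _ _ ?_
      exact (tendsto_pow_atTop two_ne_zero).comp tendsto_abs_atBot_atTop |>.congr fun x => sq_abs x
    simpa using (tendsto_inv_atTop_zero.comp h2).const_mul C
  refine squeeze_zero_norm' ?_ h1
  filter_upwards [eventually_le_atBot x₀] with x hx using (hC t (mem_of_mem_nhds hS) x hx).2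

lemma DecayingMap.tendsto_zero_vec [T2Space N] {Y : κ → ℝ → ℝ → E}
    (hY : ∀ k, SmoothField u (I ×ˢ univ) (Y k)) {f : ℝ × ℝ → E}
    (hf : JetVec (hu.jets hY) true f)
    (hYb : ∀ k, ∃ C, ∀ z ∈ I ×ˢ (univ : Set ℝ),
      metricAt h (u z.1 z.2) (Y k z.1 z.2) (Y k z.1 z.2) ≤ C)
    {t : ℝ} (ht : t ∈ I) : Tendsto (fun x => f (t, x)) atBot (𝓝 0) := by
  have h1 : Tendsto (fun x => ∑ i, (JetPoly.coordL E i (f (t, x))).re • Module.finBasis ℝ E i) atBot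
      (𝓝 (∑ i, (0 : ℂ).re • Module.finBasis ℝ E i)) :=
    tendsto_finsetSum _ fun i _ => ((Complex.continuous_re.tendsto 0).comp
      (hu.tendsto_zero hY (hf (JetPoly.coordL E i)) hYb ht)).smul_const _
  simp only [Complex.zero_re, zero_smul, Finset.sum_const_zero] at h1
  exact h1.congr fun x => (Module.finBasis ℝ E).sum_repr (f (t, x))

/-- The inner product of parallel fields is constant. -/
lemma DecayingMap.inner_of_parallel {V W : ℝ → ℝ → E} (hV : SmoothField u (I ×ˢ univ) V)
    (hW : SmoothField u (I ×ˢ univ) W) {t : ℝ} (ht : t ∈ I) {v w : E}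
    (hpV : ∀ x, nab h u (0, 1) V t x = 0) (hpW : ∀ x, nab h u (0, 1) W t x = 0)
    (hVl : Tendsto (fun x => rep u uinf V (t, x)) atBot (𝓝 v))
    (hWl : Tendsto (fun x => rep u uinf W (t, x)) atBot (𝓝 w)) (x : ℝ) :
    metricAt h (u t x) (V t x) (W t x) = metricAt h uinf v w := by
  have hd : ∀ x, HasDerivAt (fun x => metricAt h (u t x) (V t x) (W t x)) 0 x := by
    intro x
    have h1 := deriv_slice (z := (t, x)) (differentiableAt_of_smooth
      (hu.map.contDiffAt_inner h hV hW (hu.mem ht)))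
    rw [hu.map.fderiv_inner h hV hW (hu.mem ht), hpV, hpW] at h1
    simpa using h1
  have hc := is_const_of_deriv_eq_zero (fun x => (hd x).differentiableAt) (fun x => (hd x).deriv)
  have hl := hu.tendsto_inner ht hVl hWl
  exact tendsto_nhds_unique (tendsto_const_nhds.congr fun y => hc x y) hl

/-- The difference is parallel, so its norm is constant in x, and this constant equals the limit 0
at −∞. -/
lemma DecayingMap.eq_of_parallel (hK : IsKahler h) {V W : ℝ → ℝ → E}
    (hV : SmoothField u (I ×ˢ univ) V)
    (hW : SmoothField u (I ×ˢ univ) W) {t : ℝ} (ht : t ∈ I) {w : E}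
    (hpV : ∀ x, nab h u (0, 1) V t x = 0) (hpW : ∀ x, nab h u (0, 1) W t x = 0)
    (hVl : Tendsto (fun x => rep u uinf V (t, x)) atBot (𝓝 w))
    (hWl : Tendsto (fun x => rep u uinf W (t, x)) atBot (𝓝 w)) (x : ℝ) : V t x = W t x := by
  have h1 := hu.map.smooth_const_smul (-1) hW
  have hD := hV.add h1
  have hDp : ∀ x, nab h u (0, 1) (fun t x => V t x + (-1 : ℂ) • W t x) t x = 0 := by
    intro x
    have := hu.map.nab_add h hV h1 (hu.mem (x := x) ht) (0, 1)
    rw [hu.map.nab_const_smul h hK _ hW (hu.mem ht), hpV, hpW] at this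
    simpa using this
  have hl : Tendsto (fun x => rep u uinf (fun t x => V t x + (-1 : ℂ) • W t x) (t, x)) atBot
      (𝓝 0) := by
    have := hVl.sub hWl
    rw [sub_self] at this
    refine this.congr fun x => ?_
    simp [rep, sub_eq_add_neg]
  have h2 := hu.inner_of_parallel hD hD ht hDp hDp hl hl x
  by_contra hne
  have h3 := metricAt_pos h (u t x) (V t x + (-1 : ℂ) • W t x) (by
    rw [neg_smul, one_smul, ← sub_eq_add_neg]
    exact sub_ne_zero.2 hne)
  rw [h2] at h3
  simp at h3

variable {Y : κ → ℝ → ℝ → E} (hY : ∀ k, SmoothField u (I ×ˢ univ) (Y k))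

/-- Even if V is merely bounded, ∇_x V decays: in the chart each term of ∂_x V + Γ(u_x, V) contains
a jet of u. -/
lemma DecayingMap.jetVec_nab (hYp : ∀ k, ∀ z ∈ I ×ˢ (univ : Set ℝ), nab h u (0, 1) (Y k) z.1 z.2 = 0)
    {V : ℝ → ℝ → E} (hV : SmoothField u (I ×ˢ univ) V) {b : Bool}
    (hVj : JetVec (hu.jets hY) b (rep u uinf V)) :
    JetVec (hu.jets hY) true (rep u uinf (nab h u (0, 1) V)) := by
  have h1 := JetVec.fderiv (hu.jetVec_deriv_coord hY) (hu.jetVec_deriv_jet hY)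
    (fun k => hu.jetVec_deriv_parallel hY (hYp k)) hVj
  have h2 := JetVec.form₂ (D := hu.jets hY) (contDiffOn_chartChr h uinf) (JetVec.jet 0) hVj
  refine (h1.add h2).congr fun z hz => ?_
  rw [hu.map.rep_nab h hV hz.1 hz.2, localCov, hu.fderiv_coord hY hz]
  rfl

lemma DecayingMap.jetPoly_ξ {ι : Type*} [Fintype ι] (P : SpanningFields E N ι) (i : ι)
    {V : ℝ → ℝ → E} {b : Bool} (hVj : JetVec (hu.jets hY) b (rep u uinf V)) :
    JetPoly (hu.jets hY) b (fun z => P.ξ i (u z.1 z.2) (V z.1 z.2)) := by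
  refine (JetPoly.form₁ (D := hu.jets hY) (P.smooth_ξ i uinf) hVj).congr fun z hz => ?_
  exact P.ξ_apply i hz.2 V

lemma DecayingMap.jetVec_X {ι : Type*} [Fintype ι] (P : SpanningFields E N ι) (i : ι) :
    JetVec (hu.jets hY) false (rep u uinf (fun t x => P.X i (u t x))) :=
  (JetVec.base (D := hu.jets hY) (P.smooth_X i uinf)).congr fun _ hz => P.rep_X i hz.2

end Parallel

/-! ### The linear system for the coefficients -/

section Coefficients

set_option maxSynthPendingDepth 3
set_option linter.unusedSectionVars false

open Set Filter

/-- A matrix as a continuous linear map. -/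
def matrixL (ι : Type*) [Fintype ι] : (ι → ι → ℂ) →L[ℝ] (ι → ℂ) →L[ℝ] (ι → ℂ) :=
  LinearMap.toContinuousLinearMap
    { toFun := fun m => LinearMap.toContinuousLinearMap
        { toFun := fun c i => ∑ j, m i j * c j
          map_add' := fun c c' => by funext i; simp [mul_add, Finset.sum_add_distrib]
          map_smul' := fun r c => by funext i; simp [Finset.mul_sum, mul_left_comm] }
      map_add' := fun m m' => by ext c i; simp [add_mul, Finset.sum_add_distrib]
      map_smul' := fun r m => by ext c i; simp [Finset.mul_sum, mul_assoc] }

/-- The iterated time derivative. -/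
def timeDeriv (k : ℕ) (f : ℝ × ℝ → ℂ) : ℝ × ℝ → ℂ :=
  (fun g z => fderiv ℝ g z (1, 0))^[k] f

lemma timeDeriv_succ (k : ℕ) (f : ℝ × ℝ → ℂ) (z : ℝ × ℝ) :
    timeDeriv (k + 1) f z = fderiv ℝ (timeDeriv k f) z (1, 0) := by
  rw [timeDeriv, Function.iterate_succ']
  rfl

lemma contDiffAt_timeDeriv {Ω : Set (ℝ × ℝ)} {f : ℝ × ℝ → ℂ} (hf : ∀ z ∈ Ω, ContDiffAt ℝ ∞ f z)
    (k : ℕ) : ∀ z ∈ Ω, ContDiffAt ℝ ∞ (timeDeriv k f) z := by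
  induction k with
  | zero => exact hf
  | succ k ih =>
    intro z hz
    have : timeDeriv (k + 1) f = fun z => fderiv ℝ (timeDeriv k f) z (1, 0) :=
      funext fun z => timeDeriv_succ k f z
    rw [this]
    exact (contDiffAt_fderiv (ih z hz)).clm_apply contDiffAt_const

lemma isSmoothCoeff_matrix {ι : Type*} [Fintype ι] {I : Set ℝ}
    {m : ι → ι → ℝ × ℝ → ℂ} (hm : ∀ i j, ∀ z ∈ I ×ˢ (univ : Set ℝ), ContDiffAt ℝ ∞ (m i j) z)
    (hd : ∀ k i j, DecaysAtBot I (fun t x => timeDeriv k (m i j) (t, x))) :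
    IsSmoothCoeff I (fun k t x => matrixL ι (fun i j => timeDeriv k (m i j) (t, x))) where
  smooth k := by
    refine (matrixL ι).contDiff.comp_contDiffOn ?_
    refine contDiffOn_pi.2 fun i => contDiffOn_pi.2 fun j => ?_
    exact fun z hz => (contDiffAt_timeDeriv (hm i j) k z hz).contDiffWithinAt
  deriv k t ht x := by
    refine (matrixL ι).hasFDerivAt.comp_hasDerivAt t ?_
    refine hasDerivAt_pi.2 fun i => hasDerivAt_pi.2 fun j => ?_
    rw [timeDeriv_succ]
    exact deriv_slice_left (z := (t, x)) (differentiableAt_of_smooth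
      (contDiffAt_timeDeriv (hm i j) k _ ⟨ht, mem_univ _⟩))
  decays k := by
    intro t₀ ht₀ X
    choose C hC0 hC using fun i j => hd k i j t₀ ht₀ X
    have hS : 0 ≤ ∑ i, ∑ j, C i j := Finset.sum_nonneg fun i _ => Finset.sum_nonneg fun j _ => hC0 i j
    refine ⟨‖matrixL ι‖ * ∑ i, ∑ j, C i j, by positivity, ?_⟩
    filter_upwards [eventually_all.2 fun i => eventually_all.2 fun j => hC i j] with t ht x hx
    rw [mul_assoc]
    refine ((matrixL ι).le_opNorm _).trans (mul_le_mul_of_nonneg_left ?_ (norm_nonneg _))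
    have hp : (0 : ℝ) ≤ (1 + x ^ 2)⁻¹ := by positivity
    refine (pi_norm_le_iff_of_nonneg (mul_nonneg hS hp)).2 fun i =>
      (pi_norm_le_iff_of_nonneg (mul_nonneg hS hp)).2 fun j => ?_
    refine (ht i j x hx).trans (mul_le_mul_of_nonneg_right ?_ hp)
    exact (Finset.single_le_sum (f := fun j => C i j) (fun j _ => hC0 i j) (Finset.mem_univ j)).trans
      (Finset.single_le_sum (f := fun i => ∑ j, C i j)
        (fun i _ => Finset.sum_nonneg fun j _ => hC0 i j) (Finset.mem_univ i))

variable {E : Type*} [NormedAddCommGroup E] [NormedSpace ℂ E] [FiniteDimensional ℂ E]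
  {N : Type*} [TopologicalSpace N] [ChartedSpace E N] [IsManifold 𝓘(ℂ, E) ω N]
  {h : RMetric E N} {I : Set ℝ} {uinf : N} {u : ℝ → ℝ → N}

/-- A combination Σ c_i X_i(u) is parallel as soon as c solves c_x = mc, where −m_ij = ξ_i(∇_x X_j)
are coefficients of ∇_x X_j in the spanning family. The X_i need not be independent, since any such
solution c serves. The last clause, ∇_t V → 0, later fixes the constant of integration of the
connection form. -/
theorem DecayingMap.exists_parallel [T2Space N] [CompactSpace N] (hu : DecayingMap h I uinf u)
    (hK : IsKahler h) {a lam b c : ℝ} (hflow : ∀ z ∈ I ×ˢ (univ : Set ℝ),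
      vel E u (1, 0) z.1 z.2 = flowField h a lam b c u z.1 z.2) (w : E) :
    ∃ V : ℝ → ℝ → E, SmoothField u (I ×ˢ univ) V ∧ (∀ t ∈ I, ∀ x, nab h u (0, 1) V t x = 0) ∧
      (∀ t ∈ I, Tendsto (fun x => rep u uinf V (t, x)) atBot (𝓝 w)) ∧
      ∀ t ∈ I, Tendsto (fun x => rep u uinf (nab h u (1, 0) V) (t, x)) atBot (𝓝 0) := by
  obtain ⟨s, ⟨P⟩⟩ := exists_spanningFields (E := E) (N := N)
  set ι := s × Fin (Module.finrank ℂ E)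
  -- The coefficients of the system involve only u and fixed fields on N, so no bounded fields along
  -- u are adjoined.
  set Y : Empty → ℝ → ℝ → E := fun k => k.elim
  have hY : ∀ k, SmoothField u (I ×ˢ univ) (Y k) := fun k => k.elim
  set D := hu.jets hY
  have hX := fun i => hu.map.smooth_X P i
  have hXn := fun i => hu.map.smooth_nab h (hX i) (0, 1)
  set m : ι → ι → ℝ × ℝ → ℂ := fun i j z =>
    -P.ξ i (u z.1 z.2) (nab h u (0, 1) (fun t x => P.X j (u t x)) z.1 z.2) with hm
  have hms : ∀ i j, ∀ z ∈ I ×ˢ (univ : Set ℝ), ContDiffAt ℝ ∞ (m i j) z := fun i j z hz =>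
    (hu.map.smooth_ξ P i (hXn j) hz).neg
  have hmj : ∀ k i j, JetPoly D true (timeDeriv k (m i j)) := by
    intro k i j
    induction k with
    | zero =>
      exact (hu.jetPoly_ξ hY P i (hu.jetVec_nab hY (fun k => k.elim) (hX j)
        (hu.jetVec_X hY P j))).neg
    | succ k ih =>
      have h1 := JetPoly.fderiv (hu.jetVec_time_coord hY hflow) (hu.jetVec_time_jet hflow hY)
        (fun k => k.elim) ih
      exact h1.congr fun z _ => timeDeriv_succ k (m i j) z
  have hB := isSmoothCoeff_matrix hms fun k i j => hu.decaysAtBot hY (hmj k i j)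
    (fun k => k.elim) fun z hz => (contDiffAt_timeDeriv (hms i j) k z hz).continuousAt.continuousWithinAt
  -- The data at −∞ are the coefficients of w in the spanning family at u^∞, so that V → w.
  obtain ⟨c, c', hcs, hcx, hcl, hct, hcl'⟩ := exists_smooth_solution hu.isOpen hB
    (fun i => P.ξ i uinf w)
  have hΩ := hu.map.isOpen
  have hcs' : ∀ i, ∀ z ∈ I ×ˢ (univ : Set ℝ), ContDiffAt ℝ ∞ (fun z : ℝ × ℝ => c z.1 z.2 i) z :=
    fun i z hz => contDiffAt_pi.1 (hcs.contDiffAt (hΩ.mem_nhds hz)) i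
  have hsm := fun i => hu.map.smooth_smul (hcs' i) (hX i)
  have hnab : ∀ z ∈ I ×ˢ (univ : Set ℝ), ∀ d, nab h u d (fun t x => ∑ i, c t x i • P.X i (u t x))
      z.1 z.2 = ∑ i, (fderiv ℝ (fun z : ℝ × ℝ => c z.1 z.2 i) z d • P.X i (u z.1 z.2)
        + c z.1 z.2 i • nab h u d (fun t x => P.X i (u t x)) z.1 z.2) := by
    intro z hz d
    rw [hu.map.nab_sum h Finset.univ (fun i _ => hsm i) hz]
    exact Finset.sum_congr rfl fun i _ => hu.map.nab_smul h hK (hcs' i z hz) (hX i) hz d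
  have hXl : ∀ t ∈ I, ∀ i, Tendsto (fun x => P.XChart i uinf (coord E u uinf (t, x))) atBot
      (𝓝 (P.X i uinf)) := by
    intro t ht i
    have h1 := ((P.smooth_X i uinf).contDiffAt ((isOpen_extChartAt_target uinf).mem_nhds
      (mem_extChartAt_target uinf))).continuousAt.tendsto.comp (hu.tendsto_coord ht)
    have h2 : (extChartAt 𝓘(ℝ, E) uinf).symm (extChartAt 𝓘(ℝ, E) uinf uinf) = uinf :=
      (extChartAt 𝓘(ℝ, E) uinf).left_inv (mem_extChartAt_source uinf)
    rw [h2, toChart_self] at h1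
    exact h1
  refine ⟨fun t x => ∑ i, c t x i • P.X i (u t x), SmoothField.sum _ fun i _ => hsm i, ?_, ?_, ?_⟩
  · intro t ht x
    have h0 := hnab (t, x) (hu.mem ht) (0, 1)
    rw [h0, Finset.sum_add_distrib]
    have h1 : ∀ i, fderiv ℝ (fun z : ℝ × ℝ => c z.1 z.2 i) (t, x) (0, 1) =
        ∑ j, m i j (t, x) * c t x j := by
      intro i
      have e1 := deriv_slice (differentiableAt_of_smooth (hcs' i (t, x) (hu.mem ht)))
      exact e1.unique (hasDerivAt_pi.1 (hcx t ht x) i)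
    simp only [h1, Finset.sum_smul]
    rw [Finset.sum_comm, ← Finset.sum_add_distrib]
    refine Finset.sum_eq_zero fun j _ => ?_
    -- Expanding ∇_x X_j in the spanning family, its coefficients cancel those of c_x one by one.
    conv_lhs => rw [← P.sum_eq (u t x) (nab h u (0, 1) (fun t x => P.X j (u t x)) t x)]
    rw [Finset.smul_sum, ← Finset.sum_add_distrib]
    refine Finset.sum_eq_zero fun i _ => ?_
    rw [smul_smul, ← add_smul]
    simp only [hm]
    rw [show ∀ a b : ℂ, -a * b + b * a = 0 from fun a b => by ring, zero_smul]
  · intro t ht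
    have h1 : Tendsto (fun x => ∑ i, c t x i • P.XChart i uinf (coord E u uinf (t, x))) atBot
        (𝓝 (∑ i, P.ξ i uinf w • P.X i uinf)) :=
      tendsto_finsetSum _ fun i _ => ((tendsto_pi_nhds.1 (hcl t ht)) i).smul (hXl t ht i)
    rw [P.sum_eq] at h1
    refine h1.congr' ?_
    filter_upwards [hu.eventually_mem_source ht] with x hx
    simp only [rep, map_sum, toChart_smul hx]
    exact Finset.sum_congr rfl fun i _ => by rw [← P.rep_X i (z := (t, x)) hx]; rfl
  · intro t ht
    have hvt : Tendsto (fun x => rep u uinf (vel E u (1, 0)) (t, x)) atBot (𝓝 0) := by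
      refine hu.tendsto_zero_vec hY ?_ (fun k => k.elim) ht
      exact (hu.jetVec_time_coord hY hflow).congr fun z hz => hu.map.rep_vel hz.1 hz.2 _
    have hsX : ∀ i, ContDiffAt ℝ ∞ (P.XChart i uinf) (extChartAt 𝓘(ℝ, E) uinf uinf) :=
      fun i => (P.smooth_X i uinf).contDiffAt ((isOpen_extChartAt_target uinf).mem_nhds
      (mem_extChartAt_target uinf))
    -- In the chart, ∇_t V is the sum of (∂_t c_i) X_i and of c_i times the covariant derivative of
    -- X_i in the direction u_t. Both tend to 0, since ∂_t c → 0 and u_t → 0 while the other factors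
    -- converge.
    have h1 : Tendsto (fun x => ∑ i, (c' t x i • P.XChart i uinf (coord E u uinf (t, x))
        + c t x i • (fderiv ℝ (P.XChart i uinf) (coord E u uinf (t, x))
            (rep u uinf (vel E u (1, 0)) (t, x))
          + chartChr h uinf (coord E u uinf (t, x)) (rep u uinf (vel E u (1, 0)) (t, x))
            (P.XChart i uinf (coord E u uinf (t, x)))))) atBot (𝓝 0) := by
      have h2 := fun i => tendsto_clm_apply
        ((contDiffAt_fderiv (hsX i)).continuousAt.tendsto.comp (hu.tendsto_coord ht)) hvt
      have h3 := fun i => tendsto_clm_apply (tendsto_clm_apply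
        ((contDiffAt_chartChr h (mem_extChartAt_target uinf)).continuousAt.tendsto.comp
          (hu.tendsto_coord ht)) hvt) (hXl t ht i)
      have h4 := fun i => ((tendsto_pi_nhds.1 (hcl' t ht) i).smul (hXl t ht i)).add
        (((tendsto_pi_nhds.1 (hcl t ht)) i).smul ((h2 i).add (h3 i)))
      have h5 := tendsto_finsetSum Finset.univ fun i _ => h4 i
      simpa using h5
    refine h1.congr' ?_
    filter_upwards [hu.eventually_mem_source ht] with x hx
    have hz := hu.mem (x := x) ht
    have h2 := hnab (t, x) hz (1, 0)
    conv_rhs => rw [rep, h2, map_sum]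
    refine Finset.sum_congr rfl fun i _ => ?_
    have h3 : fderiv ℝ (fun z : ℝ × ℝ => c z.1 z.2 i) (t, x) (1, 0) = c' t x i :=
      (deriv_slice_left (differentiableAt_of_smooth (hcs' i (t, x) hz))).unique
        (hasDerivAt_pi.1 (hct t ht x) i)
    have h4 := hu.map.rep_nab h (hX i) hz hx (1, 0)
    have h5 : rep u uinf (fun t x => P.X i (u t x)) =ᶠ[𝓝 (t, x)]
        fun z => P.XChart i uinf (coord E u uinf z) := by
      filter_upwards [hu.map.eventually_source hz hx] with z' hz' using P.rep_X i hz'.2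
    rw [localCov, h5.fderiv_eq, h5.self_of_nhds, fderiv_comp_apply (A := P.XChart i uinf)
      (differentiableAt_of_smooth
      ((P.smooth_X i uinf).contDiffAt ((isOpen_extChartAt_target uinf).mem_nhds (coord_mem hx))))
      (differentiableAt_of_smooth (hu.map.contDiffAt_coord hz hx)),
      ← hu.map.rep_vel hz hx] at h4
    have h6 := h5.self_of_nhds
    simp only [rep] at h4 h6 ⊢
    rw [h3, map_add, toChart_smul hx, toChart_smul hx, h4, h6]

end Coefficients

end KahlerFlow
end

noncomputable section
namespace KahlerFlow

/-! ### Algebra of the curvature of a Kähler manifold -/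

section Curvature

set_option maxSynthPendingDepth 3
set_option linter.unusedSectionVars false

open Set Filter

variable {E : Type*} [NormedAddCommGroup E] [NormedSpace ℂ E] [FiniteDimensional ℂ E]
  {N : Type*} [TopologicalSpace N] [ChartedSpace E N] [IsManifold 𝓘(ℂ, E) ω N]
  {h : RMetric E N} (hK : IsKahler h) (q : N)

lemma curvAt_eq_localCurv (X Y Z : E) : curvAt h q X Y Z =
    localCurv (chartChr h q) (extChartAt 𝓘(ℝ, E) q q) X Y Z := by
  have := curvAt_eq h (mem_chart_source E q) X Y Z
  simpa only [toChart_self] using this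

lemma curvAt_antisymm (X Y Z : E) : curvAt h q X Y Z = -curvAt h q Y X Z := by
  simp only [curvAt_eq_localCurv]
  exact localCurv_antisymm _ _ _ _ _

lemma curvAt_add_right (X Y Z Z' : E) :
    curvAt h q X Y (Z + Z') = curvAt h q X Y Z + curvAt h q X Y Z' := by
  simp only [curvAt_eq_localCurv]
  exact localCurv_add_right _ _ _ _ _ _

lemma curvAt_add_left (X X' Y Z : E) :
    curvAt h q (X + X') Y Z = curvAt h q X Y Z + curvAt h q X' Y Z := by
  simp only [curvAt_eq_localCurv]
  exact localCurv_add_left _ _ _ _ _ _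

lemma curvAt_add_mid (X Y Y' Z : E) :
    curvAt h q X (Y + Y') Z = curvAt h q X Y Z + curvAt h q X Y' Z := by
  rw [curvAt_antisymm, curvAt_add_left, neg_add, ← curvAt_antisymm, ← curvAt_antisymm]

lemma curvAt_smul_left (c : ℝ) (X Y Z : E) : curvAt h q (c • X) Y Z = c • curvAt h q X Y Z := by
  simp only [curvAt_eq_localCurv]
  exact localCurv_smul_left _ _ _ _ _ _

lemma curvAt_smul_right (c : ℝ) (X Y Z : E) : curvAt h q X Y (c • Z) = c • curvAt h q X Y Z := by
  simp only [curvAt_eq_localCurv]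
  exact localCurv_smul_right _ _ _ _ _ _

lemma curvAt_smul_mid (c : ℝ) (X Y Z : E) : curvAt h q X (c • Y) Z = c • curvAt h q X Y Z := by
  rw [curvAt_antisymm, curvAt_smul_left, curvAt_antisymm q X Y, smul_neg]

lemma I_smul_I_smul (v : E) : Complex.I • Complex.I • v = -v := by
  rw [smul_smul, Complex.I_mul_I, neg_smul, one_smul]

lemma curvAt_neg_mid (X Y Z : E) : curvAt h q X (-Y) Z = -curvAt h q X Y Z := by
  rw [← neg_one_smul ℝ Y, curvAt_smul_mid, neg_one_smul]

lemma curvAt_bianchi (X Y Z : E) :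
    curvAt h q X Y Z + curvAt h q Y Z X + curvAt h q Z X Y = 0 := by
  simp only [curvAt_eq_localCurv]
  exact (isLocalMetric_metricInChart h q).bianchi (mem_extChartAt_target q) X Y Z

include hK

lemma curvAt_I_right (X Y Z : E) :
    curvAt h q X Y (Complex.I • Z) = Complex.I • curvAt h q X Y Z := by
  simp only [curvAt_eq_localCurv]
  exact (isLocalMetric_metricInChart h q).curv_I_right (chartChr_I h hK q)
    (mem_extChartAt_target q) X Y Z

lemma curvAt_I_I (X Y Z : E) :
    curvAt h q (Complex.I • X) (Complex.I • Y) Z = curvAt h q X Y Z := by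
  simp only [curvAt_eq_localCurv]
  exact (isLocalMetric_metricInChart h q).curv_I_I (metricInChart_I h hK q) (chartChr_I h hK q)
    (mem_extChartAt_target q) X Y Z

lemma curvAt_I_left (X Y Z : E) :
    curvAt h q (Complex.I • X) Y Z = -curvAt h q X (Complex.I • Y) Z := by
  have h1 := curvAt_I_I hK q (Complex.I • X) Y Z
  rw [smul_smul, Complex.I_mul_I, ← Complex.ofReal_one, ← Complex.ofReal_neg, Complex.coe_smul,
    curvAt_smul_left, neg_smul, one_smul] at h1
  exact h1.symm

omit hK

/-- The part `½ (R(X, Y) Z + i R(X, i Y) Z)` of the curvature that is conjugate linear in `Y`. -/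
def curvPart (h : RMetric E N) (q : N) (X Y Z : E) : E :=
  (1 / 2 : ℂ) • (curvAt h q X Y Z + Complex.I • curvAt h q X (Complex.I • Y) Z)

lemma curvPart_add_left (X X' Y Z : E) :
    curvPart h q (X + X') Y Z = curvPart h q X Y Z + curvPart h q X' Y Z := by
  simp only [curvPart, curvAt_add_left, smul_add]
  abel

lemma curvPart_add_mid (X Y Y' Z : E) :
    curvPart h q X (Y + Y') Z = curvPart h q X Y Z + curvPart h q X Y' Z := by
  simp only [curvPart, curvAt_add_mid, smul_add]
  abel

lemma curvPart_add_right (X Y Z Z' : E) :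
    curvPart h q X Y (Z + Z') = curvPart h q X Y Z + curvPart h q X Y Z' := by
  simp only [curvPart, curvAt_add_right, smul_add]
  abel

lemma real_smul_comm (c : ℝ) (k : ℂ) (v : E) : k • (c • v) = c • (k • v) := smul_comm k c v

lemma curvPart_smul_left_real (c : ℝ) (X Y Z : E) :
    curvPart h q (c • X) Y Z = c • curvPart h q X Y Z := by
  simp only [curvPart, curvAt_smul_left, real_smul_comm, ← smul_add]

lemma curvPart_smul_mid_real (c : ℝ) (X Y Z : E) :
    curvPart h q X (c • Y) Z = c • curvPart h q X Y Z := by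
  simp only [curvPart, real_smul_comm, curvAt_smul_mid, ← smul_add]

lemma curvPart_smul_right_real (c : ℝ) (X Y Z : E) :
    curvPart h q X Y (c • Z) = c • curvPart h q X Y Z := by
  simp only [curvPart, curvAt_smul_right, real_smul_comm, ← smul_add]

/-- Real linear maps commuting with `i` are complex linear. -/
lemma map_smul_of_I {f : E → E} (k : ℂ) (hadd : ∀ v w, f (v + w) = f v + f w)
    (hreal : ∀ (c : ℝ) v, f (c • v) = c • f v) (hI : ∀ v, f (Complex.I • v) = k • f v) (c : ℂ)
    (v : E) : f (c • v) = ((c.re : ℂ) + c.im * k) • f v := by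
  conv_lhs => rw [← Complex.re_add_im c, add_smul, mul_smul, hadd, Complex.coe_smul,
    Complex.coe_smul, hreal, hreal, hI]
  rw [add_smul, mul_smul, Complex.coe_smul, Complex.coe_smul]

include hK

/-- Linearity over i rests on R(iX, Y) = −R(X, iY), a form of the invariance of the curvature under
J. -/
lemma curvPart_smul_left (c : ℂ) (X Y Z : E) :
    curvPart h q (c • X) Y Z = c • curvPart h q X Y Z := by
  have := map_smul_of_I (f := fun X => curvPart h q X Y Z) Complex.I
    (fun v w => curvPart_add_left q v w Y Z) (fun c v => curvPart_smul_left_real q c v Y Z)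
    (fun v => by
      simp only [curvPart, curvAt_I_left hK, I_smul_I_smul, curvAt_neg_mid, neg_neg, smul_add,
        smul_comm Complex.I (1 / 2 : ℂ)]
      abel) c X
  rwa [Complex.re_add_im] at this

lemma curvPart_smul_mid (c : ℂ) (X Y Z : E) :
    curvPart h q X (c • Y) Z = (starRingEnd ℂ) c • curvPart h q X Y Z := by
  have := map_smul_of_I (f := fun Y => curvPart h q X Y Z) (-Complex.I)
    (fun v w => curvPart_add_mid q X v w Z) (fun c v => curvPart_smul_mid_real q c X v Z)
    (fun v => by
      simp only [curvPart, I_smul_I_smul, curvAt_neg_mid, smul_add, neg_smul, smul_neg,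
        smul_comm Complex.I (1 / 2 : ℂ), neg_neg]
      abel) c Y
  rw [this]
  congr 1
  apply Complex.ext <;> simp

lemma curvPart_smul_right (c : ℂ) (X Y Z : E) :
    curvPart h q X Y (c • Z) = c • curvPart h q X Y Z := by
  have := map_smul_of_I (f := fun Z => curvPart h q X Y Z) Complex.I
    (fun v w => curvPart_add_right q X Y v w) (fun c v => curvPart_smul_right_real q c X Y v)
    (fun v => by
      simp only [curvPart, curvAt_I_right hK]
      module) c Z
  rwa [Complex.re_add_im] at this

/-- The Bianchi identities for (X, Y, Z) and (X, iY, Z) exchange X and Z up to the terms R(Z,X)Y and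
iR(Z,X)Y, which cancel in the combination defining P because i² = −1. -/
lemma curvPart_symm (X Y Z : E) : curvPart h q X Y Z = curvPart h q Z Y X := by
  have h1 := curvAt_bianchi (h := h) q X Y Z
  have h2 := curvAt_bianchi (h := h) q X (Complex.I • Y) Z
  rw [curvAt_I_right hK, curvAt_antisymm q (Complex.I • Y) Z X] at h2
  rw [curvAt_antisymm q Y Z X] at h1
  have e1 : curvAt h q X Y Z = curvAt h q Z Y X - curvAt h q Z X Y := by
    rw [eq_sub_iff_add_eq, ← sub_eq_zero, ← h1]; abel
  have e2 : curvAt h q X (Complex.I • Y) Z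
      = curvAt h q Z (Complex.I • Y) X - Complex.I • curvAt h q Z X Y := by
    rw [eq_sub_iff_add_eq, ← sub_eq_zero, ← h2]; abel
  rw [curvPart, e1, e2, smul_sub, smul_smul, Complex.I_mul_I, curvPart]
  module

/-- The expression R(X, iY)Z is symmetric in X and Y, so the terms with factor i cancel in the
difference. This splitting turns each curvature term of the equation into components of S. -/
lemma curvAt_eq_sub (X Y Z : E) :
    curvAt h q X Y Z = curvPart h q X Y Z - curvPart h q Y X Z := by
  have h1 : curvAt h q Y (Complex.I • X) Z = curvAt h q X (Complex.I • Y) Z := by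
    rw [curvAt_antisymm, curvAt_I_left hK, neg_neg]
  rw [curvPart, curvPart, h1, curvAt_antisymm q Y X]
  module

omit hK

/-- The complex component `⟨V⟩_e` of `V` along `e`, as a real linear functional of `V`. -/
def compAt (h : RMetric E N) (q : N) (V e : E) : ℂ :=
  (metricAt h q V e : ℂ) + Complex.I * (metricAt h q V (Complex.I • e) : ℂ)

lemma compAt_add (V W e : E) : compAt h q (V + W) e = compAt h q V e + compAt h q W e := by
  simp only [compAt, map_add, add_apply]
  push_cast
  ring

include hK

lemma metricAt_I_left (V W : E) :
    metricAt h q (Complex.I • V) W = -metricAt h q V (Complex.I • W) := by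
  have h1 := metricAt_I h hK q (Complex.I • V) W
  rw [smul_smul, Complex.I_mul_I, neg_smul, one_smul, map_neg, neg_apply] at h1
  exact h1.symm

lemma compAt_smul (c : ℂ) (V e : E) : compAt h q (c • V) e = c * compAt h q V e := by
  have hr : ∀ (r : ℝ) (V : E), compAt h q ((r : ℂ) • V) e = r * compAt h q V e := by
    intro r V
    rw [Complex.coe_smul]
    simp only [compAt, map_smul, smul_apply, smul_eq_mul]
    push_cast
    ring
  have hI : ∀ V : E, compAt h q (Complex.I • V) e = Complex.I * compAt h q V e := by
    intro V
    rw [compAt, metricAt_I_left hK, metricAt_I h hK, compAt]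
    push_cast
    linear_combination (-(metricAt h q V (Complex.I • e) : ℂ)) * Complex.I_mul_I
  conv_lhs => rw [← Complex.re_add_im c, add_smul, mul_smul, compAt_add, hr, hr, hI]
  conv_rhs => rw [← Complex.re_add_im c]
  ring

/-- `⟨·⟩_e` as a complex linear functional. -/
def compL (e : E) : E →ₗ[ℂ] ℂ where
  toFun V := compAt h q V e
  map_add' V W := compAt_add q V W e
  map_smul' c V := compAt_smul hK q c V e

/-- Expansion of vectors in a unitary frame. -/
lemma sum_compAt_smul {n : ℕ} (hn : Module.finrank ℂ E = n) {e : Fin n → E}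
    (he : ∀ i j, compAt h q (e i) (e j) = if i = j then 1 else 0) (V : E) :
    ∑ p, compAt h q V (e p) • e p = V := by
  have hs : ∀ (c : Fin n → ℂ) j, compAt h q (∑ p, c p • e p) (e j) = c j := by
    intro c j
    change compL hK q (e j) _ = _
    rw [map_sum, Finset.sum_eq_single j]
    · rw [map_smul]
      change c j • compAt h q (e j) (e j) = _
      simp [he]
    · intro i _ hij
      rw [map_smul]
      change c i • compAt h q (e i) (e j) = _
      simp [he, hij]
    · simp
  have hli : LinearIndependent ℂ e := by
    refine Fintype.linearIndependent_iff.2 fun c hc i => ?_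
    rw [← hs c i, hc]
    exact map_zero (compL hK q (e i))
  -- The construction of a basis from n independent vectors needs a nonempty index set, so dimension
  -- 0 is treated apart.
  rcases n.eq_zero_or_pos with rfl | hpos
  · have : Subsingleton E := Module.finrank_zero_iff.1 hn
    exact Subsingleton.elim _ _
  have : Nonempty (Fin n) := ⟨⟨0, hpos⟩⟩
  set B := basisOfLinearIndependentOfCardEqFinrank hli (by simp [hn])
  have hB : ∀ i, B i = e i := fun i => by simp [B]
  have hV : V = ∑ p, B.repr V p • e p := by
    conv_lhs => rw [← B.sum_repr V]
    simp only [hB]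
  have hc : ∀ p, compAt h q V (e p) = B.repr V p := fun p => by
    conv_lhs => rw [hV]
    exact hs _ p
  simp only [hc]
  exact hV.symm

/-- The components of the curvature part of three vectors. -/
lemma compAt_curvPart {n : ℕ} {e : Fin n → E} (x y z : Fin n → ℂ) (f : E) :
    compAt h q (curvPart h q (∑ p, x p • e p) (∑ p, y p • e p) (∑ r, z r • e r)) f =
      ∑ p, ∑ s, ∑ r, compAt h q (curvPart h q (e p) (e s) (e r)) f * x p
        * (starRingEnd ℂ) (y s) * z r := by
  -- Only additivity is bundled, because the middle slot is conjugate linear; the scalars are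
  -- extracted after the sums have been pulled out.
  let A : E →+ E →+ E →+ ℂ :=
    AddMonoidHom.mk' (fun X => AddMonoidHom.mk' (fun Y => AddMonoidHom.mk'
      (fun Z => compAt h q (curvPart h q X Y Z) f)
      (fun Z Z' => by rw [curvPart_add_right, compAt_add]))
      (fun Y Y' => by
        ext Z
        exact (congrArg (compAt h q · f) (curvPart_add_mid q X Y Y' Z)).trans
          (compAt_add _ _ _ _)))
      (fun X X' => by
        ext Y Z
        exact (congrArg (compAt h q · f) (curvPart_add_left q X X' Y Z)).trans
          (compAt_add _ _ _ _))
  change A (∑ p, x p • e p) (∑ p, y p • e p) (∑ r, z r • e r) = _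
  rw [map_sum A, AddMonoidHom.finsetSum_apply, AddMonoidHom.finsetSum_apply]
  refine Finset.sum_congr rfl fun p _ => ?_
  rw [map_sum (A _), AddMonoidHom.finsetSum_apply]
  refine Finset.sum_congr rfl fun s _ => ?_
  rw [map_sum]
  refine Finset.sum_congr rfl fun r _ => ?_
  change compAt h q (curvPart h q _ _ _) f = _
  rw [curvPart_smul_left hK, curvPart_smul_mid hK, curvPart_smul_right hK, compAt_smul hK,
    compAt_smul hK, compAt_smul hK]
  ring

end Curvature

end KahlerFlow
end

noncomputable section
namespace KahlerFlow

/-! ### Components of fields in a parallel frame -/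

section Components

set_option maxSynthPendingDepth 3
set_option linter.unusedSectionVars false

open Set Filter MeasureTheory

variable {E : Type*} [NormedAddCommGroup E] [NormedSpace ℂ E] [FiniteDimensional ℂ E]
  {N : Type*} [TopologicalSpace N] [ChartedSpace E N] [IsManifold 𝓘(ℂ, E) ω N]
  {h : RMetric E N} {I : Set ℝ} {uinf : N} {u : ℝ → ℝ → N} {κ : Type*}

/-- Smooth functions on `I × ℝ` which are polynomials in the jets near `x = -∞`. -/
structure FlowFn (hu : DecayingMap h I uinf u) {Y : κ → ℝ → ℝ → E}
    (hY : ∀ k, SmoothField u (I ×ˢ univ) (Y k)) (b : Bool) (F : ℝ → ℝ → ℂ) : Prop where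
  jet : JetPoly (hu.jets hY) b (fun z => F z.1 z.2)
  smooth : ∀ z ∈ I ×ˢ (univ : Set ℝ), ContDiffAt ℝ ∞ (fun z : ℝ × ℝ => F z.1 z.2) z

namespace FlowFn

variable {hu : DecayingMap h I uinf u} {Y : κ → ℝ → ℝ → E}
  {hY : ∀ k, SmoothField u (I ×ˢ univ) (Y k)} {b b' : Bool} {F G : ℝ → ℝ → ℂ}

lemma congr (hF : FlowFn hu hY b F) (hFG : ∀ z ∈ I ×ˢ (univ : Set ℝ), G z.1 z.2 = F z.1 z.2) :
    FlowFn hu hY b G :=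
  ⟨hF.jet.congr fun z hz => hFG z hz.1, fun z hz => (hF.smooth z hz).congr_of_eventuallyEq
    (eventually_of_mem (hu.map.isOpen.mem_nhds hz) hFG)⟩

lemma add (hF : FlowFn hu hY b F) (hG : FlowFn hu hY b G) :
    FlowFn hu hY b (fun t x => F t x + G t x) :=
  ⟨hF.jet.add hG.jet, fun z hz => (hF.smooth z hz).add (hG.smooth z hz)⟩

lemma sub (hF : FlowFn hu hY b F) (hG : FlowFn hu hY b G) :
    FlowFn hu hY b (fun t x => F t x - G t x) :=
  ⟨hF.jet.sub hG.jet, fun z hz => (hF.smooth z hz).sub (hG.smooth z hz)⟩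

lemma mul (hF : FlowFn hu hY b F) (hG : FlowFn hu hY b' G) :
    FlowFn hu hY (b || b') (fun t x => F t x * G t x) :=
  ⟨hF.jet.mul hG.jet, fun z hz => (hF.smooth z hz).mul (hG.smooth z hz)⟩

lemma const_mul (c : ℂ) (hF : FlowFn hu hY b F) : FlowFn hu hY b (fun t x => c * F t x) :=
  ⟨hF.jet.const_mul c, fun z hz => contDiffAt_const.mul (hF.smooth z hz)⟩

lemma conj (hF : FlowFn hu hY b F) : FlowFn hu hY b (fun t x => (starRingEnd ℂ) (F t x)) :=
  ⟨hF.jet.conj, fun z hz => Complex.conjCLE.contDiff.contDiffAt.comp z (hF.smooth z hz)⟩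

lemma sum {ι : Type*} [Fintype ι] {F : ι → ℝ → ℝ → ℂ} (hF : ∀ i, FlowFn hu hY b (F i)) :
    FlowFn hu hY b (fun t x => ∑ i, F i t x) :=
  ⟨JetPoly.sum _ fun i _ => (hF i).jet, fun z hz => ContDiffAt.sum fun i _ => (hF i).smooth z hz⟩

lemma contDiffOn (hF : FlowFn hu hY b F) :
    ContDiffOn ℝ ∞ (fun z : ℝ × ℝ => F z.1 z.2) (I ×ˢ univ) :=
  fun z hz => (hF.smooth z hz).contDiffWithinAt

lemma dx_eq (hF : FlowFn hu hY b F) {z : ℝ × ℝ} (hz : z ∈ I ×ˢ (univ : Set ℝ)) :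
    dx F z.1 z.2 = fderiv ℝ (fun z : ℝ × ℝ => F z.1 z.2) z (0, 1) :=
  (deriv_slice (differentiableAt_of_smooth (hF.smooth z hz))).deriv

lemma hasDerivAt (hF : FlowFn hu hY b F) {t : ℝ} (ht : t ∈ I) (x : ℝ) :
    HasDerivAt (F t) (dx F t x) x := by
  have := deriv_slice (differentiableAt_of_smooth (hF.smooth (t, x) (hu.mem ht)))
  rw [← hF.dx_eq (hu.mem ht)] at this
  exact this

lemma dt_eq (hF : FlowFn hu hY b F) {z : ℝ × ℝ} (hz : z ∈ I ×ˢ (univ : Set ℝ)) :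
    dt F z.1 z.2 = fderiv ℝ (fun z : ℝ × ℝ => F z.1 z.2) z (1, 0) :=
  (deriv_slice_left (differentiableAt_of_smooth (hF.smooth z hz))).deriv

/-- Differentiation in x always raises the flag: ∂_x v is a jet, and a parallel Y satisfies ∂_x Y =
−Γ(u_x, Y). In particular ∂_x S decays although S is only bounded. -/
lemma dx (hYp : ∀ k, ∀ z ∈ I ×ˢ (univ : Set ℝ), nab h u (0, 1) (Y k) z.1 z.2 = 0)
    (hF : FlowFn hu hY b F) : FlowFn hu hY true (dx F) := by
  refine congr (F := fun t x => fderiv ℝ (fun z : ℝ × ℝ => F z.1 z.2) (t, x) (0, 1)) ⟨?_, ?_⟩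
    fun z hz => hF.dx_eq hz
  · exact JetPoly.fderiv (hu.jetVec_deriv_coord hY) (hu.jetVec_deriv_jet hY)
      (fun k => hu.jetVec_deriv_parallel hY (hYp k)) hF.jet
  · exact fun z hz => (contDiffAt_fderiv (hF.smooth z hz)).clm_apply contDiffAt_const

variable [T2Space N] (hYb : ∀ k, ∃ C, ∀ z ∈ I ×ˢ (univ : Set ℝ),
  
      metricAt h (u z.1 z.2) (Y k z.1 z.2) (Y k z.1 z.2) ≤ C)
include hYb

lemma integrableOn (hF : FlowFn hu hY true F) {t : ℝ} (ht : t ∈ I) (x : ℝ) :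
    IntegrableOn (F t) (Iic x) :=
  (hu.decaysAtBot hY hF.jet hYb hF.contDiffOn.continuousOn).integrableOn
    hF.contDiffOn.continuousOn ht x

lemma tendsto_zero (hF : FlowFn hu hY true F) {t : ℝ} (ht : t ∈ I) :
    Tendsto (F t) atBot (𝓝 0) :=
  hu.tendsto_zero hY hF.jet hYb ht

end FlowFn

lemma dx_congr {F G : ℝ → ℝ → ℂ} (hFG : ∀ z ∈ I ×ˢ (univ : Set ℝ), F z.1 z.2 = G z.1 z.2) :
    ∀ z ∈ I ×ˢ (univ : Set ℝ), dx F z.1 z.2 = dx G z.1 z.2 := by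
  intro z hz
  have : (fun y => F z.1 y) = fun y => G z.1 y := funext fun y => hFG (z.1, y) ⟨hz.1, mem_univ _⟩
  rw [dx, this, dx]

/-- The complex component of the field `V` along the field `W`. -/
def compField (h : RMetric E N) (u : ℝ → ℝ → N) (V W : ℝ → ℝ → E) (t x : ℝ) : ℂ :=
  compAt h (u t x) (V t x) (W t x)

lemma jetPoly_inner (hu : DecayingMap h I uinf u) {Y : κ → ℝ → ℝ → E}
    (hY : ∀ k, SmoothField u (I ×ˢ univ) (Y k)) {b b' : Bool} {V W : ℝ → ℝ → E}
    (hV : JetVec (hu.jets hY) b (rep u uinf V)) (hW : JetVec (hu.jets hY) b' (rep u uinf W)) :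
    JetPoly (hu.jets hY) (b || b')
      (fun z => (metricAt h (u z.1 z.2) (V z.1 z.2) (W z.1 z.2) : ℂ)) := by
  have hG := contDiffOn_metricInChart h uinf
  refine (JetPoly.clm_apply (L := fun z => Complex.ofRealCLM.comp
    (metricInChart h uinf (coord E u uinf z) (rep u uinf V z))) (fun e => ?_) hW).congr
    fun z hz => congrArg _ (metricAt_eq h hz.2 _ _)
  refine JetPoly.form₁ (D := hu.jets hY) (L := fun y => Complex.ofRealCLM.comp
    ((metricInChart h uinf y).flip e)) ?_ hV
  exact contDiffOn_clm_apply.2 fun v => Complex.ofRealCLM.contDiff.comp_contDiffOn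
    ((hG.clm_apply contDiffOn_const).clm_apply contDiffOn_const)

lemma jetVec_smul (hu : DecayingMap h I uinf u) {Y : κ → ℝ → ℝ → E}
    (hY : ∀ k, SmoothField u (I ×ˢ univ) (Y k)) {b : Bool} {V : ℝ → ℝ → E}
    (hV : JetVec (hu.jets hY) b (rep u uinf V)) (c : ℂ) :
    JetVec (hu.jets hY) b (rep u uinf (fun t x => c • V t x)) :=
  (hV.const_smul c).congr fun _ hz => toChart_smul hz.2 _ _

lemma jetVec_curv (hu : DecayingMap h I uinf u) {Y : κ → ℝ → ℝ → E}
    (hY : ∀ k, SmoothField u (I ×ˢ univ) (Y k)) {b b' b'' : Bool} {V W X : ℝ → ℝ → E}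
    (hV : JetVec (hu.jets hY) b (rep u uinf V)) (hW : JetVec (hu.jets hY) b' (rep u uinf W))
    (hX : JetVec (hu.jets hY) b'' (rep u uinf X)) :
    JetVec (hu.jets hY) (b || b' || b'')
      (rep u uinf (fun t x => curvAt h (u t x) (V t x) (W t x) (X t x))) :=
  (JetVec.curv (D := hu.jets hY) (contDiffOn_chartChr h uinf) hV hW hX).congr
    fun _ hz => curvAt_eq h hz.2 _ _ _

lemma contDiffAt_compField (hu : DecayingMap h I uinf u) {V W : ℝ → ℝ → E}
    (hV : SmoothField u (I ×ˢ univ) V) (hW : SmoothField u (I ×ˢ univ) W) {z : ℝ × ℝ}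
    (hz : z ∈ I ×ˢ (univ : Set ℝ)) :
    ContDiffAt ℝ ∞ (fun z : ℝ × ℝ => compField h u V W z.1 z.2) z :=
  (Complex.ofRealCLM.contDiff.contDiffAt.comp z (hu.map.contDiffAt_inner h hV hW hz)).add
    (contDiffAt_const.mul (Complex.ofRealCLM.contDiff.contDiffAt.comp z
      (hu.map.contDiffAt_inner h hV (hu.map.smooth_const_smul Complex.I hW) hz)))

lemma flowFn_compField (hu : DecayingMap h I uinf u) {Y : κ → ℝ → ℝ → E}
    (hY : ∀ k, SmoothField u (I ×ˢ univ) (Y k)) {b b' : Bool} {V W : ℝ → ℝ → E}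
    (hVs : SmoothField u (I ×ˢ univ) V) (hWs : SmoothField u (I ×ˢ univ) W)
    (hV : JetVec (hu.jets hY) b (rep u uinf V)) (hW : JetVec (hu.jets hY) b' (rep u uinf W)) :
    FlowFn hu hY (b || b') (compField h u V W) := by
  exact ⟨(jetPoly_inner hu hY hV hW).add
    ((jetPoly_inner hu hY hV (jetVec_smul hu hY hW Complex.I)).const_mul Complex.I),
    fun _ hz => contDiffAt_compField hu hVs hWs hz⟩

/-- Along parallel fields, components of the covariant derivative are derivatives of components. -/
lemma dx_compField (hu : DecayingMap h I uinf u) (hK : IsKahler h) {V W : ℝ → ℝ → E}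
    (hV : SmoothField u (I ×ˢ univ) V) (hW : SmoothField u (I ×ˢ univ) W)
    (hp : ∀ z ∈ I ×ˢ (univ : Set ℝ), nab h u (0, 1) W z.1 z.2 = 0) :
    ∀ z ∈ I ×ˢ (univ : Set ℝ),
      dx (compField h u V W) z.1 z.2 = compField h u (nab h u (0, 1) V) W z.1 z.2 := by
  intro z hz
  have hWI := hu.map.smooth_const_smul Complex.I hW
  have h1 := deriv_slice (differentiableAt_of_smooth (hu.map.contDiffAt_inner h hV hW hz))
  have h2 := deriv_slice (differentiableAt_of_smooth (hu.map.contDiffAt_inner h hV hWI hz))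
  rw [hu.map.fderiv_inner h hV hW hz, hp z hz, map_zero, add_zero] at h1
  rw [hu.map.fderiv_inner h hV hWI hz, hu.map.nab_const_smul h hK _ hW hz, hp z hz, smul_zero,
    map_zero, add_zero] at h2
  exact (h1.ofReal_comp.add (h2.ofReal_comp.const_mul Complex.I)).deriv

end Components

end KahlerFlow
end

noncomputable section
namespace KahlerFlow

/-! ### The nonlocal densities as derivatives -/

section Densities

open scoped ComplexConjugate

variable {n : ℕ}

/-- The sum `∑ s_{pq} X_p conj Y_q`. -/
def sum₂ (s : Fin n → Fin n → ℂ) (X Y : Fin n → ℂ) : ℂ := ∑ p, ∑ q, s p q * X p * conj (Y q)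

/-- The sum `∑ s_{pqr} X_p conj Y_q Z_r`. -/
def sum₃ (s : Fin n → Fin n → Fin n → ℂ) (X Y Z : Fin n → ℂ) : ℂ :=
  ∑ p, ∑ q, ∑ r, s p q r * X p * conj (Y q) * Z r

lemma sum₂_add_left (s : Fin n → Fin n → ℂ) (X X' Y : Fin n → ℂ) :
    sum₂ s (fun p => X p + X' p) Y = sum₂ s X Y + sum₂ s X' Y := by
  simp only [sum₂, ← Finset.sum_add_distrib]
  exact Finset.sum_congr rfl fun p _ => Finset.sum_congr rfl fun q _ => by ring

lemma sum₂_add_right (s : Fin n → Fin n → ℂ) (X Y Y' : Fin n → ℂ) :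
    sum₂ s X (fun p => Y p + Y' p) = sum₂ s X Y + sum₂ s X Y' := by
  simp only [sum₂, ← Finset.sum_add_distrib]
  exact Finset.sum_congr rfl fun p _ => Finset.sum_congr rfl fun q _ => by rw [map_add]; ring

lemma sum₂_smul_left (s : Fin n → Fin n → ℂ) (c : ℝ) (X Y : Fin n → ℂ) :
    sum₂ s (fun p => c * X p) Y = c * sum₂ s X Y := by
  simp only [sum₂, Finset.mul_sum]
  exact Finset.sum_congr rfl fun p _ => Finset.sum_congr rfl fun q _ => by ring

lemma sum₂_smul_right (s : Fin n → Fin n → ℂ) (c : ℝ) (X Y : Fin n → ℂ) :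
    sum₂ s X (fun p => c * Y p) = c * sum₂ s X Y := by
  simp only [sum₂, Finset.mul_sum]
  exact Finset.sum_congr rfl fun p _ => Finset.sum_congr rfl fun q _ => by
    rw [map_mul, Complex.conj_ofReal]; ring

lemma sum₂_sum₃_right (s : Fin n → Fin n → ℂ) (S : Fin n → Fin n → Fin n → Fin n → ℂ)
    (X A B C : Fin n → ℂ) : sum₂ s X (fun q => sum₃ (S q) A B C) =
      ∑ p, ∑ q, ∑ α, ∑ β, ∑ γ, s p q * conj (S q α β γ) * conj (A α) * B β * conj (C γ) * X p := by
  simp only [sum₂, sum₃, map_sum, map_mul, Complex.conj_conj, Finset.mul_sum]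
  refine Finset.sum_congr rfl fun p _ => Finset.sum_congr rfl fun q _ => Finset.sum_congr rfl
    fun α _ => Finset.sum_congr rfl fun β _ => Finset.sum_congr rfl fun γ _ => by ring

lemma sum₂_sum₃_left (s : Fin n → Fin n → ℂ) (S : Fin n → Fin n → Fin n → Fin n → ℂ)
    (A B C Y : Fin n → ℂ) : sum₂ s (fun p => sum₃ (S p) A B C) Y =
      ∑ p, ∑ q, ∑ α, ∑ β, ∑ γ, s p q * S p α β γ * A α * conj (B β) * C γ * conj (Y q) := by
  simp only [sum₂, sum₃, Finset.mul_sum, Finset.sum_mul]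
  refine Finset.sum_congr rfl fun p _ => Finset.sum_congr rfl fun q _ => Finset.sum_congr rfl
    fun α _ => Finset.sum_congr rfl fun β _ => Finset.sum_congr rfl fun γ _ => by ring

lemma sum_sum₂_mul (s : Fin n → Fin n → Fin n → ℂ) (X Y Z : Fin n → ℂ) :
    ∑ r, sum₂ (fun p q => s p q r) X Y * Z r = sum₃ s X Y Z := by
  simp only [sum₂, sum₃, Finset.sum_mul]
  rw [Finset.sum_comm]
  exact Finset.sum_congr rfl fun p _ => Finset.sum_comm

lemma sum₃_symm {s : Fin n → Fin n → Fin n → ℂ} (hs : ∀ p q r, s p q r = s r q p)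
    (X Y Z : Fin n → ℂ) : sum₃ s X Y Z = sum₃ s Z Y X := by
  simp only [sum₃]
  rw [Finset.sum_comm]
  conv_rhs => rw [Finset.sum_comm]
  refine Finset.sum_congr rfl fun q _ => ?_
  rw [Finset.sum_comm]
  exact Finset.sum_congr rfl fun r _ => Finset.sum_congr rfl fun p _ => by rw [hs]; ring

lemma hasDerivAt_conj {f : ℝ → ℂ} {f' : ℂ} {x : ℝ} (hf : HasDerivAt f f' x) :
    HasDerivAt (fun x => conj (f x)) (conj f') x :=
  Complex.conjCLE.toContinuousLinearMap.hasFDerivAt.comp_hasDerivAt x hf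

lemma hasDerivAt_sum₂ {s : Fin n → Fin n → ℝ → ℂ} {X Y : Fin n → ℝ → ℂ} {s' : Fin n → Fin n → ℂ}
    {X' Y' : Fin n → ℂ} {x : ℝ} (hs : ∀ p q, HasDerivAt (s p q) (s' p q) x)
    (hX : ∀ p, HasDerivAt (X p) (X' p) x) (hY : ∀ p, HasDerivAt (Y p) (Y' p) x) :
    HasDerivAt (fun x => sum₂ (fun p q => s p q x) (fun p => X p x) (fun p => Y p x))
      (sum₂ s' (fun p => X p x) (fun p => Y p x) + sum₂ (fun p q => s p q x) X' (fun p => Y p x)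
        + sum₂ (fun p q => s p q x) (fun p => X p x) Y') x := by
  have := HasDerivAt.fun_sum (u := Finset.univ) fun p _ => HasDerivAt.fun_sum (u := Finset.univ)
    fun q _ => ((hs p q).mul (hX p)).mul (hasDerivAt_conj (hY q))
  refine this.congr_deriv ?_
  simp only [sum₂, ← Finset.sum_add_distrib]
  exact Finset.sum_congr rfl fun p _ => Finset.sum_congr rfl fun q _ => by
    simp only [Pi.mul_apply]; ring

lemma hasDerivAt_sum₃ {s : Fin n → Fin n → Fin n → ℝ → ℂ} {X Y Z : Fin n → ℝ → ℂ}
    {s' : Fin n → Fin n → Fin n → ℂ} {X' Y' Z' : Fin n → ℂ} {x : ℝ}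
    (hs : ∀ p q r, HasDerivAt (s p q r) (s' p q r) x) (hX : ∀ p, HasDerivAt (X p) (X' p) x)
    (hY : ∀ p, HasDerivAt (Y p) (Y' p) x) (hZ : ∀ p, HasDerivAt (Z p) (Z' p) x) :
    HasDerivAt (fun x => sum₃ (fun p q r => s p q r x) (fun p => X p x) (fun p => Y p x)
        (fun p => Z p x))
      (sum₃ s' (fun p => X p x) (fun p => Y p x) (fun p => Z p x)
        + sum₃ (fun p q r => s p q r x) X' (fun p => Y p x) (fun p => Z p x)
        + sum₃ (fun p q r => s p q r x) (fun p => X p x) Y' (fun p => Z p x)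
        + sum₃ (fun p q r => s p q r x) (fun p => X p x) (fun p => Y p x) Z') x := by
  have := HasDerivAt.fun_sum (u := Finset.univ) fun p _ => HasDerivAt.fun_sum (u := Finset.univ)
    fun q _ => HasDerivAt.fun_sum (u := Finset.univ) fun r _ =>
      (((hs p q r).mul (hX p)).mul (hasDerivAt_conj (hY q))).mul (hZ r)
  refine this.congr_deriv ?_
  simp only [sum₃, ← Finset.sum_add_distrib]
  exact Finset.sum_congr rfl fun p _ => Finset.sum_congr rfl fun q _ => Finset.sum_congr rfl
    fun r _ => by simp only [Pi.mul_apply]; ring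

variable (a lam b c : ℝ) (S : Fin n → Fin n → Fin n → Fin n → ℝ → ℝ → ℂ) (Q : Fin n → ℝ → ℝ → ℂ)

/-- `-i` times the components of `u_t`. -/
def fluxFn (j : Fin n) (t x : ℝ) : ℂ :=
  a * dx (dx (dx (Q j))) t x + lam * dx (Q j) t x
    + (b + 2 * c : ℝ) * sum₃ (fun p q r => S j p q r t x) (fun p => dx (Q p) t x) (fun p => Q p t x)
        (fun p => Q p t x)
    + (-b : ℝ) * sum₃ (fun p q r => S j p q r t x) (fun p => Q p t x) (fun p => dx (Q p) t x)
        (fun p => Q p t x)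

/-- The local part of the connection form in the time direction. -/
def boundaryFn (j r : Fin n) (t x : ℝ) : ℂ :=
  -a * (sum₂ (fun p q => S j p q r t x) (fun p => dx (dx (Q p)) t x) (fun p => Q p t x)
      + sum₂ (fun p q => S j p q r t x) (fun p => Q p t x) (fun p => dx (dx (Q p)) t x)
      - sum₂ (fun p q => S j p q r t x) (fun p => dx (Q p) t x) (fun p => dx (Q p) t x)
      - sum₂ (fun p q => dx (S j p q r) t x) (fun p => dx (Q p) t x) (fun p => Q p t x)
      - sum₂ (fun p q => dx (S j p q r) t x) (fun p => Q p t x) (fun p => dx (Q p) t x))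
    - lam * sum₂ (fun p q => S j p q r t x) (fun p => Q p t x) (fun p => Q p t x)

variable {t : ℝ}

lemma f1_eq (j r : Fin n) (x : ℝ) : f1 b c S Q j r t x =
    -(b + 2 * c) * sum₂ (fun p q => S j p q r t x) (fun p => Q p t x)
        (fun q => sum₃ (fun p q' r => S q p q' r t x) (fun p => dx (Q p) t x) (fun p => Q p t x)
          (fun p => Q p t x))
    - (b + 2 * c) * sum₂ (fun p q => S j p q r t x)
        (fun q => sum₃ (fun p q' r => S q p q' r t x) (fun p => dx (Q p) t x) (fun p => Q p t x)
          (fun p => Q p t x)) (fun p => Q p t x)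
    + b * sum₂ (fun p q => S j p q r t x) (fun p => Q p t x)
        (fun q => sum₃ (fun p q' r => S q p q' r t x) (fun p => Q p t x) (fun p => dx (Q p) t x)
          (fun p => Q p t x))
    + b * sum₂ (fun p q => S j p q r t x)
        (fun q => sum₃ (fun p q' r => S q p q' r t x) (fun p => Q p t x) (fun p => dx (Q p) t x)
          (fun p => Q p t x)) (fun p => Q p t x) := by
  rw [sum₂_sum₃_right (fun p q => S j p q r t x) (fun q p q' r => S q p q' r t x),
    sum₂_sum₃_right (fun p q => S j p q r t x) (fun q p q' r => S q p q' r t x),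
    sum₂_sum₃_left (fun p q => S j p q r t x) (fun q p q' r => S q p q' r t x),
    sum₂_sum₃_left (fun p q => S j p q r t x) (fun q p q' r => S q p q' r t x)]
  rfl

lemma f2_eq (j r : Fin n) (x : ℝ) : f2 a lam S Q j r t x =
    -a * (sum₂ (fun p q => dx (dx (S j p q r)) t x) (fun p => dx (Q p) t x) (fun p => Q p t x)
      + sum₂ (fun p q => dx (dx (S j p q r)) t x) (fun p => Q p t x) (fun p => dx (Q p) t x))
    - 3 * a * sum₂ (fun p q => dx (S j p q r) t x) (fun p => dx (Q p) t x) (fun p => dx (Q p) t x)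
    + lam * sum₂ (fun p q => dx (S j p q r) t x) (fun p => Q p t x) (fun p => Q p t x) := by
  simp only [f2, sum₂, ← Finset.sum_add_distrib]
  congr 3
  exact Finset.sum_congr rfl fun p _ => Finset.sum_congr rfl fun q _ => by ring

variable (hS : ∀ j p q r x, HasDerivAt (S j p q r t) (dx (S j p q r) t x) x)
  (hS1 : ∀ j p q r x, HasDerivAt (dx (S j p q r) t) (dx (dx (S j p q r)) t x) x)
  (hQ : ∀ j x, HasDerivAt (Q j t) (dx (Q j) t x) x)
  (hQ1 : ∀ j x, HasDerivAt (dx (Q j) t) (dx (dx (Q j)) t x) x)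
  (hQ2 : ∀ j x, HasDerivAt (dx (dx (Q j)) t) (dx (dx (dx (Q j))) t x) x)

include hS hS1 hQ hQ1 hQ2

/-- Integration by parts. The terms S(Q‴Q̄ + QQ̄‴) coming from the a part of the flux are, up to
terms containing ∂_x S, the derivative of S(Q″Q̄ + QQ̄″ − Q′Q̄′). The terms with ∂_x S are
integrated once more, which leaves −3a ∂_x S Q′Q̄′ and the terms with ∂_x² S. The λ part leaves λ
∂_x S QQ̄. The cubic part of the flux is not integrated and becomes f¹. -/
lemma hasDerivAt_density {m : ℝ → ℂ} (j r : Fin n) {x : ℝ}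
    (hm : HasDerivAt m (-sum₂ (fun p q => S j p q r t x) (fun p => Q p t x)
        (fun p => fluxFn a lam b c S Q p t x)
      - sum₂ (fun p q => S j p q r t x) (fun p => fluxFn a lam b c S Q p t x)
        (fun p => Q p t x)) x) :
    HasDerivAt (fun x => m x - boundaryFn a lam S Q j r t x)
      (f1 b c S Q j r t x + f2 a lam S Q j r t x) x := by
  have hs := fun p q => hS j p q r x
  have hs1 := fun p q => hS1 j p q r x
  have q0 := fun p => hQ p x
  have q1 := fun p => hQ1 p x
  have q2 := fun p => hQ2 p x
  have hb := ((((((hasDerivAt_sum₂ hs q2 q0).add (hasDerivAt_sum₂ hs q0 q2)).sub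
    (hasDerivAt_sum₂ hs q1 q1)).sub (hasDerivAt_sum₂ hs1 q1 q0)).sub
    (hasDerivAt_sum₂ hs1 q0 q1)).const_mul (-a : ℂ)).sub
    ((hasDerivAt_sum₂ hs q0 q0).const_mul (lam : ℂ))
  refine (hm.sub hb).congr_deriv ?_
  rw [f1_eq, f2_eq]
  simp only [fluxFn, sum₂_add_left, sum₂_add_right, sum₂_smul_left, sum₂_smul_right]
  push_cast
  ring

omit hS1 hQ2 in
/-- The evolution equation with the connection form in the time direction, in its final form. -/
lemma systemEq_of (hsym : ∀ j p q r x, S j p q r t x = S j r q p t x)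
    (hQ3 : ∀ j x, HasDerivAt (dx (dx (dx (Q j))) t) (dx (dx (dx (dx (Q j)))) t x) x) (j : Fin n)
    {x : ℝ} {M : Fin n → ℂ}
    (hM : ∀ r, M r - boundaryFn a lam S Q j r t x = (∫ y in Set.Iic x, f1 b c S Q j r t y)
      + ∫ y in Set.Iic x, f2 a lam S Q j r t y)
    (hev : Complex.I * dt (Q j) t x = -deriv (fluxFn a lam b c S Q j t) x + ∑ r, M r * Q r t x) :
    SystemEq a lam b c S Q j t x := by
  have hs := fun p q r => hS j p q r x
  have q0 := fun p => hQ p x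
  have q1 := fun p => hQ1 p x
  have hF := ((((hQ3 j x).const_mul (a : ℂ)).add ((hQ1 j x).const_mul (lam : ℂ))).add
    ((hasDerivAt_sum₃ hs q1 q0 q0).const_mul ((b + 2 * c : ℝ) : ℂ))).add
    ((hasDerivAt_sum₃ hs q0 q1 q0).const_mul ((-b : ℝ) : ℂ))
  have hF' : deriv (fluxFn a lam b c S Q j t) x = _ := hF.deriv
  have hM' : ∑ r, M r * Q r t x = ∑ r, boundaryFn a lam S Q j r t x * Q r t x
      + ((∑ r, (∫ y in Set.Iic x, f1 b c S Q j r t y) * Q r t x)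
      + ∑ r, (∫ y in Set.Iic x, f2 a lam S Q j r t y) * Q r t x) := by
    simp only [← Finset.sum_add_distrib]
    refine Finset.sum_congr rfl fun r _ => ?_
    linear_combination (Q r t x) * hM r
  have hb : ∑ r, boundaryFn a lam S Q j r t x * Q r t x =
      -a * (sum₃ (fun p q r => S j p q r t x) (fun p => dx (dx (Q p)) t x) (fun p => Q p t x)
          (fun p => Q p t x)
        + sum₃ (fun p q r => S j p q r t x) (fun p => Q p t x) (fun p => dx (dx (Q p)) t x)
          (fun p => Q p t x)
        - sum₃ (fun p q r => S j p q r t x) (fun p => dx (Q p) t x) (fun p => dx (Q p) t x)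
          (fun p => Q p t x)
        - sum₃ (fun p q r => dx (S j p q r) t x) (fun p => dx (Q p) t x) (fun p => Q p t x)
          (fun p => Q p t x)
        - sum₃ (fun p q r => dx (S j p q r) t x) (fun p => Q p t x) (fun p => dx (Q p) t x)
          (fun p => Q p t x))
      - lam * sum₃ (fun p q r => S j p q r t x) (fun p => Q p t x) (fun p => Q p t x)
          (fun p => Q p t x) := by
    simp only [← sum_sum₂_mul, Finset.mul_sum, ← Finset.sum_add_distrib, ← Finset.sum_sub_distrib]
    refine Finset.sum_congr rfl fun r _ => ?_
    rw [boundaryFn]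
    ring
  -- The derivative of the flux yields S(Q, Q̄′, Q′) as well as S(Q′, Q̄′, Q). They agree by the
  -- symmetry of S in its outer slots and are both counted in d₃.
  have h3 : sum₃ (fun p q r => S j p q r t x) (fun p => Q p t x) (fun p => dx (Q p) t x)
      (fun p => dx (Q p) t x) = sum₃ (fun p q r => S j p q r t x) (fun p => dx (Q p) t x)
      (fun p => dx (Q p) t x) (fun p => Q p t x) := sum₃_symm (fun p q r => hsym j p q r x) _ _ _
  rw [hF', hM', hb, h3] at hev
  change _ + (_ * dx (dx (dx (dx (Q j)))) t x + _ * dx (dx (Q j)) t x) =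
    ((-a - b - 2 * c : ℝ) : ℂ) * sum₃ (fun p q r => S j p q r t x) (fun p => dx (dx (Q p)) t x)
      (fun p => Q p t x) (fun p => Q p t x)
    + ((-a + b : ℝ) : ℂ) * sum₃ (fun p q r => S j p q r t x) (fun p => Q p t x)
      (fun p => dx (dx (Q p)) t x) (fun p => Q p t x)
    + ((a + b - 2 * c : ℝ) : ℂ) * sum₃ (fun p q r => S j p q r t x) (fun p => dx (Q p) t x)
      (fun p => dx (Q p) t x) (fun p => Q p t x)
    + ((-b - 2 * c : ℝ) : ℂ) * sum₃ (fun p q r => S j p q r t x) (fun p => dx (Q p) t x)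
      (fun p => Q p t x) (fun p => dx (Q p) t x)
    + ((a - b - 2 * c : ℝ) : ℂ) * sum₃ (fun p q r => dx (S j p q r) t x) (fun p => dx (Q p) t x)
      (fun p => Q p t x) (fun p => Q p t x)
    + ((a + b : ℝ) : ℂ) * sum₃ (fun p q r => dx (S j p q r) t x) (fun p => Q p t x)
      (fun p => dx (Q p) t x) (fun p => Q p t x)
    - lam * sum₃ (fun p q r => S j p q r t x) (fun p => Q p t x) (fun p => Q p t x)
      (fun p => Q p t x) + _ + _
  rw [hev]
  push_cast
  ring

end Densities

end KahlerFlow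
end

noncomputable section
namespace KahlerFlow

/-! ### The system satisfied by the components of `u_x` -/

section FinalSystem

set_option maxSynthPendingDepth 3
set_option linter.unusedSectionVars false

open Set Filter MeasureTheory
open scoped ComplexConjugate

variable {E : Type*} [NormedAddCommGroup E] [NormedSpace ℂ E] [FiniteDimensional ℂ E]
  {N : Type*} [TopologicalSpace N] [ChartedSpace E N] [IsManifold 𝓘(ℂ, E) ω N]
  {h : RMetric E N} {I : Set ℝ} {uinf : N} {u : ℝ → ℝ → N} {n : ℕ}

/-- A smooth parallel unitary frame along `u` with limits at `x = -∞`. -/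
structure UnitaryFrame (h : RMetric E N) (I : Set ℝ) (u : ℝ → ℝ → N) (uinf : N)
    (einf : Fin n → E) (e : Fin n → ℝ → ℝ → E) : Prop where
  smooth : ∀ j, SmoothField u (I ×ˢ univ) (e j)
  parallel : ∀ j, ∀ z ∈ I ×ˢ (univ : Set ℝ), nab h u (0, 1) (e j) z.1 z.2 = 0
  unitary : ∀ z ∈ I ×ˢ (univ : Set ℝ), ∀ i j,
    compAt h (u z.1 z.2) (e i z.1 z.2) (e j z.1 z.2) = if i = j then 1 else 0
  norm : ∀ j, ∀ z ∈ I ×ˢ (univ : Set ℝ), metricAt h (u z.1 z.2) (e j z.1 z.2) (e j z.1 z.2) = 1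
  tendsto : ∀ j, ∀ t ∈ I, Tendsto (fun x => rep u uinf (e j) (t, x)) atBot (𝓝 (einf j))
  tendsto_time : ∀ j, ∀ t ∈ I,
    Tendsto (fun x => rep u uinf (nab h u (1, 0) (e j)) (t, x)) atBot (𝓝 0)

/-- The coefficients `S`. -/
def curvCoeff (h : RMetric E N) (u : ℝ → ℝ → N) (e : Fin n → ℝ → ℝ → E) (j p q r : Fin n)
    (t x : ℝ) : ℂ :=
  compAt h (u t x) (curvPart h (u t x) (e p t x) (e q t x) (e r t x)) (e j t x)

namespace UnitaryFrame

variable {einf : Fin n → E} {e : Fin n → ℝ → ℝ → E} (he : UnitaryFrame h I u uinf einf e)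
  (hu : DecayingMap h I uinf u) (hK : IsKahler h) (hn : Module.finrank ℂ E = n)
include he

lemma bounded (k : Fin n) : ∃ C, ∀ z ∈ I ×ˢ (univ : Set ℝ),
    metricAt h (u z.1 z.2) (e k z.1 z.2) (e k z.1 z.2) ≤ C :=
  ⟨1, fun z hz => (he.norm k z hz).le⟩

include hu

lemma flowFn_curvCoeff (j p q r : Fin n) : FlowFn hu he.smooth false (curvCoeff h u e j p q r) := by
  have hY := fun k => JetVec.bdd (D := hu.jets he.smooth) k
  have hI := hu.map.smooth_const_smul Complex.I (he.smooth q)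
  have s1 := hu.map.smooth_curv h (he.smooth p) (he.smooth q) (he.smooth r)
  have s2 := hu.map.smooth_curv h (he.smooth p) hI (he.smooth r)
  have j1 := jetVec_curv hu he.smooth (hY p) (hY q) (hY r)
  have j2 := jetVec_curv hu he.smooth (hY p) (jetVec_smul hu he.smooth (hY q) Complex.I) (hY r)
  have s3 := hu.map.smooth_const_smul (1 / 2 : ℂ) (s1.add (hu.map.smooth_const_smul Complex.I s2))
  refine flowFn_compField (b := false) (b' := false) hu he.smooth s3 (he.smooth j) ?_ (hY j)
  refine jetVec_smul hu he.smooth ?_ _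
  exact (j1.add (jetVec_smul hu he.smooth j2 Complex.I)).congr fun z _ => by
    simp only [rep, map_add]

lemma tendsto_compField (i j : Fin n) {t : ℝ} (ht : t ∈ I) :
    Tendsto (fun x => compField h u (nab h u (1, 0) (e i)) (e j) t x) atBot (𝓝 0) := by
  have hI : Tendsto (fun x => rep u uinf (fun t x => Complex.I • e j t x) (t, x)) atBot
      (𝓝 (Complex.I • einf j)) := by
    refine ((he.tendsto j t ht).const_smul Complex.I).congr' ?_
    filter_upwards [hu.eventually_mem_source ht] with x hx
    exact (toChart_smul hx _ _).symm
  have h1 := hu.tendsto_inner ht (he.tendsto_time i t ht) (he.tendsto j t ht)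
  have h2 := hu.tendsto_inner ht (he.tendsto_time i t ht) hI
  rw [map_zero, zero_apply] at h1 h2
  have h3 := ((Complex.continuous_ofReal.tendsto 0).comp h1).add
    (((Complex.continuous_ofReal.tendsto 0).comp h2).const_mul Complex.I)
  simp only [Complex.ofReal_zero, mul_zero, add_zero] at h3
  exact h3

lemma flowFn_component {Q : Fin n → ℝ → ℝ → ℂ} (hQ : ∀ j, ∀ z ∈ I ×ˢ (univ : Set ℝ),
    Q j z.1 z.2 = compField h u (vel E u (0, 1)) (e j) z.1 z.2) (j : Fin n) :
    FlowFn hu he.smooth true (Q j) :=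
  (flowFn_compField hu he.smooth (hu.map.smooth_vel _) (he.smooth j)
    (JetVec.jet (D := hu.jets he.smooth) 0) (JetVec.bdd j)).congr (hQ j)

include hK hn

lemma compAt_curvPart_eq {z : ℝ × ℝ} (hz : z ∈ I ×ˢ (univ : Set ℝ)) (X Y Z : E) (j : Fin n) :
    compAt h (u z.1 z.2) (curvPart h (u z.1 z.2) X Y Z) (e j z.1 z.2) =
      sum₃ (fun p q r => curvCoeff h u e j p q r z.1 z.2)
        (fun p => compAt h (u z.1 z.2) X (e p z.1 z.2))
        (fun p => compAt h (u z.1 z.2) Y (e p z.1 z.2))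
        (fun p => compAt h (u z.1 z.2) Z (e p z.1 z.2)) := by
  have h1 := compAt_curvPart hK (u z.1 z.2) (e := fun p => e p z.1 z.2)
    (fun p => compAt h (u z.1 z.2) X (e p z.1 z.2)) (fun p => compAt h (u z.1 z.2) Y (e p z.1 z.2))
    (fun p => compAt h (u z.1 z.2) Z (e p z.1 z.2)) (e j z.1 z.2)
  have h2 := fun V => sum_compAt_smul hK (u z.1 z.2) hn (he.unitary z hz) V
  rw [h2, h2, h2] at h1
  exact h1

variable {Q : Fin n → ℝ → ℝ → ℂ} (hQ : ∀ j, ∀ z ∈ I ×ˢ (univ : Set ℝ),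
  Q j z.1 z.2 = compField h u (vel E u (0, 1)) (e j) z.1 z.2)
include hQ

omit hn

lemma iterate_dx_component (j : Fin n) (l : ℕ) : ∀ z ∈ I ×ˢ (univ : Set ℝ),
    dx^[l] (Q j) z.1 z.2 = compField h u (jetField h u l) (e j) z.1 z.2 := by
  induction l with
  | zero => exact hQ j
  | succ l ih =>
    intro z hz
    rw [Function.iterate_succ', Function.comp_apply, dx_congr ih z hz,
      dx_compField hu hK (hu.map.smooth_jetField l) (he.smooth j) (he.parallel j) z hz, jetField,
      jetField, Function.iterate_succ', Function.comp_apply]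

include hn

/-- The components of the right hand side of the equation. -/
lemma compField_flowField (a lam b c : ℝ) (j : Fin n) : ∀ z ∈ I ×ˢ (univ : Set ℝ),
    compField h u (flowField h a lam b c u) (e j) z.1 z.2 =
      Complex.I * fluxFn a lam b c (curvCoeff h u e) Q j z.1 z.2 := by
  intro z hz
  have hr : ∀ (k : ℝ) (V : E), compAt h (u z.1 z.2) (k • V) (e j z.1 z.2)
      = k * compAt h (u z.1 z.2) V (e j z.1 z.2) := fun k V => by
    rw [← Complex.coe_smul, compAt_smul hK]
  have hsub : ∀ V W : E, compAt h (u z.1 z.2) (V - W) (e j z.1 z.2)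
      = compAt h (u z.1 z.2) V (e j z.1 z.2) - compAt h (u z.1 z.2) W (e j z.1 z.2) := fun V W =>
    map_sub (compL hK (u z.1 z.2) (e j z.1 z.2)) V W
  have hq := fun p l => he.iterate_dx_component hu hK hQ p l z hz
  simp only [compField] at hq
  have hq0 : ∀ p, compAt h (u z.1 z.2) (jetField h u 0 z.1 z.2) (e p z.1 z.2) = Q p z.1 z.2 :=
    fun p => (hq p 0).symm
  have hq1 : ∀ p, compAt h (u z.1 z.2) (jetField h u 1 z.1 z.2) (e p z.1 z.2)
      = dx (Q p) z.1 z.2 := fun p => (hq p 1).symm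
  have hq3 : ∀ p, compAt h (u z.1 z.2) (jetField h u 3 z.1 z.2) (e p z.1 z.2)
      = dx (dx (dx (Q p))) z.1 z.2 := fun p => (hq p 3).symm
  -- By the type of each slot of P, the b term equals ib(P(∇u_x,u_x)u_x − P(u_x,∇u_x)u_x). In the c
  -- term the two halves of R(iu_x,u_x)∇u_x coincide and give 2ic P(u_x,u_x)∇u_x, which the symmetry
  -- of P brings to the form of the first.
  rw [compField, flowField, curvAt_eq_sub hK, curvAt_eq_sub hK _ (Complex.I • _),
    curvPart_smul_right hK, curvPart_smul_right hK, curvPart_smul_left hK, curvPart_smul_mid hK,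
    curvPart_symm hK _ (jetField h u 0 z.1 z.2) (jetField h u 0 z.1 z.2) (jetField h u 1 z.1 z.2)]
  simp only [compAt_add, hr, hsub, compAt_smul hK, he.compAt_curvPart_eq hu hK hn hz, hq0, hq1, hq3]
  rw [fluxFn, Complex.conj_I]
  push_cast
  ring

variable {a lam b c : ℝ} (hflow : ∀ z ∈ I ×ˢ (univ : Set ℝ),
  vel E u (1, 0) z.1 z.2 = flowField h a lam b c u z.1 z.2)
include hflow

/-- Since ∇_x e_r = 0, commuting derivatives gives ∇_x ∇_t e_r = R(u_x, u_t)e_r. Inserting iF for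
the components of u_t and multiplying by −i produces the two terms. -/
lemma hasDerivAt_connection (j r : Fin n) {t : ℝ} (ht : t ∈ I) (x : ℝ) :
    HasDerivAt (fun x => -Complex.I * compField h u (nab h u (1, 0) (e r)) (e j) t x)
      (-sum₂ (fun p q => curvCoeff h u e j p q r t x) (fun p => Q p t x)
        (fun p => fluxFn a lam b c (curvCoeff h u e) Q p t x)
      - sum₂ (fun p q => curvCoeff h u e j p q r t x)
        (fun p => fluxFn a lam b c (curvCoeff h u e) Q p t x) (fun p => Q p t x)) x := by
  have hz := hu.mem (x := x) ht
  have hs := hu.map.smooth_nab h (he.smooth r) (1, 0)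
  have h1 := deriv_slice (differentiableAt_of_smooth
    (contDiffAt_compField hu hs (he.smooth j) hz))
  have h2 := dx_compField hu hK hs (he.smooth j) (he.parallel j) _ hz
  have h3 := hu.map.nab_comm h (he.smooth r) hz (0, 1) (1, 0)
  -- The field ∇_x e_r vanishes identically on the domain, so its t derivative vanishes too and only
  -- one term of the commutator is left.
  rw [hu.map.nab_congr h (W := fun _ _ => 0) (he.parallel r) hz, nab_zero h (t, x) (1, 0), sub_zero,
    hflow _ hz] at h3
  have h4 : dx (compField h u (nab h u (1, 0) (e r)) (e j)) t x = _ := h1.deriv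
  rw [← h4, h2, compField, h3, curvAt_eq_sub hK] at h1
  have hsub : ∀ V W : E, compAt h (u t x) (V - W) (e j t x)
      = compAt h (u t x) V (e j t x) - compAt h (u t x) W (e j t x) := fun V W =>
    map_sub (compL hK (u t x) (e j t x)) V W
  have hF := fun p => he.compField_flowField hu hK hn hQ a lam b c p _ hz
  have hV : ∀ p, compAt h (u t x) (vel E u (0, 1) t x) (e p t x) = Q p t x :=
    fun p => (hQ p _ hz).symm
  have hr : ∀ p, compAt h (u t x) (e r t x) (e p t x) = if r = p then 1 else 0 :=
    fun p => he.unitary _ hz r p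
  simp only [compField] at hF
  refine (h1.const_mul (-Complex.I)).congr_deriv ?_
  simp only [hsub, he.compAt_curvPart_eq hu hK hn hz, hF, hV, hr]
  simp only [sum₃, sum₂, mul_ite, mul_one, mul_zero, Finset.sum_ite_eq, Finset.mem_univ, if_true,
    ← Finset.sum_neg_distrib, ← Finset.sum_sub_distrib, Finset.mul_sum]
  refine Finset.sum_congr rfl fun p _ => Finset.sum_congr rfl fun q _ => ?_
  rw [map_mul, Complex.conj_I]
  linear_combination (curvCoeff h u e j p q r t x) * (Q p t x
    * conj (fluxFn a lam b c (curvCoeff h u e) Q q t x)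
    + fluxFn a lam b c (curvCoeff h u e) Q p t x * conj (Q q t x)) * Complex.I_mul_I

/-- The evolution equation of the components of `u_x`. -/
lemma evolution (j : Fin n) {t : ℝ} (ht : t ∈ I) (x : ℝ) : Complex.I * dt (Q j) t x =
    -deriv (fluxFn a lam b c (curvCoeff h u e) Q j t) x
      + ∑ r, (-Complex.I * compField h u (nab h u (1, 0) (e r)) (e j) t x) * Q r t x := by
  have hz := hu.mem (x := x) ht
  have hQf := fun p => he.flowFn_component hu hQ p
  have hexp : ∀ z ∈ I ×ˢ (univ : Set ℝ), vel E u (0, 1) z.1 z.2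
      = ∑ r, Q r z.1 z.2 • e r z.1 z.2 := by
    intro z hz
    simp only [hQ _ z hz]
    exact (sum_compAt_smul hK (u z.1 z.2) hn (he.unitary z hz) _).symm
  have h1 := hu.map.nab_congr h (W := fun t x => ∑ r, Q r t x • e r t x) hexp hz (1, 0)
  have hsm := fun r => hu.map.smooth_smul (hQf r).smooth (he.smooth r)
  -- Absence of torsion replaces ∇_t u_x by ∇_x u_t, while the expansion u_x = Σ Q_r e_r computes
  -- the same derivative in terms of ∂_t Q_r and ∇_t e_r.
  rw [hu.map.torsion_free h hz, hu.map.nab_sum h Finset.univ (fun r _ => hsm r) hz] at h1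
  have h2 : ∀ r, nab h u (1, 0) (fun t x => Q r t x • e r t x) t x
      = dt (Q r) t x • e r t x + Q r t x • nab h u (1, 0) (e r) t x := by
    intro r
    have := hu.map.nab_smul h hK ((hQf r).smooth _ hz) (he.smooth r) hz (1, 0)
    rw [← (hQf r).dt_eq hz] at this
    exact this
  simp only [h2] at h1
  rw [hu.map.nab_congr h hflow hz] at h1
  have h3 := dx_compField hu hK (V := flowField h a lam b c u) (hu.map.smooth_congr
    (fun z hz => (hflow z hz).symm) (hu.map.smooth_vel _)) (he.smooth j) (he.parallel j) _ hz
  rw [dx_congr (G := fun t x => Complex.I * fluxFn a lam b c (curvCoeff h u e) Q j t x)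
    (he.compField_flowField hu hK hn hQ a lam b c j) _ hz, compField, h1] at h3
  have h4 : dx (fun t x => Complex.I * fluxFn a lam b c (curvCoeff h u e) Q j t x) t x
      = Complex.I * deriv (fluxFn a lam b c (curvCoeff h u e) Q j t) x := by
    rw [dx]
    exact congrFun (deriv_const_mul_field' Complex.I) x
  have h5 : compAt h (u t x) (∑ r, (dt (Q r) t x • e r t x
      + Q r t x • nab h u (1, 0) (e r) t x)) (e j t x) = dt (Q j) t x
      + ∑ r, compField h u (nab h u (1, 0) (e r)) (e j) t x * Q r t x := by
    change compL hK (u t x) (e j t x) _ = _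
    rw [map_sum]
    have h6 : ∀ r, compL hK (u t x) (e j t x) (dt (Q r) t x • e r t x
        + Q r t x • nab h u (1, 0) (e r) t x) = dt (Q r) t x * (if r = j then 1 else 0)
        + compField h u (nab h u (1, 0) (e r)) (e j) t x * Q r t x := by
      intro r
      rw [map_add, map_smul, map_smul, ← he.unitary _ hz r j, smul_eq_mul, smul_eq_mul,
        mul_comm (Q r t x)]
      rfl
    simp only [h6, Finset.sum_add_distrib, mul_ite, mul_one, mul_zero, Finset.sum_ite_eq',
      Finset.mem_univ, if_true]
  have h7 := (h4.symm.trans h3).trans h5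
  have h8 : ∑ r, (-Complex.I * compField h u (nab h u (1, 0) (e r)) (e j) t x) * Q r t x
      = -Complex.I * ∑ r, compField h u (nab h u (1, 0) (e r)) (e j) t x * Q r t x := by
    rw [Finset.mul_sum]
    exact Finset.sum_congr rfl fun r _ => by ring
  rw [h8]
  linear_combination (-Complex.I) * h7
    + deriv (fluxFn a lam b c (curvCoeff h u e) Q j t) x * Complex.I_mul_I

end UnitaryFrame

end FinalSystem

end KahlerFlow
end

noncomputable section
namespace KahlerFlow

section MainTheorem

set_option maxSynthPendingDepth 3
set_option linter.unusedSectionVars false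

open Set Filter MeasureTheory
open scoped ComplexConjugate

variable {E : Type*} [NormedAddCommGroup E] [NormedSpace ℂ E] [FiniteDimensional ℂ E]
  {N : Type*} [TopologicalSpace N] [ChartedSpace E N] [IsManifold 𝓘(ℂ, E) ω N]
  {h : RMetric E N} {I : Set ℝ} {uinf : N} {u : ℝ → ℝ → N} {n : ℕ}

/-! ### Smoothness and decay of the densities -/

section FlowFunctions

variable {hu : DecayingMap h I uinf u} {κ : Type*} {Y : κ → ℝ → ℝ → E}
  {hY : ∀ k, SmoothField u (I ×ˢ univ) (Y k)}
  {S : Fin n → Fin n → Fin n → Fin n → ℝ → ℝ → ℂ} {Q : Fin n → ℝ → ℝ → ℂ}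

lemma flowFn_sum₂ {s : Fin n → Fin n → ℝ → ℝ → ℂ} {X Z : Fin n → ℝ → ℝ → ℂ}
    (hs : ∀ p q, FlowFn hu hY false (s p q)) (hX : ∀ p, FlowFn hu hY true (X p))
    (hZ : ∀ p, FlowFn hu hY true (Z p)) :
    FlowFn hu hY true (fun t x => sum₂ (fun p q => s p q t x) (fun p => X p t x)
      (fun p => Z p t x)) :=
  FlowFn.sum fun p => FlowFn.sum fun q => ((hs p q).mul (hX p)).mul (hZ q).conj

variable (hYp : ∀ k, ∀ z ∈ I ×ˢ (univ : Set ℝ), nab h u (0, 1) (Y k) z.1 z.2 = 0)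
  (hS : ∀ j p q r, FlowFn hu hY false (S j p q r)) (hQ : ∀ j, FlowFn hu hY true (Q j))
include hYp hS hQ

lemma flowFn_f1 (b c : ℝ) (j r : Fin n) : FlowFn hu hY true (f1 b c S Q j r) := by
  have hQ1 := fun p => (hQ p).dx hYp
  have h1 : FlowFn hu hY true (fun t x => ∑ p, ∑ q, ∑ α, ∑ β, ∑ γ, S j p q r t x
      * conj (S q α β γ t x) * conj (dx (Q α) t x) * Q β t x * conj (Q γ t x) * Q p t x) :=
    FlowFn.sum fun p => FlowFn.sum fun q => FlowFn.sum fun α => FlowFn.sum fun β =>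
      FlowFn.sum fun γ => (((((hS j p q r).mul (hS q α β γ).conj).mul (hQ1 α).conj).mul (hQ β)).mul
        (hQ γ).conj).mul (hQ p)
  have h2 : FlowFn hu hY true (fun t x => ∑ p, ∑ q, ∑ α, ∑ β, ∑ γ, S j p q r t x * S p α β γ t x
      * dx (Q α) t x * conj (Q β t x) * Q γ t x * conj (Q q t x)) :=
    FlowFn.sum fun p => FlowFn.sum fun q => FlowFn.sum fun α => FlowFn.sum fun β =>
      FlowFn.sum fun γ => (((((hS j p q r).mul (hS p α β γ)).mul (hQ1 α)).mul (hQ β).conj).mul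
        (hQ γ)).mul (hQ q).conj
  have h3 : FlowFn hu hY true (fun t x => ∑ p, ∑ q, ∑ α, ∑ β, ∑ γ, S j p q r t x
      * conj (S q α β γ t x) * conj (Q α t x) * dx (Q β) t x * conj (Q γ t x) * Q p t x) :=
    FlowFn.sum fun p => FlowFn.sum fun q => FlowFn.sum fun α => FlowFn.sum fun β =>
      FlowFn.sum fun γ => (((((hS j p q r).mul (hS q α β γ).conj).mul (hQ α).conj).mul (hQ1 β)).mul
        (hQ γ).conj).mul (hQ p)
  have h4 : FlowFn hu hY true (fun t x => ∑ p, ∑ q, ∑ α, ∑ β, ∑ γ, S j p q r t x * S p α β γ t x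
      * Q α t x * conj (dx (Q β) t x) * Q γ t x * conj (Q q t x)) :=
    FlowFn.sum fun p => FlowFn.sum fun q => FlowFn.sum fun α => FlowFn.sum fun β =>
      FlowFn.sum fun γ => (((((hS j p q r).mul (hS p α β γ)).mul (hQ α)).mul (hQ1 β).conj).mul
        (hQ γ)).mul (hQ q).conj
  exact (((h1.const_mul (-(b + 2 * c))).sub (h2.const_mul (b + 2 * c))).add (h3.const_mul b)).add
    (h4.const_mul b)

lemma flowFn_f2 (a lam : ℝ) (j r : Fin n) : FlowFn hu hY true (f2 a lam S Q j r) := by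
  have hQ1 := fun p => (hQ p).dx hYp
  have hS1 := fun p q => ((hS j p q r).dx hYp)
  have hS2 := fun p q => ((hS1 p q).dx hYp)
  have h1 : FlowFn hu hY true (fun t x => ∑ p, ∑ q, dx (dx (S j p q r)) t x
      * (dx (Q p) t x * conj (Q q t x) + Q p t x * conj (dx (Q q) t x))) :=
    FlowFn.sum fun p => FlowFn.sum fun q => (hS2 p q).mul
      (((hQ1 p).mul (hQ q).conj).add ((hQ p).mul (hQ1 q).conj))
  have h2 : FlowFn hu hY true (fun t x => ∑ p, ∑ q, dx (S j p q r) t x * dx (Q p) t x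
      * conj (dx (Q q) t x)) :=
    FlowFn.sum fun p => FlowFn.sum fun q => ((hS1 p q).mul (hQ1 p)).mul (hQ1 q).conj
  have h3 : FlowFn hu hY true (fun t x => ∑ p, ∑ q, dx (S j p q r) t x * Q p t x
      * conj (Q q t x)) :=
    FlowFn.sum fun p => FlowFn.sum fun q => ((hS1 p q).mul (hQ p)).mul (hQ q).conj
  exact ((h1.const_mul (-a)).sub (h2.const_mul (3 * a))).add (h3.const_mul lam)

/-- Each term contains components of u_x, so the local part of the connection form vanishes at −∞
and contributes no constant of integration. -/
lemma flowFn_boundaryFn (a lam : ℝ) (j r : Fin n) :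
    FlowFn hu hY true (boundaryFn a lam S Q j r) := by
  have hQ1 := fun p => (hQ p).dx hYp
  have hQ2 := fun p => (hQ1 p).dx hYp
  have hs := fun p q => hS j p q r
  have hS1 : ∀ p q, FlowFn hu hY false (dx (S j p q r)) := fun p q =>
    ⟨((hS j p q r).dx hYp).jet.weaken, ((hS j p q r).dx hYp).smooth⟩
  exact ((((((flowFn_sum₂ hs hQ2 hQ).add (flowFn_sum₂ hs hQ hQ2)).sub
    (flowFn_sum₂ hs hQ1 hQ1)).sub (flowFn_sum₂ hS1 hQ1 hQ)).sub
    (flowFn_sum₂ hS1 hQ hQ1)).const_mul (-a)).sub ((flowFn_sum₂ hs hQ hQ).const_mul lam)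

end FlowFunctions

/-- The system for the components of `u_x` in a parallel frame. -/
theorem UnitaryFrame.systemEq [T2Space N] {einf : Fin n → E} {e : Fin n → ℝ → ℝ → E}
    (he : UnitaryFrame h I u uinf einf e) (hu : DecayingMap h I uinf u) (hK : IsKahler h)
    (hn : Module.finrank ℂ E = n) {a lam b c : ℝ} (hflow : ∀ z ∈ I ×ˢ (univ : Set ℝ),
      vel E u (1, 0) z.1 z.2 = flowField h a lam b c u z.1 z.2) {Q : Fin n → ℝ → ℝ → ℂ}
    (hQ : ∀ j, ∀ z ∈ I ×ˢ (univ : Set ℝ),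
      Q j z.1 z.2 = compField h u (vel E u (0, 1)) (e j) z.1 z.2) (j : Fin n) {t : ℝ} (ht : t ∈ I)
    (x : ℝ) :
    (∀ r, IntegrableOn (f1 b c (curvCoeff h u e) Q j r t) (Iic x)) ∧
    (∀ r, IntegrableOn (f2 a lam (curvCoeff h u e) Q j r t) (Iic x)) ∧
    SystemEq a lam b c (curvCoeff h u e) Q j t x := by
  have hS := fun j p q r => he.flowFn_curvCoeff hu j p q r
  have hS1 := fun j p q r => (hS j p q r).dx he.parallel
  have hQ0 := fun j => he.flowFn_component hu hQ j
  have hQ1 := fun j => (hQ0 j).dx he.parallel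
  have hQ2 := fun j => (hQ1 j).dx he.parallel
  have hQ3 := fun j => (hQ2 j).dx he.parallel
  have hi1 := fun r x => (flowFn_f1 he.parallel hS hQ0 b c j r).integrableOn he.bounded ht x
  have hi2 := fun r x => (flowFn_f2 he.parallel hS hQ0 a lam j r).integrableOn he.bounded ht x
  refine ⟨fun r => hi1 r x, fun r => hi2 r x, ?_⟩
  have dS := fun j p q r x => (hS j p q r).hasDerivAt ht x
  have dS1 := fun j p q r x => (hS1 j p q r).hasDerivAt ht x
  have d0 := fun j x => (hQ0 j).hasDerivAt ht x
  have d1 := fun j x => (hQ1 j).hasDerivAt ht x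
  have d2 := fun j x => (hQ2 j).hasDerivAt ht x
  have d3 := fun j x => (hQ3 j).hasDerivAt ht x
  refine systemEq_of a lam b c _ Q dS d0 d1 (fun j p q r x => ?_) d3 j (fun r => ?_)
    (he.evolution hu hK hn hQ hflow j ht x)
  · rw [curvCoeff, curvPart_symm hK]
    rfl
  -- The connection form minus its local part has derivative f¹ + f² and tends to 0 at −∞, so it
  -- equals the integral from −∞.
  · have hd := fun x => hasDerivAt_density a lam b c (curvCoeff h u e) Q dS dS1 d0 d1 d2 j r
      (he.hasDerivAt_connection hu hK hn hQ hflow j r ht x)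
    have hl : Tendsto (fun x => -Complex.I * compField h u (nab h u (1, 0) (e r)) (e j) t x
        - boundaryFn a lam (curvCoeff h u e) Q j r t x) atBot (𝓝 0) := by
      have h1 := ((he.tendsto_compField hu r j ht).const_mul (-Complex.I)).sub
        ((flowFn_boundaryFn he.parallel hS hQ0 a lam j r).tendsto_zero he.bounded ht)
      simpa using h1
    have hint := integral_Iic_of_hasDerivAt_of_tendsto' (a := x) (fun y _ => hd y)
      ((hi1 r x).add (hi2 r x)) hl
    rw [integral_add (hi1 r x) (hi2 r x), sub_zero] at hint
    exact hint.symm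

/-! ### Comparison with the definitions of the statement -/

lemma IsParallelFrame.metric {T : EReal} {einf : Fin n → TangentSpace 𝓘(ℝ, E) uinf}
    {e : Fin n → VF E u} (he : IsParallelFrame h T u einf e) {z : ℝ × ℝ} (hz : z ∈ spaceTime T)
    (i j : Fin n) : metricAt h (u z.1 z.2) (e i z.1 z.2) (e j z.1 z.2) = (if i = j then 1 else 0) ∧
      metricAt h (u z.1 z.2) (e i z.1 z.2) (J (e j z.1 z.2)) = 0 := by
  have := he.orthonormal z.1 hz.1 z.2 i j
  exact ⟨this.1, this.2.1⟩

lemma flow_eq {T : EReal} {a lam b c : ℝ} (hu : SmoothMap E u (spaceTime T))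
    (hsol : IsSolution h a lam b c T u) : ∀ z ∈ spaceTime T,
    vel E u (1, 0) z.1 z.2 = flowField h a lam b c u z.1 z.2 := by
  intro z hz
  rw [← hu.velT_eq hz]
  have h1 := hsol z.1 hz.1 z.2
  have e0 : (velX E u z.1 z.2 : E) = jetField h u 0 z.1 z.2 := hu.iterate_velX_eq 0 z hz
  have e1 : (nablaX h u (velX E u) z.1 z.2 : E) = jetField h u 1 z.1 z.2 :=
    hu.iterate_velX_eq 1 z hz
  have e3 : ((nablaX h u)^[3] (velX E u) z.1 z.2 : E) = jetField h u 3 z.1 z.2 :=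
    hu.iterate_velX_eq 3 z hz
  rw [flowField, ← e0, ← e1, ← e3]
  exact h1

lemma compAt_curvPart_eq (hK : IsKahler h) (q : N) (X Y Z e : E) :
    compAt h q (curvPart h q X Y Z) e = (1 / 2) * (compAt h q (curvAt h q X Y Z) e
      + Complex.I * compAt h q (curvAt h q X (Complex.I • Y) Z) e) := by
  rw [curvPart, compAt_smul hK, compAt_add, compAt_smul hK]

lemma Sfun_eq (hK : IsKahler h) (e : Fin n → VF E u) (j p q r : Fin n) :
    Sfun h e j p q r = curvCoeff h u (fun j t x => (e j t x : E)) j p q r := by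
  funext t x
  exact (compAt_curvPart_eq hK (u t x) (e p t x) (e q t x) (e r t x) (e j t x)).symm

lemma smoothField_of_isParallelFrame {T : EReal} (hu : SmoothMap E u (spaceTime T))
    {einf : Fin n → TangentSpace 𝓘(ℝ, E) uinf}
    {e : Fin n → VF E u} (he : IsParallelFrame h T u einf e) (j : Fin n) :
    SmoothField u (spaceTime T) (fun t x => (e j t x : E)) :=
  hu.smoothField_iff.2 (he.smooth j)

lemma compAt_eq_ite {q : N} {v w : E} {P : Prop} [Decidable P]
    (h1 : metricAt h q v w = if P then 1 else 0) (h2 : metricAt h q v (Complex.I • w) = 0) :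
    compAt h q v w = if P then 1 else 0 := by
  rw [compAt, h1, h2]
  split_ifs <;> simp

/-- Nothing is assumed about ∇_t e_j at −∞ for a given frame. Parallel fields are determined by
their limits, so e_j is the field constructed by `exists_parallel`, for which ∇_t e_j → 0 is known.
-/
lemma IsParallelFrame.unitaryFrame [T2Space N] [CompactSpace N] {T : EReal} (hK : IsKahler h)
    (hu : DecayingMap h (timeInterval T) uinf u) {einf : Fin n → TangentSpace 𝓘(ℝ, E) uinf}
    {e : Fin n → VF E u} (he : IsParallelFrame h T u einf e) {a lam b c : ℝ}
    (hflow : ∀ z ∈ spaceTime T, vel E u (1, 0) z.1 z.2 = flowField h a lam b c u z.1 z.2) :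
    UnitaryFrame h (timeInterval T) u uinf (fun j => (einf j : E))
      (fun j t x => (e j t x : E)) := by
  have hs := fun j => smoothField_of_isParallelFrame hu.map he j
  have hp : ∀ j, ∀ z ∈ timeInterval T ×ˢ (univ : Set ℝ),
      nab h u (0, 1) (fun t x => (e j t x : E)) z.1 z.2 = 0 := fun j z hz => by
    rw [← hu.map.nablaX_eq h (hs j) hz]
    exact he.parallel j z.1 hz.1 z.2
  have ht : ∀ j, ∀ t ∈ timeInterval T, Tendsto (fun x => rep u uinf (fun t x => (e j t x : E))
      (t, x)) atBot (𝓝 (einf j : E)) := fun j t ht =>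
    (tendsto_tangentBundle_iff.1 (he.tendsto j t ht)).2
  refine ⟨hs, hp, fun z hz i j => ?_, fun j z hz => ?_, ht, fun j t htI => ?_⟩
  · exact compAt_eq_ite (he.metric hz i j).1 (he.metric hz i j).2
  · simpa using (he.metric hz j j).1
  · obtain ⟨V, hVs, hVp, hVt, hV0⟩ := hu.exists_parallel hK hflow (einf j : E)
    have heq : ∀ z ∈ timeInterval T ×ˢ (univ : Set ℝ), V z.1 z.2 = (e j z.1 z.2 : E) :=
      fun z hz => hu.eq_of_parallel hK hVs (hs j) hz.1 (hVp z.1 hz.1)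
        (fun x => hp j (z.1, x) (hu.mem hz.1)) (hVt z.1 hz.1) (ht j z.1 hz.1) z.2
    refine (hV0 t htI).congr fun x => ?_
    rw [rep, hu.map.nab_congr h heq (hu.mem htI)]
    rfl

/-- Inner products of parallel fields are constant in x, so the orthonormality relations at u^∞
persist. The fields iV_j are covered as well, being parallel by ∇J = 0. -/
lemma exists_isParallelFrame [T2Space N] [CompactSpace N] {T : EReal} (hK : IsKahler h)
    (hu : DecayingMap h (timeInterval T) uinf u) {einf : Fin n → TangentSpace 𝓘(ℝ, E) uinf}
    (heinf : IsUnitaryFrame h einf) {a lam b c : ℝ}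
    (hflow : ∀ z ∈ spaceTime T, vel E u (1, 0) z.1 z.2 = flowField h a lam b c u z.1 z.2) :
    ∃ e : Fin n → VF E u, IsParallelFrame h T u einf e := by
  choose V hVs hVp hVt hV0 using fun j => hu.exists_parallel hK hflow (einf j : E)
  have hIs := fun j => hu.map.smooth_const_smul Complex.I (hVs j)
  have hIp : ∀ j, ∀ t ∈ timeInterval T, ∀ x,
      nab h u (0, 1) (fun t x => Complex.I • V j t x) t x = 0 := fun j t ht x => by
    have := hu.map.nab_const_smul h hK Complex.I (hVs j) (hu.mem (x := x) ht) (0, 1)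
    rw [hVp j t ht, smul_zero] at this
    exact this
  have hIt : ∀ j, ∀ t ∈ timeInterval T, Tendsto (fun x => rep u uinf
      (fun t x => Complex.I • V j t x) (t, x)) atBot (𝓝 (J (einf j))) := by
    intro j t ht
    refine ((hVt j t ht).const_smul Complex.I).congr' ?_
    filter_upwards [hu.eventually_mem_source ht] with x hx
    exact (toChart_smul hx _ _).symm
  refine ⟨fun j t x => V j t x, fun j => hu.map.smoothField_iff.1 (hVs j), fun t ht x i j => ?_,
    fun j t ht x => ?_, fun j t ht => tendsto_tangentBundle_iff.2 ⟨hu.tendsto t ht, hVt j t ht⟩⟩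
  · have h1 := hu.inner_of_parallel (hVs i) (hVs j) ht (hVp i t ht) (hVp j t ht) (hVt i t ht)
      (hVt j t ht) x
    have h2 := hu.inner_of_parallel (hVs i) (hIs j) ht (hVp i t ht) (hIp j t ht) (hVt i t ht)
      (hIt j t ht) x
    have h3 := hu.inner_of_parallel (hIs i) (hIs j) ht (hIp i t ht) (hIp j t ht) (hIt i t ht)
      (hIt j t ht) x
    have h0 := heinf i j
    exact ⟨h1.trans h0.1, h2.trans h0.2.1, h3.trans h0.2.2⟩
  · have := hu.map.nablaX_eq h (hVs j) (hu.mem (x := x) ht)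
    rw [hVp j t ht] at this
    exact this

end MainTheorem

end KahlerFlow
end

/-! ### The theorem -/

open KahlerFlow in
theorem theorem1
    {E : Type*} [NormedAddCommGroup E] [NormedSpace ℂ E] [FiniteDimensional ℂ E]
    {N : Type*} [TopologicalSpace N] [T2Space N] [CompactSpace N]
    [ChartedSpace E N] [IsManifold 𝓘(ℂ, E) ω N]
    (n : ℕ) (hn : Module.finrank ℂ E = n)
    (h : RMetric E N) (hK : IsKahler h)
    (a lam b c : ℝ) (ha : a ≠ 0) (T : EReal) (hT : 0 < T)
    (uinf : N) (u : ℝ → ℝ → N) (hu : IsAdmissible h T uinf u)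
    (hsol : IsSolution h a lam b c T u)
    (einf : Fin n → TangentSpace 𝓘(ℝ, E) uinf) (heinf : IsUnitaryFrame h einf) :
    (∃ e : Fin n → VF E u, IsParallelFrame h T u einf e) ∧
    ∀ e : Fin n → VF E u, IsParallelFrame h T u einf e →
      (∀ j, ContDiffOn ℝ ∞ (fun z : ℝ × ℝ => Qfun h e j z.1 z.2) (spaceTime T)) ∧
      (∀ j p q r, ContDiffOn ℝ ∞ (fun z : ℝ × ℝ => Sfun h e j p q r z.1 z.2) (spaceTime T)) ∧
      ∀ j, ∀ t ∈ timeInterval T, ∀ x : ℝ,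
        (∀ r, MeasureTheory.IntegrableOn
          (f1 b c (Sfun h e) (Qfun h e) j r t) (Set.Iic x)) ∧
        (∀ r, MeasureTheory.IntegrableOn
          (f2 a lam (Sfun h e) (Qfun h e) j r t) (Set.Iic x)) ∧
        SystemEq a lam b c (Sfun h e) (Qfun h e) j t x := by
  have hd := hu.decayingMap
  have hflow := flow_eq hd.map hsol
  refine ⟨exists_isParallelFrame hK hd heinf hflow, fun e he => ?_⟩
  have hfr := he.unitaryFrame hK hd hflow
  have hQ : ∀ j, ∀ z ∈ timeInterval T ×ˢ (Set.univ : Set ℝ), Qfun h e j z.1 z.2 =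
      compField h u (vel E u (0, 1)) (fun t x => (e j t x : E)) z.1 z.2 := by
    intro j z hz
    exact congrArg (fun v : E => compAt h (u z.1 z.2) v (e j z.1 z.2)) (hd.map.velX_eq hz)
  have hS : Sfun h e = curvCoeff h u (fun j t x => (e j t x : E)) := by
    funext j p q r
    exact Sfun_eq hK e j p q r
  rw [hS]
  exact ⟨fun j => (hfr.flowFn_component hd hQ j).contDiffOn,
    fun j p q r => (hfr.flowFn_curvCoeff hd j p q r).contDiffOn,
    fun j t ht x => hfr.systemEq hd hK hn hflow hQ j ht x⟩
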